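/- Let $s=(s_1,s_2,s_3)\in\mathbb R(t)^3$ and $R\in\mathbb R(t)$, and let $\Sigma(t):\ |x-s(t)|^2-R(t)=0$ be the corresponding one-parameter family of spheres with centers $s(t)$ and squared radii $R(t)$. Assume that $s$ is a proper (i.e. generically injective over $\mathbb C$) parameterization of the spine curve $S\subset\mathbb P^3_{\mathbb C}$, the projective closure of the set of the points $s(t)$. For $t\in\mathbb C$ let $\Sigma'(t):\ -2\,s'(t)\cdot(x-s(t))-R'(t)=0$ be the plane obtained by differentiating $\Sigma(t)$ with respect to $t$, and let $C_{s(t)}=\Sigma(t)\cap\Sigma'(t)\subset\mathbb P^3_{\mathbb C}$ (the intersection of the projective closures) be the characteristic circle at $s(t)$. Assume that it is a genuine circle for generic $t$, i.e. neither $s'\cdot s'$ nor $4R\,(s'\cdot s')-(R')^2$ vanishes identically. Let $X\subset\mathbb P^3_{\mathbb C}$ be the rational canal surface of this family, i.e. the Zariski closure of the union of the characteristic circles $C_{s(t)}$ over those $t$ that are not poles of $s$ or $R$ and satisfy $s'(t)\cdot s'(t)\neq0$ and $4R(t)\,(s'(t)\cdot s'(t))\ne R'(t)^2$; assume that $X$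 is indeed a surface, the zero set of a homogeneous polynomial with real coefficients. Then for every plane $E\subset\mathbb P^3_{\mathbb C}$ outside a proper Zariski closed subset of the dual projective space, with plane section $H=X\cap E$, there is a rational map $\xi:H\dashrightarrow S$ (defined on a dense subset of $H$) which is coherent: for all but finitely many points $q\in S$, the fiber $\xi^{-1}(q)$ is equal to $E\cap C_q$, and this set consists of exactly two points. -/

import Mathlib

open scoped LinearAlgebra.Projectivization

noncomputable section

/-- Complex projective 3-space with homogeneous coordinates `(W : X : Y : Z)`. The affine point
`(x, y, z)` is `(1 : x : y : z)`, and `W = 0` is the ideal plane. -/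
abbrev P3 : Type := ℙ ℂ (Fin 4 → ℂ)

/-- The zero set in `P3` of a polynomial; it is used for homogeneous polynomials only, for which
the choice of the representative is irrelevant. -/
def projZeros (f : MvPolynomial (Fin 4) ℂ) : Set P3 :=
  {p | MvPolynomial.eval p.rep f = 0}

/-- The Zariski closure of a set of points in `P3`. -/
def zariskiClosure (A : Set P3) : Set P3 :=
  {p | ∀ (d : ℕ) (f : MvPolynomial (Fin 4) ℂ), f.IsHomogeneous d → A ⊆ projZeros f →
    p ∈ projZeros f}

/-- The plane `h₀ W + h₁ X + h₂ Y + h₃ Z = 0` in `P3`. -/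
def planeOf (h : Fin 4 → ℂ) : Set P3 :=
  {p | ∑ i, h i * p.rep i = 0}

/-- `P` holds for a generic plane: for all planes outside a proper Zariski closed subset of the
dual projective space. -/
def ForGenericPlane (P : (Fin 4 → ℂ) → Prop) : Prop :=
  ∃ (d : ℕ) (G : MvPolynomial (Fin 4) ℂ), G.IsHomogeneous d ∧ G ≠ 0 ∧
    ∀ h : Fin 4 → ℂ, h ≠ 0 → MvPolynomial.eval h G ≠ 0 → P h

/-- The value of a real rational function at a complex number (meaningful away from poles). -/
def ratVal (f : RatFunc ℝ) (t : ℂ) : ℂ :=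
  RatFunc.eval (algebraMap ℝ ℂ) t f

/-- The derivative of a real rational function at a complex number (away from poles). -/
def ratDeriv (f : RatFunc ℝ) (t : ℂ) : ℂ :=
  deriv (fun z => ratVal f z) t

/-- `t` is not a pole of `f`. -/
def RegularAt (f : RatFunc ℝ) (t : ℂ) : Prop :=
  Polynomial.aeval t f.denom ≠ 0

/-- A rationally parameterized squared medial axis transform: the centers `s(t)` and the squared
radii `R(t)` of a one-parameter family of spheres. -/
structure SquaredMAT where
  s : Fin 3 → RatFunc ℝ
  R : RatFunc ℝ

namespace SquaredMAT

variable (M : SquaredMAT)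

/-- The point `s(t)`, as a point of `P3`. -/
def spinePoint (t : ℂ) : P3 :=
  Projectivization.mk ℂ (Fin.cons 1 (fun i => ratVal (M.s i) t) : Fin 4 → ℂ)
    (fun h => one_ne_zero (α := ℂ) (by simpa using congrFun h 0))

/-- The spine curve: the projective closure of the curve traced by the centers. -/
def spine : Set P3 :=
  zariskiClosure {q | ∃ t : ℂ, (∀ i, RegularAt (M.s i) t) ∧ M.spinePoint t = q}

/-- `s(t)` is a proper (generically injective) parameterization of the spine curve. -/
def Proper : Prop :=
  ∃ E : Set ℂ, E.Finite ∧ Set.InjOn (fun (t : ℂ) (i : Fin 3) => ratVal (M.s i) t) Eᶜ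

/-- The homogenized sphere `Σ(t) : |x - s(t)|² - R(t) = 0`. -/
def sphere (t : ℂ) : Set P3 :=
  {p | ∑ i : Fin 3, (p.rep i.succ - ratVal (M.s i) t * p.rep 0) ^ 2
      - ratVal M.R t * p.rep 0 ^ 2 = 0}

/-- The homogenized plane `Σ'(t) : -2 s'(t) · (x - s(t)) - R'(t) = 0`. -/
def normalPlane (t : ℂ) : Set P3 :=
  {p | -2 * ∑ i : Fin 3, ratDeriv (M.s i) t * (p.rep i.succ - ratVal (M.s i) t * p.rep 0)
      - ratDeriv M.R t * p.rep 0 = 0}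

/-- The characteristic circle `Σ(t) ∩ Σ'(t)`. -/
def charCircle (t : ℂ) : Set P3 :=
  M.sphere t ∩ M.normalPlane t

/-- The parameters at which the characteristic circle is a genuine circle: `t` is not a pole,
`s' · s' ≠ 0` (so that the plane `Σ'(t)` meets the absolute conic in two distinct points), and
`4 R (s' · s') ≠ R' ^ 2` (so that the plane is not tangent to the sphere, that is, the conic is
not a pair of lines). -/
def Admissible (t : ℂ) : Prop :=
  (∀ i, RegularAt (M.s i) t) ∧ RegularAt M.R t ∧
    ∑ i, ratDeriv (M.s i) t ^ 2 ≠ 0 ∧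
    4 * ratVal M.R t * ∑ i, ratDeriv (M.s i) t ^ 2 ≠ ratDeriv M.R t ^ 2

/-- The characteristic circle that corresponds to a point `q` of the spine curve (for a proper
parameterization there is, for all but finitely many `q`, at most one parameter `t`). -/
def charCircleAt (q : P3) : Set P3 :=
  {p | ∃ t : ℂ, M.Admissible t ∧ M.spinePoint t = q ∧ p ∈ M.charCircle t}

/-- `X` is the canal surface of the family: a surface in `P3`, defined by a real polynomial, which
is the projective closure of the union of the characteristic circles. -/
def IsCanalSurface (X : Set P3) : Prop :=
  (∃ t : ℂ, M.Admissible t) ∧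
  X = zariskiClosure {p | ∃ t : ℂ, M.Admissible t ∧ p ∈ M.charCircle t} ∧
  ∃ (d : ℕ) (F : MvPolynomial (Fin 4) ℝ), F.IsHomogeneous d ∧
    X = projZeros (MvPolynomial.map (algebraMap ℝ ℂ) F)

end SquaredMAT

/-- A rational map `H ⇢ S` between closed subsets of `P3`: four forms of the same degree which
have no common zero on a Zariski dense subset of `H`, and which map that subset into `S`. -/
structure RationalMap (H S : Set P3) where
  degree : ℕ
  coord : Fin 4 → MvPolynomial (Fin 4) ℂ
  homogeneous : ∀ i, (coord i).IsHomogeneous degree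
  dense : H ⊆ zariskiClosure
    {p | p ∈ H ∧ (fun i => MvPolynomial.eval p.rep (coord i)) ≠ 0}
  mapsTo : ∀ p ∈ H, ∀ hp : (fun i => MvPolynomial.eval p.rep (coord i)) ≠ 0,
    Projectivization.mk ℂ (fun i => MvPolynomial.eval p.rep (coord i)) hp ∈ S

/-- The fiber of a rational map: the points at which it is defined and takes the value `q`. -/
def RationalMap.fiber {H S : Set P3} (ξ : RationalMap H S) (q : P3) : Set P3 :=
  {p | p ∈ H ∧ ∃ hp : (fun i => MvPolynomial.eval p.rep (ξ.coord i)) ≠ 0,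
    Projectivization.mk ℂ (fun i => MvPolynomial.eval p.rep (ξ.coord i)) hp = q}

/-- A rational map from the section `H` by the plane `h` to the spine curve is coherent if its
fiber at a generic point `q` of the spine curve consists of the two points in which the plane
meets the characteristic circle of `q`. -/
def IsCoherent (M : SquaredMAT) (h : Fin 4 → ℂ) {H : Set P3} (ξ : RationalMap H M.spine) : Prop :=
  ∃ T : Set P3, T.Finite ∧ ∀ q ∈ M.spine, q ∉ T →
    ξ.fiber q = planeOf h ∩ M.charCircleAt q ∧ (planeOf h ∩ M.charCircleAt q).ncard = 2

end

/-! The main point is that a generic point of X lies on only one characteristic circle. Its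
parameter is then a rational function a/b of the point, and ξ sends p to the center s(a(p)/b(p)).

Geometric reason. X is the envelope of the family, so every sphere touches X along its circle. If
the generic point of X were on the circles of two parameters τ ≠ τ', then both spheres would have
the tangent plane of X there and would be tangent to each other. They are not concentric, because
the spine is properly parameterized. Hence the point of contact is algebraic over τ, τ' and the
homogenizing coordinate. The affine cone over the surface X has dimension three, so τ and τ' are
algebraically independent, and the tangency condition, a polynomial in the two parameters, holds
identically: all spheres of the family are tangent to each other. This is false for nearby
parameters. The condition for t and u is divisible by (u - t)², and at u = t the quotient is a
nonzero multiple of 4R(s'·s') - R'², which does not vanish for a genuine circle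
(`exists_not_tangent`).

Algebraic form. Denominators are cleared, so the cone over a circle is given by `quad` and `lin`,
polynomials in the point and in t. The ideal `idl` of the union of these cones is prime
(`idl_isPrime`): a generic plane meets a generic circle in two points, at both of which a form that
is not identically zero on the circles is nonzero (`exists_generic_section`). As X is the zero set
of one polynomial, `idl` is generated by one element, zero or irreducible (`idl_eq_span`); zero is
excluded in `IsGenericPoint.ne_zero`. Let K be the fraction field of the coordinate ring and Ω its
algebraic closure. The generic point has a circle parameter τ in Ω (`IsGenericPoint.exists_param`),
and only one (`IsGenericPoint.param_unique`, with tangency to X from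
`IsGenericPoint.exists_polar_eq`). All conjugates of τ over K are circle parameters too, so τ is in
K (`IsGenericPoint.exists_rational_param`).

Three finiteness and genericity facts turn this into a coherent map. All but finitely many points of
the spine are centers (`SquaredMAT.exists_finite_spine`). A generic plane section of X has no
component on which ξ is undefined (`exists_generic_dense`). For a generic plane, all but finitely
many circles have two section points, with b nonzero at both (`exists_generic_section` again).
Conversely, a point of X with b ≠ 0 lies on the circle of a/b (`mem_circleCone_of_inverse`), so the
fibers contain nothing else. -/

noncomputable section

/-! ### Families of spheres with cleared denominators -/

/-- A family of spheres with centers `ctr i / den` and squared radii `rad / den`. -/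
structure SphereFamily where
  den : Polynomial ℂ
  rad : Polynomial ℂ
  ctr : Fin 3 → Polynomial ℂ

namespace SphereFamily

open Polynomial

variable (S : SphereFamily)

/-- The numerator of the derivative of the center, over the denominator `den ^ 2`. -/
def vel (i : Fin 3) : ℂ[X] := derivative (S.ctr i) * S.den - S.ctr i * derivative S.den

/-- The numerator of the derivative of the squared radius, over the denominator `den ^ 2`. -/
def radVel : ℂ[X] := derivative S.rad * S.den - S.rad * derivative S.den

/-- The numerator of the squared speed of the center, over the denominator `den ^ 4`. -/
def speed : ℂ[X] := ∑ i, S.vel i ^ 2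

/-- The polynomial whose roots are the parameters without a genuine characteristic circle. -/
def bad : ℂ[X] := S.den * S.speed * (4 * S.rad * S.speed - S.den * S.radVel ^ 2)

section Eval

variable {A B : Type*} [CommRing A] [Algebra ℂ A] [CommRing B] [Algebra ℂ B]

/-- The position of a point relative to the center, times `den`. -/
def off (p : Fin 4 → A) (t : A) (i : Fin 3) : A :=
  aeval t S.den * p i.succ - aeval t (S.ctr i) * p 0

/-- The equation of the sphere at the parameter `t`, times `den ^ 2`. -/
def quad (p : Fin 4 → A) (t : A) : A :=
  ∑ i, S.off p t i ^ 2 - aeval t S.den * aeval t S.rad * p 0 ^ 2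

/-- The equation of the plane of the characteristic circle, times `den ^ 3`. -/
def lin (p : Fin 4 → A) (t : A) : A :=
  -2 * ∑ i, aeval t (S.vel i) * S.off p t i - aeval t S.den * aeval t S.radVel * p 0

theorem map_off (f : A →ₐ[ℂ] B) (p : Fin 4 → A) (t : A) (i : Fin 3) :
    f (S.off p t i) = S.off (fun i => f (p i)) (f t) i := by
  simp [off, aeval_algHom_apply]

theorem map_quad (f : A →ₐ[ℂ] B) (p : Fin 4 → A) (t : A) :
    f (S.quad p t) = S.quad (fun i => f (p i)) (f t) := by
  simp [quad, map_off, aeval_algHom_apply]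

theorem map_lin (f : A →ₐ[ℂ] B) (p : Fin 4 → A) (t : A) :
    f (S.lin p t) = S.lin (fun i => f (p i)) (f t) := by
  simp only [lin, map_sub, map_mul, map_neg, map_ofNat, map_sum, map_off, aeval_algHom_apply]

theorem off_smul (c : A) (p : Fin 4 → A) (t : A) (i : Fin 3) :
    S.off (c • p) t i = c * S.off p t i := by
  simp only [off, Pi.smul_apply, smul_eq_mul]; ring

theorem quad_smul (c : A) (p : Fin 4 → A) (t : A) : S.quad (c • p) t = c ^ 2 * S.quad p t := by
  simp only [quad, off_smul, Fin.sum_univ_three, Pi.smul_apply, smul_eq_mul]; ring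

theorem lin_smul (c : A) (p : Fin 4 → A) (t : A) : S.lin (c • p) t = c * S.lin p t := by
  simp only [lin, off_smul, Fin.sum_univ_three, Pi.smul_apply, smul_eq_mul]; ring

end Eval

/-- The affine cone over the characteristic circle at `t`. -/
def circleCone (t : ℂ) : Set (Fin 4 → ℂ) := {v | S.quad v t = 0 ∧ S.lin v t = 0}

/-- The union of the affine cones over the genuine characteristic circles. -/
def cone : Set (Fin 4 → ℂ) := {v | ∃ t, S.bad.eval t ≠ 0 ∧ v ∈ S.circleCone t}

theorem smul_mem_circleCone {t : ℂ} {v : Fin 4 → ℂ} (c : ℂ) (hv : v ∈ S.circleCone t) :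
    c • v ∈ S.circleCone t := by
  refine ⟨?_, ?_⟩
  · rw [quad_smul, hv.1, mul_zero]
  · rw [lin_smul, hv.2, mul_zero]

theorem den_ne_zero {t : ℂ} (ht : S.bad.eval t ≠ 0) : S.den.eval t ≠ 0 := by
  intro h; apply ht; simp [bad, h]

theorem speed_ne_zero {t : ℂ} (ht : S.bad.eval t ≠ 0) : ∑ i, (S.vel i).eval t ^ 2 ≠ 0 := by
  intro h; apply ht; simp [bad, speed, eval_finsetSum, h]

theorem discr_ne_zero {t : ℂ} (ht : S.bad.eval t ≠ 0) :
    4 * S.rad.eval t * ∑ i, (S.vel i).eval t ^ 2 - S.den.eval t * S.radVel.eval t ^ 2 ≠ 0 := by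
  intro h; apply ht
  simp only [bad, speed, eval_mul, eval_sub, eval_pow, eval_finsetSum, eval_ofNat]
  rw [h, mul_zero]

end SphereFamily

/-! ### Isotropic vectors in a nondegenerate plane -/

/-- In the orthogonal complement of a non-isotropic vector of `ℂ³` there is a hyperbolic pair. -/
theorem exists_hyperbolic_pair (n : Fin 3 → ℂ) (hn : n ⬝ᵥ n ≠ 0) :
    ∃ e f : Fin 3 → ℂ, n ⬝ᵥ e = 0 ∧ n ⬝ᵥ f = 0 ∧ e ⬝ᵥ e = 0 ∧ f ⬝ᵥ f = 0 ∧ e ⬝ᵥ f = 1 ∧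
      ∀ x, n ⬝ᵥ x = 0 → x = (x ⬝ᵥ f) • e + (x ⬝ᵥ e) • f := by
  -- The three vectors n × eᵢ lie in the complement and their squares add up to 2(n·n), so they are
  -- not all isotropic.
  obtain ⟨w, hw, hww⟩ : ∃ w : Fin 3 → ℂ, n ⬝ᵥ w = 0 ∧ w ⬝ᵥ w ≠ 0 := by
    by_contra! H
    have h1 := H ![0, n 2, -n 1] (by simp [dotProduct, Fin.sum_univ_three]; ring)
    have h2 := H ![-n 2, 0, n 0] (by simp [dotProduct, Fin.sum_univ_three]; ring)
    have h3 := H ![n 1, -n 0, 0] (by simp [dotProduct, Fin.sum_univ_three]; ring)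
    simp [dotProduct, Fin.sum_univ_three] at h1 h2 h3 hn
    apply hn; linear_combination (h1 + h2 + h3) / 2
  -- As c²(n·n) = -1, the vector c(n × w) is orthogonal to w and has square -(w·w). Hence w ± c(n ×
  -- w) are isotropic, with product 2(w·w), which the scalar in the second vector normalizes to 1.
  obtain ⟨c, hc⟩ := IsAlgClosed.exists_pow_nat_eq (-(n ⬝ᵥ n)⁻¹) two_pos
  have hc' : c ^ 2 * (n ⬝ᵥ n) = -1 := by rw [hc]; field_simp
  refine ⟨w + c • crossProduct n w, (2 * (w ⬝ᵥ w))⁻¹ • (w - c • crossProduct n w), ?_, ?_, ?_, ?_,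
    ?_, ?_⟩
  · rw [dotProduct_add, hw, dotProduct_smul, dot_self_cross, smul_zero, add_zero]
  · rw [dotProduct_smul, dotProduct_sub, hw, dotProduct_smul, dot_self_cross, smul_zero, sub_zero,
      smul_zero]
  · simp only [dotProduct, Fin.sum_univ_three, cross_apply, Pi.add_apply, Pi.smul_apply,
      smul_eq_mul, Matrix.cons_val] at hw hc' ⊢
    linear_combination (w 0 ^ 2 + w 1 ^ 2 + w 2 ^ 2) * hc' -
      c ^ 2 * (n 0 * w 0 + n 1 * w 1 + n 2 * w 2) * hw
  · rw [smul_dotProduct, dotProduct_smul]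
    convert! smul_zero _
    convert! smul_zero _
    simp only [dotProduct, Fin.sum_univ_three, cross_apply, Pi.sub_apply, Pi.smul_apply,
      smul_eq_mul, Matrix.cons_val] at hw hc' ⊢
    linear_combination (w 0 ^ 2 + w 1 ^ 2 + w 2 ^ 2) * hc' -
      c ^ 2 * (n 0 * w 0 + n 1 * w 1 + n 2 * w 2) * hw
  · rw [dotProduct_smul, smul_eq_mul, inv_mul_eq_one₀ (mul_ne_zero two_ne_zero hww)]
    simp only [dotProduct, Fin.sum_univ_three, cross_apply, Pi.sub_apply, Pi.add_apply,
      Pi.smul_apply, smul_eq_mul, Matrix.cons_val] at hw hc' ⊢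
    linear_combination (w 0 ^ 2 + w 1 ^ 2 + w 2 ^ 2) * hc' -
      c ^ 2 * (n 0 * w 0 + n 1 * w 1 + n 2 * w 2) * hw
  · intro x hx
    -- The expansion of x in the orthogonal basis w, n × w of the complement.
    have key : ∀ i, (w ⬝ᵥ w) * x i =
        (x ⬝ᵥ w) * w i - c ^ 2 * (x ⬝ᵥ crossProduct n w) * crossProduct n w i := by
      intro i
      apply mul_left_cancel₀ hn
      have e1 : (n ⬝ᵥ n) * ((w ⬝ᵥ w) * x i) = (n ⬝ᵥ n) * ((x ⬝ᵥ w) * w i) +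
          (x ⬝ᵥ crossProduct n w) * crossProduct n w i := by
        fin_cases i <;>
        simp only [dotProduct, Fin.sum_univ_three, cross_apply, Matrix.cons_val, Fin.zero_eta,
          Fin.mk_one, Fin.reduceFinMk] at hw hx ⊢
        · linear_combination (n 0 * (w 0 * w 0 + w 1 * w 1 + w 2 * w 2) -
            w 0 * (n 0 * w 0 + n 1 * w 1 + n 2 * w 2)) * hx +
            ((n 0 * w 0 + n 1 * w 1 + n 2 * w 2) * x 0 -
            (x 0 * w 0 + x 1 * w 1 + x 2 * w 2) * n 0) * hw
        · linear_combination (n 1 * (w 0 * w 0 + w 1 * w 1 + w 2 * w 2) -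
            w 1 * (n 0 * w 0 + n 1 * w 1 + n 2 * w 2)) * hx +
            ((n 0 * w 0 + n 1 * w 1 + n 2 * w 2) * x 1 -
            (x 0 * w 0 + x 1 * w 1 + x 2 * w 2) * n 1) * hw
        · linear_combination (n 2 * (w 0 * w 0 + w 1 * w 1 + w 2 * w 2) -
            w 2 * (n 0 * w 0 + n 1 * w 1 + n 2 * w 2)) * hx +
            ((n 0 * w 0 + n 1 * w 1 + n 2 * w 2) * x 2 -
            (x 0 * w 0 + x 1 * w 1 + x 2 * w 2) * n 2) * hw
      linear_combination e1 + (x ⬝ᵥ crossProduct n w) * crossProduct n w i * hc'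
    ext i
    have h2 : (w ⬝ᵥ w) * x i = (w ⬝ᵥ w) * ((x ⬝ᵥ (2 * (w ⬝ᵥ w))⁻¹ • (w - c • crossProduct n w)) •
        (w + c • crossProduct n w) + (x ⬝ᵥ (w + c • crossProduct n w)) • (2 * (w ⬝ᵥ w))⁻¹ •
        (w - c • crossProduct n w)) i := by
      rw [key i]
      simp only [dotProduct_smul, dotProduct_sub, dotProduct_add, Pi.add_apply, Pi.smul_apply,
        Pi.sub_apply, smul_eq_mul]
      field_simp
      ring
    exact mul_left_cancel₀ hww h2

/-! ### Characteristic circles as conics -/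

namespace SphereFamily

open Polynomial

variable (S : SphereFamily)

theorem off_eq_eval (v : Fin 4 → ℂ) (t : ℂ) (i : Fin 3) :
    S.off v t i = S.den.eval t * v i.succ - (S.ctr i).eval t * v 0 := by
  simp [off, coe_aeval_eq_eval]

/-- The vector with a given first coordinate and given position relative to the center. -/
def ofOff (t x : ℂ) (w : Fin 3 → ℂ) : Fin 4 → ℂ :=
  Fin.cons x fun i => (w i + (S.ctr i).eval t * x) / S.den.eval t

theorem off_ofOff {t : ℂ} (ht : S.den.eval t ≠ 0) (x : ℂ) (w : Fin 3 → ℂ) :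
    S.off (S.ofOff t x w) t = w := by
  ext i
  simp only [off_eq_eval, ofOff, Fin.cons_succ, Fin.cons_zero]
  field_simp
  ring

theorem ofOff_off {t : ℂ} (ht : S.den.eval t ≠ 0) (v : Fin 4 → ℂ) :
    S.ofOff t (v 0) (S.off v t) = v := by
  ext i
  refine Fin.cases ?_ (fun i => ?_) i
  · simp [ofOff]
  · simp only [off_eq_eval, ofOff, Fin.cons_succ]
    field_simp
    ring

theorem smul_ofOff (t c x : ℂ) (w : Fin 3 → ℂ) : S.ofOff t (c * x) (c • w) = c • S.ofOff t x w := by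
  ext i
  refine Fin.cases ?_ (fun i => ?_) i
  · simp [ofOff]
  · simp only [ofOff, Fin.cons_succ, Pi.smul_apply, smul_eq_mul]
    ring

/-- The velocity of the center. -/
def velAt (t : ℂ) : Fin 3 → ℂ := fun i => (S.vel i).eval t

theorem mem_circleCone_iff_off {t : ℂ} {v : Fin 4 → ℂ} : v ∈ S.circleCone t ↔
    S.off v t ⬝ᵥ S.off v t = S.den.eval t * S.rad.eval t * v 0 ^ 2 ∧
    2 * (S.velAt t ⬝ᵥ S.off v t) = -(S.den.eval t * S.radVel.eval t * v 0) := by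
  simp only [circleCone, quad, lin, Set.mem_ofPred_eq, coe_aeval_eq_eval, dotProduct, velAt,
    Fin.sum_univ_three]
  constructor
  · rintro ⟨h1, h2⟩
    exact ⟨by linear_combination h1, by linear_combination -h2⟩
  · rintro ⟨h1, h2⟩
    exact ⟨by linear_combination h1, by linear_combination -h2⟩

/-- A conic parameterization of a characteristic circle: every vector in its affine cone is a
multiple of a point with parameter `τ`. -/
theorem exists_param {t : ℂ} (ht : S.bad.eval t ≠ 0) {v : Fin 4 → ℂ} (hv : v ∈ S.circleCone t) :
    ∃ (g e f : Fin 3 → ℂ) (k : ℂ), k ≠ 0 ∧ e ⬝ᵥ e = 0 ∧ f ⬝ᵥ f = 0 ∧ e ⬝ᵥ f = 1 ∧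
      (∀ τ : ℂ, S.ofOff t τ (τ • g + τ ^ 2 • e + k • f) ∈ S.circleCone t) ∧
      ∃ c τ : ℂ, v = c • S.ofOff t τ (τ • g + τ ^ 2 • e + k • f) := by
  have hα := S.den_ne_zero ht
  have hσ : S.velAt t ⬝ᵥ S.velAt t ≠ 0 := by
    simpa [dotProduct, velAt, sq] using S.speed_ne_zero ht
  have hκ : 4 * S.rad.eval t * (S.velAt t ⬝ᵥ S.velAt t) -
      S.den.eval t * S.radVel.eval t ^ 2 ≠ 0 := by
    simpa [dotProduct, velAt, sq] using S.discr_ne_zero ht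
  obtain ⟨e, f, hne, hnf, hee, hff, hef, hx⟩ := exists_hyperbolic_pair _ hσ
  set n := S.velAt t with hn
  set σ := n ⬝ᵥ n with hσd
  set α := S.den.eval t with hαd
  set r := S.radVel.eval t with hrd
  set q := S.rad.eval t with hqd
  -- Up to the factor `den`, the vector g below leads from the center of the sphere to the center of
  -- the circle, and 2k = αq - g·g is the squared radius of the circle times `den ^ 2`. In
  -- coordinates w = x g + a e + b f the circle is the conic ab = k x².
  set k := α * (4 * q * σ - α * r ^ 2) / (8 * σ) with hk
  have hk0 : k ≠ 0 := by
    rw [hk]; exact div_ne_zero (mul_ne_zero hα hκ) (mul_ne_zero (by norm_num) hσ)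
  set g := (-(α * r) / (2 * σ)) • n with hg
  have hgg : g ⬝ᵥ g = α * q - 2 * k := by
    rw [hg, hk, smul_dotProduct, dotProduct_smul, ← hσd, smul_eq_mul, smul_eq_mul]
    field_simp
    ring
  have hfe : f ⬝ᵥ e = 1 := by rw [dotProduct_comm, hef]
  have hng : n ⬝ᵥ g = -(α * r) / 2 := by
    rw [hg, dotProduct_smul, ← hσd, smul_eq_mul]; field_simp
  have hge : g ⬝ᵥ e = 0 := by rw [hg, smul_dotProduct, hne, smul_zero]
  have hgf : g ⬝ᵥ f = 0 := by rw [hg, smul_dotProduct, hnf, smul_zero]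
  have heg : e ⬝ᵥ g = 0 := by rw [dotProduct_comm, hge]
  have hfg : f ⬝ᵥ g = 0 := by rw [dotProduct_comm, hgf]
  have mem : ∀ x a b : ℂ, a * b = k * x ^ 2 →
      S.ofOff t x (x • g + a • e + b • f) ∈ S.circleCone t := by
    intro x a b hab
    rw [mem_circleCone_iff_off, S.off_ofOff hα]
    simp only [add_dotProduct, dotProduct_add, smul_dotProduct, dotProduct_smul, hgg, hge, hgf,
      heg, hfg, hee, hff, hef, hfe, smul_eq_mul, ← hn, hng, hne, hnf, ofOff, Fin.cons_zero]
    rw [← hαd, ← hqd, ← hrd]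
    exact ⟨by linear_combination 2 * hab, by ring⟩
  have hv' := S.mem_circleCone_iff_off.1 hv
  rw [← hαd, ← hqd, ← hrd, ← hn] at hv'
  set w := S.off v t with hw
  set a := (w - v 0 • g) ⬝ᵥ f with ha
  set b := (w - v 0 • g) ⬝ᵥ e with hb
  have hwab : w = v 0 • g + a • e + b • f := by
    have := hx (w - v 0 • g) (by
      rw [dotProduct_sub, dotProduct_smul, hng, smul_eq_mul]
      linear_combination hv'.2 / 2)
    rw [add_assoc, ← this]; abel
  have hab : 2 * (a * b) = 2 * k * v 0 ^ 2 := by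
    have := hv'.1
    rw [hwab] at this
    simp only [add_dotProduct, dotProduct_add, smul_dotProduct, dotProduct_smul, hgg, hge, hgf,
      heg, hfg, hee, hff, hef, hfe, smul_eq_mul] at this
    linear_combination this
  have hab' : a * b = k * v 0 ^ 2 := by linear_combination hab / 2
  have hveq : v = S.ofOff t (v 0) (v 0 • g + a • e + b • f) := by
    rw [← hwab, hw, S.ofOff_off hα]
  -- The parameterization (x : a : b) = (τ : τ² : k) misses b = 0. There x = 0, and exchanging e and
  -- f brings the point to τ = 0.
  by_cases hb0 : b = 0
  · have hv0 : v 0 = 0 := by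
      rw [hb0, mul_zero] at hab'
      simpa [hk0] using hab'.symm
    refine ⟨g, f, e, k, hk0, hff, hee, hfe, fun τ => ?_, a / k, 0, ?_⟩
    · have := mem τ k (τ ^ 2) (by ring)
      convert this using 2; abel
    · have h3 : a / k * k = a := div_mul_cancel₀ _ hk0
      conv_lhs => rw [hveq, hv0, hb0]
      clear_value w a b k g
      rw [← smul_ofOff]
      congr 1
      · simp
      · rw [smul_add, smul_smul, h3]
        simp
  · refine ⟨g, e, f, k, hk0, hee, hff, hef, fun τ => mem τ (τ ^ 2) k (by ring), b / k,
      v 0 * k / b, ?_⟩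
    conv_lhs => rw [hveq]
    clear_value w a b k g
    have h1 : b / k * (v 0 * k / b) = v 0 := by field_simp
    have h2 : b / k * (v 0 * k / b) ^ 2 = a := by field_simp; linear_combination -hab'
    have h3 : b / k * k = b := div_mul_cancel₀ _ hk0
    rw [← smul_ofOff, h1, smul_add, smul_add, smul_smul, smul_smul, smul_smul, h1, h2, h3]

end SphereFamily

theorem eval_smul_of_isHomogeneous {σ R : Type*} [CommRing R] {f : MvPolynomial σ R} {d : ℕ}
    (hf : f.IsHomogeneous d) (c : R) (v : σ → R) :
    MvPolynomial.eval (c • v) f = c ^ d * MvPolynomial.eval v f := by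
  rw [MvPolynomial.eval_eq, MvPolynomial.eval_eq, Finset.mul_sum]
  refine Finset.sum_congr rfl fun m hm => ?_
  have h : m.degree = d := by
    rw [Finsupp.degree_eq_weight_one]; exact hf (MvPolynomial.mem_support_iff.1 hm)
  rw [Finsupp.degree_apply] at h
  simp only [Pi.smul_apply, smul_eq_mul, mul_pow, Finset.prod_mul_distrib, Finset.prod_pow_eq_pow_sum]
  rw [h]
  ring

/-! ### Polynomial functions of a parameter and a plane -/

/-- Functions of `t` and `h` that are polynomial in both. -/
def IsPolyFun (F : ℂ → (Fin 4 → ℂ) → ℂ) : Prop :=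
  ∃ P : Polynomial (MvPolynomial (Fin 4) ℂ),
    ∀ t h, (P.map (MvPolynomial.eval h)).eval t = F t h

namespace IsPolyFun

variable {F G : ℂ → (Fin 4 → ℂ) → ℂ}

theorem const (c : ℂ) : IsPolyFun fun _ _ => c :=
  ⟨Polynomial.C (MvPolynomial.C c), fun t h => by simp⟩

theorem param (p : Polynomial ℂ) : IsPolyFun fun t _ => p.eval t :=
  ⟨p.map MvPolynomial.C, fun t h => by
    rw [Polynomial.map_map, show (MvPolynomial.eval h).comp MvPolynomial.C = RingHom.id ℂ by
      ext; simp, Polynomial.map_id]⟩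

theorem coord (i : Fin 4) : IsPolyFun fun _ h => h i :=
  ⟨Polynomial.C (MvPolynomial.X i), fun t h => by simp⟩

theorem add (hF : IsPolyFun F) (hG : IsPolyFun G) : IsPolyFun fun t h => F t h + G t h := by
  obtain ⟨P, hP⟩ := hF
  obtain ⟨Q, hQ⟩ := hG
  exact ⟨P + Q, fun t h => by simp [hP, hQ]⟩

theorem mul (hF : IsPolyFun F) (hG : IsPolyFun G) : IsPolyFun fun t h => F t h * G t h := by
  obtain ⟨P, hP⟩ := hF
  obtain ⟨Q, hQ⟩ := hG
  exact ⟨P * Q, fun t h => by simp [hP, hQ]⟩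

theorem neg (hF : IsPolyFun F) : IsPolyFun fun t h => -F t h := by
  obtain ⟨P, hP⟩ := hF
  exact ⟨-P, fun t h => by simp [hP]⟩

theorem sub (hF : IsPolyFun F) (hG : IsPolyFun G) : IsPolyFun fun t h => F t h - G t h := by
  simpa only [sub_eq_add_neg] using hF.add hG.neg

theorem pow (hF : IsPolyFun F) (n : ℕ) : IsPolyFun fun t h => F t h ^ n := by
  obtain ⟨P, hP⟩ := hF
  exact ⟨P ^ n, fun t h => by simp [hP]⟩

theorem div_const (hF : IsPolyFun F) (c : ℂ) : IsPolyFun fun t h => F t h / c := by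
  simpa only [div_eq_mul_inv] using hF.mul (const c⁻¹)

/-- A polynomial on the line through `a` in the direction `b`, split into its even and odd part. -/
theorem exists_even_odd {a b : Fin 4 → ℂ → (Fin 4 → ℂ) → ℂ} {δ : ℂ → (Fin 4 → ℂ) → ℂ}
    (ha : ∀ i, IsPolyFun (a i)) (hb : ∀ i, IsPolyFun (b i)) (hδ : IsPolyFun δ)
    (f : MvPolynomial (Fin 4) ℂ) :
    ∃ e₀ e₁ : ℂ → (Fin 4 → ℂ) → ℂ, IsPolyFun e₀ ∧ IsPolyFun e₁ ∧ ∀ t h z, z ^ 2 = δ t h →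
      MvPolynomial.eval (fun i => a i t h + z * b i t h) f = e₀ t h + z * e₁ t h := by
  induction f using MvPolynomial.induction_on with
  | C c => exact ⟨_, _, const c, const 0, fun t h z _ => by simp⟩
  | add p q hp hq =>
    obtain ⟨e₀, e₁, h0, h1, he⟩ := hp
    obtain ⟨e₀', e₁', h0', h1', he'⟩ := hq
    refine ⟨_, _, h0.add h0', h1.add h1', fun t h z hz => ?_⟩
    rw [map_add, he t h z hz, he' t h z hz]; ring
  | mul_X p i hp =>
    obtain ⟨e₀, e₁, h0, h1, he⟩ := hp
    refine ⟨_, _, (h0.mul (ha i)).add (hδ.mul (h1.mul (hb i))), (h0.mul (hb i)).add (h1.mul (ha i)),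
      fun t h z hz => ?_⟩
    rw [map_mul, he t h z hz, MvPolynomial.eval_X, ← hz]; ring

end IsPolyFun

/-- The orthogonal complement of two vectors is spanned by their cross product. -/
theorem eq_smul_of_perp {n h x : Fin 3 → ℂ} (hn : n ⬝ᵥ x = 0) (hh : h ⬝ᵥ x = 0)
    (hm : crossProduct n h ⬝ᵥ crossProduct n h ≠ 0) : ∃ c : ℂ, x = c • crossProduct n h := by
  refine ⟨(x ⬝ᵥ crossProduct n h) / (crossProduct n h ⬝ᵥ crossProduct n h), ?_⟩
  have key : ∀ i, (crossProduct n h ⬝ᵥ crossProduct n h) * x i =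
      (x ⬝ᵥ crossProduct n h) * crossProduct n h i := by
    intro i
    -- The triple product expansion (n × h) × x = (n·x)h - (h·x)n; vectors with zero cross product
    -- with a non-isotropic m are multiples of m.
    have h1 : crossProduct (crossProduct n h) x = 0 := by
      ext i
      fin_cases i <;>
      simp only [dotProduct, Fin.sum_univ_three, cross_apply, Matrix.cons_val, Fin.zero_eta,
        Fin.mk_one, Fin.reduceFinMk, Pi.zero_apply] at hn hh ⊢
      · linear_combination h 0 * hn - n 0 * hh
      · linear_combination h 1 * hn - n 1 * hh
      · linear_combination h 2 * hn - n 2 * hh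
    generalize crossProduct n h = m at h1
    have a0 := congrFun h1 0
    have a1 := congrFun h1 1
    have a2 := congrFun h1 2
    simp only [cross_apply, Matrix.cons_val, Pi.zero_apply] at a0 a1 a2
    fin_cases i <;>
    simp only [dotProduct, Fin.sum_univ_three, Fin.zero_eta, Fin.mk_one, Fin.reduceFinMk]
    · linear_combination m 2 * a1 - m 1 * a2
    · linear_combination m 0 * a2 - m 2 * a0
    · linear_combination m 1 * a0 - m 0 * a1
  ext i
  rw [Pi.smul_apply, smul_eq_mul, div_mul_eq_mul_div, eq_div_iff hm, mul_comm, key i]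

/-! ### Sections of a characteristic circle by a plane -/

namespace SphereFamily

open Polynomial

variable (S : SphereFamily)

/-- A direction vector of the intersection of the plane of the circle with the plane `h`. -/
def secDir (t : ℂ) (h : Fin 4 → ℂ) : Fin 3 → ℂ := crossProduct (S.velAt t) fun i => h i.succ

/-- The squared length of the direction vector. -/
def secNorm (t : ℂ) (h : Fin 4 → ℂ) : ℂ := S.secDir t h ⬝ᵥ S.secDir t h

/-- The value of the plane `h` at the center, times `den`. -/
def secOff (t : ℂ) (h : Fin 4 → ℂ) : ℂ :=
  S.den.eval t * h 0 + ∑ i : Fin 3, h i.succ * (S.ctr i).eval t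

/-- The foot of the perpendicular from the center to the intersection line, up to scaling. -/
def secFoot (t : ℂ) (h : Fin 4 → ℂ) : Fin 3 → ℂ :=
  (-(S.den.eval t * S.radVel.eval t) / 2) • crossProduct (fun i => h i.succ) (S.secDir t h) -
    S.secOff t h • crossProduct (S.secDir t h) (S.velAt t)

/-- The discriminant of the restriction of the sphere to the intersection line. -/
def secDiscr (t : ℂ) (h : Fin 4 → ℂ) : ℂ :=
  S.den.eval t * S.rad.eval t * S.secNorm t h -
    ((-(S.den.eval t * S.radVel.eval t) / 2) ^ 2 * ∑ i : Fin 3, h i.succ ^ 2 +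
      S.secOff t h ^ 2 * (S.velAt t ⬝ᵥ S.velAt t) +
      2 * (-(S.den.eval t * S.radVel.eval t) / 2) * S.secOff t h *
        ∑ i : Fin 3, h i.succ * S.velAt t i)

/-- The midpoint of the section. -/
def secMid (t : ℂ) (h : Fin 4 → ℂ) : Fin 4 → ℂ :=
  Fin.cons (S.den.eval t * S.secNorm t h)
    fun i => S.secFoot t h i + (S.ctr i).eval t * S.secNorm t h

/-- The points of the section; they are on the circle if `z ^ 2` is the discriminant. -/
def secPoint (t : ℂ) (h : Fin 4 → ℂ) (z : ℂ) : Fin 4 → ℂ :=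
  fun i => S.secMid t h i + z * (Fin.cons 0 (S.secDir t h) : Fin 4 → ℂ) i

theorem secPoint_eq {t : ℂ} (ht : S.den.eval t ≠ 0) (h : Fin 4 → ℂ) (z : ℂ) :
    S.secPoint t h z = S.ofOff t (S.den.eval t * S.secNorm t h)
      (S.den.eval t • (S.secFoot t h + z • S.secDir t h)) := by
  ext i
  refine Fin.cases ?_ (fun i => ?_) i
  · simp [secPoint, secMid, ofOff]
  · simp only [secPoint, secMid, ofOff, Fin.cons_succ, Pi.add_apply, Pi.smul_apply, smul_eq_mul]
    field_simp
    ring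

theorem plane_eq_off {t : ℂ} (h v : Fin 4 → ℂ) :
    S.den.eval t * (h ⬝ᵥ v) =
      S.secOff t h * v 0 + (fun i : Fin 3 => h i.succ) ⬝ᵥ S.off v t := by
  simp only [secOff, dotProduct, Fin.sum_univ_succ, off_eq_eval, Fin.succ_zero_eq_one]
  simp only [Finset.univ_eq_empty, Finset.sum_empty]
  ring

section

variable (t : ℂ) (h : Fin 4 → ℂ)

/-- By triple products: the products of the foot with n, h and n × h are prescribed by the two
planes and by orthogonality to the line. The division by `secNorm` is left out so that everything
stays polynomial in t and h. -/
theorem foot_perp : S.velAt t ⬝ᵥ S.secFoot t h =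
    -(S.den.eval t * S.radVel.eval t) / 2 * S.secNorm t h := by
  simp only [secFoot, secNorm, secDir]
  generalize S.velAt t = n
  generalize S.secOff t h = k
  simp only [dotProduct, Fin.sum_univ_three, cross_apply, Matrix.cons_val, Pi.sub_apply,
    Pi.smul_apply, smul_eq_mul]
  ring

theorem foot_perp' : (fun i : Fin 3 => h i.succ) ⬝ᵥ S.secFoot t h =
    -S.secOff t h * S.secNorm t h := by
  simp only [secFoot, secNorm, secDir]
  generalize S.velAt t = n
  generalize S.secOff t h = k
  simp only [dotProduct, Fin.sum_univ_three, cross_apply, Matrix.cons_val, Pi.sub_apply,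
    Pi.smul_apply, smul_eq_mul]
  ring

theorem foot_dir : S.secFoot t h ⬝ᵥ S.secDir t h = 0 := by
  simp only [secFoot, secDir]
  generalize S.velAt t = n
  generalize S.secOff t h = k
  simp only [dotProduct, Fin.sum_univ_three, cross_apply, Matrix.cons_val, Pi.sub_apply,
    Pi.smul_apply, smul_eq_mul]
  ring

/-- The source of the formula for `secDiscr`: the foot is orthogonal to the direction, so |foot +
z·dir|² = foot·foot + z²·`secNorm`, and for nonzero `secNorm` this has the value `den * rad *
secNorm ^ 2` required by the sphere exactly when z² is the discriminant. -/
theorem foot_foot : S.secFoot t h ⬝ᵥ S.secFoot t h =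
    S.secNorm t h * (S.den.eval t * S.rad.eval t * S.secNorm t h - S.secDiscr t h) := by
  simp only [secFoot, secNorm, secDir, secDiscr]
  generalize S.velAt t = n
  generalize S.secOff t h = k
  generalize -(S.den.eval t * S.radVel.eval t) / 2 = c
  generalize S.den.eval t = α
  generalize S.rad.eval t = β
  simp only [dotProduct, Fin.sum_univ_three, cross_apply, Matrix.cons_val, Pi.sub_apply,
    Pi.smul_apply, smul_eq_mul]
  generalize h (Fin.succ 0) = h0
  generalize h (Fin.succ 1) = h1
  generalize h (Fin.succ 2) = h2
  generalize n 0 = n0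
  generalize n 1 = n1
  generalize n 2 = n2
  ring

theorem dir_perp : S.velAt t ⬝ᵥ S.secDir t h = 0 := dot_self_cross _ _

theorem dir_perp' : (fun i : Fin 3 => h i.succ) ⬝ᵥ S.secDir t h = 0 := dot_cross_self _ _

end

/-- The vectors of the intersection of a characteristic circle with a plane. -/
theorem mem_section_iff {t : ℂ} (ht : S.den.eval t ≠ 0) {h : Fin 4 → ℂ} (hμ : S.secNorm t h ≠ 0)
    (v : Fin 4 → ℂ) : (v ∈ S.circleCone t ∧ h ⬝ᵥ v = 0) ↔
      ∃ c z : ℂ, z ^ 2 = S.secDiscr t h ∧ v = c • S.secPoint t h z := by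
  constructor
  · rintro ⟨hv, hhv⟩
    have hv' := S.mem_circleCone_iff_off.1 hv
    have hp := S.plane_eq_off (t := t) h v
    rw [hhv, mul_zero] at hp
    obtain ⟨c, hc⟩ := eq_smul_of_perp (n := S.velAt t) (h := fun i : Fin 3 => h i.succ)
      (x := S.secNorm t h • S.off v t - v 0 • S.secFoot t h)
      (by
        rw [dotProduct_sub, dotProduct_smul, dotProduct_smul, foot_perp, smul_eq_mul, smul_eq_mul]
        linear_combination S.secNorm t h / 2 * hv'.2)
      (by
        rw [dotProduct_sub, dotProduct_smul, dotProduct_smul, foot_perp', smul_eq_mul, smul_eq_mul]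
        linear_combination -S.secNorm t h * hp)
      hμ
    change _ = c • S.secDir t h at hc
    have hw : S.secNorm t h • S.off v t = v 0 • S.secFoot t h + c • S.secDir t h := by
      rw [← hc]; abel
    have hsq : S.secNorm t h * S.secNorm t h * (c ^ 2 - v 0 ^ 2 * S.secDiscr t h) = 0 := by
      have h1 : (S.secNorm t h • S.off v t) ⬝ᵥ (S.secNorm t h • S.off v t) =
          S.secNorm t h * (S.secNorm t h *
            (S.den.eval t * S.rad.eval t * v 0 ^ 2)) := by
        rw [smul_dotProduct, dotProduct_smul, hv'.1, smul_eq_mul, smul_eq_mul]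
      rw [hw] at h1
      simp only [add_dotProduct, dotProduct_add, smul_dotProduct, dotProduct_smul, foot_foot,
        foot_dir, dotProduct_comm (S.secDir t h) (S.secFoot t h), smul_eq_mul] at h1
      rw [show S.secDir t h ⬝ᵥ S.secDir t h = S.secNorm t h from rfl] at h1
      linear_combination S.secNorm t h * h1
    have hcz : c ^ 2 = v 0 ^ 2 * S.secDiscr t h := by
      have := (mul_eq_zero.1 hsq).resolve_left (mul_ne_zero hμ hμ)
      linear_combination this
    -- A section vector at infinity is zero, because its offset is a multiple of c and c² = 0. Every
    -- other one can be scaled to the first coordinate of `secPoint`.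
    by_cases hv0 : v 0 = 0
    · have hc0 : c = 0 := by simpa [hv0] using hcz
      obtain ⟨z, hz⟩ := IsAlgClosed.exists_pow_nat_eq (S.secDiscr t h) two_pos
      refine ⟨0, z, hz, ?_⟩
      have hoff : S.off v t = 0 := by
        rw [hv0, hc0, zero_smul, zero_smul, add_zero] at hw
        exact (smul_eq_zero.1 hw).resolve_left hμ
      rw [← S.ofOff_off ht v, hoff, hv0, zero_smul]
      ext i
      refine Fin.cases ?_ (fun i => ?_) i <;> simp [ofOff]
    · refine ⟨v 0 / (S.den.eval t * S.secNorm t h), c / v 0, ?_, ?_⟩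
      · rw [div_pow, hcz]; field_simp
      · rw [S.secPoint_eq ht, ← smul_ofOff, div_mul_cancel₀ _ (mul_ne_zero ht hμ)]
        conv_lhs => rw [← S.ofOff_off ht v]
        congr 1
        apply smul_right_injective _ hμ
        simp only
        rw [hw]
        ext i
        simp only [Pi.add_apply, Pi.smul_apply, smul_eq_mul]
        field_simp
  · rintro ⟨c, z, hz, rfl⟩
    suffices H : S.secPoint t h z ∈ S.circleCone t ∧ h ⬝ᵥ S.secPoint t h z = 0 from
      ⟨S.smul_mem_circleCone c H.1, by rw [dotProduct_smul, H.2, smul_zero]⟩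
    have h0 : S.secPoint t h z 0 = S.den.eval t * S.secNorm t h := by
      rw [S.secPoint_eq ht]; rfl
    have hoff : S.off (S.secPoint t h z) t =
        S.den.eval t • (S.secFoot t h + z • S.secDir t h) := by
      rw [S.secPoint_eq ht, S.off_ofOff ht]
    refine ⟨S.mem_circleCone_iff_off.2 ⟨?_, ?_⟩, ?_⟩
    · rw [hoff, h0]
      simp only [add_dotProduct, dotProduct_add, smul_dotProduct, dotProduct_smul, foot_foot,
        foot_dir, dotProduct_comm (S.secDir t h) (S.secFoot t h), smul_eq_mul]
      rw [show S.secDir t h ⬝ᵥ S.secDir t h = S.secNorm t h from rfl]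
      linear_combination S.den.eval t ^ 2 * S.secNorm t h * hz
    · rw [hoff, h0, dotProduct_smul, dotProduct_add, dotProduct_smul, foot_perp, dir_perp]
      simp only [smul_eq_mul]
      ring
    · apply mul_left_cancel₀ ht
      rw [S.plane_eq_off (t := t), hoff, h0, dotProduct_smul, dotProduct_add, dotProduct_smul,
        foot_perp', dir_perp']
      simp only [smul_eq_mul]
      ring

/-- The two vectors have the same nonzero first coordinate and differ by 2z times the direction. -/
theorem secPoint_neg_independent {t : ℂ} (ht : S.den.eval t ≠ 0) {h : Fin 4 → ℂ}
    (hμ : S.secNorm t h ≠ 0) {z : ℂ} (hz : z ≠ 0) :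
    LinearIndependent ℂ ![S.secPoint t h z, S.secPoint t h (-z)] := by
  rw [LinearIndependent.pair_iff]
  intro a b hab
  have h0 : a + b = 0 := by
    have := congrFun hab 0
    simp only [secPoint, secMid, Pi.add_apply, Pi.smul_apply, Fin.cons_zero, smul_eq_mul,
      Pi.zero_apply, mul_zero, add_zero] at this
    have h1 : (a + b) * (S.den.eval t * S.secNorm t h) = 0 := by linear_combination this
    exact (mul_eq_zero.1 h1).resolve_right (mul_ne_zero ht hμ)
  obtain rfl : b = -a := by linear_combination h0
  obtain ⟨i, hi⟩ : ∃ i, S.secDir t h i ≠ 0 := by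
    by_contra! H
    apply hμ
    simp [secNorm, dotProduct, H]
  have := congrFun hab i.succ
  simp only [secPoint, secMid, Pi.add_apply, Pi.smul_apply, Fin.cons_succ, smul_eq_mul,
    Pi.zero_apply] at this
  have h2 : a * (2 * z * S.secDir t h i) = 0 := by linear_combination this
  have ha := (mul_eq_zero.1 h2).resolve_right (mul_ne_zero (mul_ne_zero two_ne_zero hz) hi)
  exact ⟨ha, by rw [ha, neg_zero]⟩

/-- A form that does not vanish on a circle does not vanish at two of its points that are not on
an isotropic line. -/
theorem exists_pair_of_eval_ne_zero {t : ℂ} (ht : S.bad.eval t ≠ 0) {v : Fin 4 → ℂ}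
    (hv : v ∈ S.circleCone t) {d : ℕ} {f : MvPolynomial (Fin 4) ℂ} (hf : f.IsHomogeneous d)
    (hfv : MvPolynomial.eval v f ≠ 0) :
    ∃ w₁ w₂ : Fin 3 → ℂ, S.ofOff t 1 w₁ ∈ S.circleCone t ∧ S.ofOff t 1 w₂ ∈ S.circleCone t ∧
      MvPolynomial.eval (S.ofOff t 1 w₁) f ≠ 0 ∧ MvPolynomial.eval (S.ofOff t 1 w₂) f ≠ 0 ∧
      (w₁ - w₂) ⬝ᵥ (w₁ - w₂) ≠ 0 := by
  obtain ⟨g, e, f', k, hk, hee, hff, hef, hmem, c, τ₀, rfl⟩ := S.exists_param ht hv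
  have hsc : ∀ (a : ℂ) (u : Fin 4 → ℂ), MvPolynomial.eval (a • u) f =
      a ^ d * MvPolynomial.eval u f := by
    intro a u
    exact eval_smul_of_isHomogeneous hf a u
  -- Along the conic the form becomes a polynomial in τ. It is nonzero at τ₀, so two nonzero
  -- parameters can be chosen away from its roots.
  obtain ⟨P, hP⟩ : ∃ P : ℂ[X], ∀ τ, P.eval τ =
      MvPolynomial.eval (S.ofOff t τ (τ • g + τ ^ 2 • e + k • f')) f := by
    refine ⟨MvPolynomial.aeval (Fin.cons X fun i => (X * C (g i) + X ^ 2 * C (e i) + C (k * f' i) +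
      C ((S.ctr i).eval t) * X) * C (S.den.eval t)⁻¹ : Fin 4 → ℂ[X]) f, fun τ => ?_⟩
    rw [← coe_evalRingHom, MvPolynomial.aeval_def, MvPolynomial.hom_eval₂, MvPolynomial.eval]
    congr 1
    · ext; simp
    · ext i
      refine Fin.cases ?_ (fun i => ?_) i
      · simp [ofOff]
      · simp only [Fin.cons_succ, coe_evalRingHom, eval_mul, eval_add, eval_X,
          eval_pow, eval_C, ofOff, Pi.add_apply, Pi.smul_apply, smul_eq_mul]
        ring
  have hP0 : P ≠ 0 := by
    rintro rfl
    rw [hsc, ← hP, eval_zero, mul_zero] at hfv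
    exact hfv rfl
  have ex : ∀ Q : ℂ[X], Q ≠ 0 → ∃ x, Q.eval x ≠ 0 := fun Q hQ => by
    by_contra! H
    exact hQ (Polynomial.funext fun r => by simp [H r])
  obtain ⟨τ₁, h1⟩ := ex (X * P) (mul_ne_zero X_ne_zero hP0)
  obtain ⟨τ₂, h2⟩ := ex (X * (X - C τ₁) * P)
    (mul_ne_zero (mul_ne_zero X_ne_zero (X_sub_C_ne_zero _)) hP0)
  simp only [eval_mul, eval_X, ne_eq, mul_eq_zero, not_or, eval_sub, eval_C, hP] at h1 h2
  obtain ⟨h10, h1⟩ := h1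
  obtain ⟨⟨h20, h12⟩, h2⟩ := h2
  have key : ∀ τ : ℂ, τ ≠ 0 → S.ofOff t 1 (g + τ • e + (k / τ) • f') =
      τ⁻¹ • S.ofOff t τ (τ • g + τ ^ 2 • e + k • f') := by
    intro τ hτ
    rw [← smul_ofOff, inv_mul_cancel₀ hτ, smul_add, smul_add, smul_smul, smul_smul, smul_smul,
      inv_mul_cancel₀ hτ, one_smul]
    congr 3
    · congr 1; field_simp
    · field_simp
  refine ⟨g + τ₁ • e + (k / τ₁) • f', g + τ₂ • e + (k / τ₂) • f', ?_, ?_, ?_, ?_, ?_⟩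
  · rw [key _ h10]; exact S.smul_mem_circleCone _ (hmem _)
  · rw [key _ h20]; exact S.smul_mem_circleCone _ (hmem _)
  · rw [key _ h10, hsc]; exact mul_ne_zero (pow_ne_zero _ (inv_ne_zero h10)) h1
  · rw [key _ h20, hsc]; exact mul_ne_zero (pow_ne_zero _ (inv_ne_zero h20)) h2
  -- The square of the difference is 2(τ₁ - τ₂)(k/τ₁ - k/τ₂), which is nonzero because k ≠ 0 and τ₁
  -- ≠ τ₂.
  · have : g + τ₁ • e + (k / τ₁) • f' - (g + τ₂ • e + (k / τ₂) • f') =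
        (τ₁ - τ₂) • e + (k / τ₁ - k / τ₂) • f' := by
      rw [sub_smul, sub_smul]; abel
    rw [this]
    simp only [add_dotProduct, dotProduct_add, smul_dotProduct, dotProduct_smul, hee, hff, hef,
      dotProduct_comm f' e, smul_eq_mul]
    have : k / τ₁ - k / τ₂ = k * (τ₂ - τ₁) / (τ₁ * τ₂) := by field_simp
    rw [this]
    have e1 : (τ₁ - τ₂) * ((τ₁ - τ₂) * 0) + (k * (τ₂ - τ₁) / (τ₁ * τ₂)) * ((τ₁ - τ₂) * 1) +
        ((τ₁ - τ₂) * ((k * (τ₂ - τ₁) / (τ₁ * τ₂)) * 1) +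
        (k * (τ₂ - τ₁) / (τ₁ * τ₂)) * ((k * (τ₂ - τ₁) / (τ₁ * τ₂)) * 0)) =
        -2 * k * (τ₂ - τ₁) ^ 2 / (τ₁ * τ₂) := by ring
    have e2 : -2 * k * (τ₂ - τ₁) ^ 2 / (τ₁ * τ₂) ≠ 0 :=
      div_ne_zero (mul_ne_zero (mul_ne_zero (by norm_num) hk) (pow_ne_zero _ h12))
        (mul_ne_zero h10 h20)
    intro h
    apply e2
    rw [← e1]
    linear_combination h

/-- For all parameters and planes outside a proper closed set, the plane meets the characteristic
circle in exactly two points, at which a form that does not vanish on all circles is nonzero. -/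
theorem exists_generic_section {v : Fin 4 → ℂ} (hv : v ∈ S.cone) {d : ℕ}
    {f : MvPolynomial (Fin 4) ℂ} (hf : f.IsHomogeneous d) (hfv : MvPolynomial.eval v f ≠ 0) :
    ∃ P : Polynomial (MvPolynomial (Fin 4) ℂ), P ≠ 0 ∧ ∀ t h,
      (P.map (MvPolynomial.eval h)).eval t ≠ 0 → S.bad.eval t ≠ 0 ∧
      ∃ x y : Fin 4 → ℂ, LinearIndependent ℂ ![x, y] ∧ MvPolynomial.eval x f ≠ 0 ∧
        MvPolynomial.eval y f ≠ 0 ∧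
        ∀ v, (v ∈ S.circleCone t ∧ h ⬝ᵥ v = 0) ↔ ∃ c : ℂ, v = c • x ∨ v = c • y := by
  have hdir : ∀ i, IsPolyFun fun t h => S.secDir t h i := by
    intro i
    fin_cases i <;>
    simp only [secDir, cross_apply, Matrix.cons_val, Fin.zero_eta, Fin.mk_one, Fin.reduceFinMk,
      velAt] <;>
    exact ((IsPolyFun.param _).mul (.coord _)).sub ((IsPolyFun.param _).mul (.coord _))
  have hnorm : IsPolyFun S.secNorm := by
    unfold secNorm
    simp only [dotProduct, Fin.sum_univ_three]
    exact (((hdir _).mul (hdir _)).add ((hdir _).mul (hdir _))).add ((hdir _).mul (hdir _))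
  have hoff : IsPolyFun S.secOff := by
    unfold secOff
    simp only [Fin.sum_univ_three]
    exact ((IsPolyFun.param _).mul (.coord _)).add
      ((((IsPolyFun.coord _).mul (.param _)).add ((IsPolyFun.coord _).mul (.param _))).add
        ((IsPolyFun.coord _).mul (.param _)))
  have hc : IsPolyFun fun t _ => -(S.den.eval t * S.radVel.eval t) / 2 :=
    (((IsPolyFun.param _).mul (.param _)).neg).div_const 2
  have hfoot : ∀ i, IsPolyFun fun t h => S.secFoot t h i := by
    intro i
    fin_cases i <;>
    simp only [secFoot, cross_apply, Matrix.cons_val, Fin.zero_eta, Fin.mk_one, Fin.reduceFinMk,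
      velAt, Pi.sub_apply, Pi.smul_apply, smul_eq_mul] <;>
    exact (hc.mul (((IsPolyFun.coord _).mul (hdir _)).sub ((IsPolyFun.coord _).mul (hdir _)))).sub
      (hoff.mul (((hdir _).mul (.param _)).sub ((hdir _).mul (.param _))))
  have hdiscr : IsPolyFun S.secDiscr := by
    unfold secDiscr
    simp only [dotProduct, Fin.sum_univ_three, velAt]
    refine (((IsPolyFun.param _).mul (.param _)).mul hnorm).sub ((((hc.pow 2).mul ?_).add
      ((hoff.pow 2).mul ?_)).add (((IsPolyFun.mul (.const 2) hc).mul hoff).mul ?_))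
    · exact (((IsPolyFun.coord _).pow 2).add ((IsPolyFun.coord _).pow 2)).add
        ((IsPolyFun.coord _).pow 2)
    · exact (((IsPolyFun.param _).mul (.param _)).add ((IsPolyFun.param _).mul (.param _))).add
        ((IsPolyFun.param _).mul (.param _))
    · exact (((IsPolyFun.coord _).mul (.param _)).add ((IsPolyFun.coord _).mul (.param _))).add
        ((IsPolyFun.coord _).mul (.param _))
  have hmid : ∀ i, IsPolyFun fun t h => S.secMid t h i := by
    intro i
    refine Fin.cases ?_ (fun i => ?_) i
    · simp only [secMid, Fin.cons_zero]
      exact (IsPolyFun.param _).mul hnorm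
    · simp only [secMid, Fin.cons_succ]
      exact (hfoot i).add ((IsPolyFun.param _).mul hnorm)
  have hdir' : ∀ i, IsPolyFun fun t h => (Fin.cons 0 (S.secDir t h) : Fin 4 → ℂ) i := by
    intro i
    refine Fin.cases ?_ (fun i => ?_) i
    · simpa only [Fin.cons_zero] using IsPolyFun.const 0
    · simpa only [Fin.cons_succ] using hdir i
  obtain ⟨e₀, e₁, he₀, he₁, he⟩ := IsPolyFun.exists_even_odd hmid hdir' hdiscr f
  -- At the two section points f takes the values e₀ ± z e₁ with z² = `secDiscr`, so the product of
  -- the values is again polynomial in t and h. The other factors stand for a genuine circle, a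
  -- non-isotropic intersection line and two distinct points.
  obtain ⟨P, hP⟩ := (((IsPolyFun.param S.bad).mul hnorm).mul hdiscr).mul
    ((he₀.pow 2).sub (hdiscr.mul (he₁.pow 2)))
  have he' : ∀ t h z, z ^ 2 = S.secDiscr t h →
      MvPolynomial.eval (S.secPoint t h z) f = e₀ t h + z * e₁ t h := he
  refine ⟨P, ?_, fun t h hPt => ?_⟩
  · obtain ⟨t, ht, hvt⟩ := hv
    have hα := S.den_ne_zero ht
    obtain ⟨w₁, w₂, hw₁, hw₂, hf₁, hf₂, hw⟩ := S.exists_pair_of_eval_ne_zero ht hvt hf hfv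
    have hσ : S.velAt t ⬝ᵥ S.velAt t ≠ 0 := by
      simpa [dotProduct, velAt, sq] using S.speed_ne_zero ht
    have hn₁ := (S.mem_circleCone_iff_off.1 hw₁).2
    have hn₂ := (S.mem_circleCone_iff_off.1 hw₂).2
    rw [S.off_ofOff hα] at hn₁ hn₂
    have hn : S.velAt t ⬝ᵥ (w₁ - w₂) = 0 := by
      rw [dotProduct_sub]
      simp only [ofOff, Fin.cons_zero] at hn₁ hn₂
      linear_combination (hn₁ - hn₂) / 2
    -- The witness for P ≠ 0 is the plane through the two points perpendicular to the plane of the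
    -- circle. Its intersection line has direction n × g = -(n·n)(w₁ - w₂), which is not isotropic;
    -- the first coordinate of h makes it pass through w₁.
    set g : Fin 3 → ℂ := crossProduct (S.velAt t) (w₁ - w₂) with hg
    have hgw : g ⬝ᵥ w₁ = g ⬝ᵥ w₂ := by
      have : g ⬝ᵥ (w₁ - w₂) = 0 := by rw [dotProduct_comm]; exact dot_cross_self _ _
      rw [dotProduct_sub] at this
      linear_combination this
    set h : Fin 4 → ℂ :=
      Fin.cons ((-(∑ i, g i * (S.ctr i).eval t) - g ⬝ᵥ w₁) / S.den.eval t) g with hh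
    have hoff : S.secOff t h = -(g ⬝ᵥ w₁) := by
      simp only [secOff, hh, Fin.cons_zero, Fin.cons_succ]
      field_simp
      ring
    have hdir : S.secDir t h = -(S.velAt t ⬝ᵥ S.velAt t) • (w₁ - w₂) := by
      simp only [secDir, hh, Fin.cons_succ]
      rw [hg]
      generalize S.velAt t = n at hn ⊢
      generalize w₁ - w₂ = w at hn ⊢
      ext i
      fin_cases i <;>
      simp only [dotProduct, Fin.sum_univ_three, cross_apply, Matrix.cons_val, Fin.zero_eta,
        Fin.mk_one, Fin.reduceFinMk, Pi.smul_apply, smul_eq_mul] at hn ⊢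
      · linear_combination n 0 * hn
      · linear_combination n 1 * hn
      · linear_combination n 2 * hn
    have hμ : S.secNorm t h ≠ 0 := by
      rw [secNorm, hdir, smul_dotProduct, dotProduct_smul, smul_eq_mul, smul_eq_mul]
      exact mul_ne_zero (neg_ne_zero.2 hσ) (mul_ne_zero (neg_ne_zero.2 hσ) hw)
    have hpl : ∀ w : Fin 3 → ℂ, g ⬝ᵥ w = g ⬝ᵥ w₁ → h ⬝ᵥ S.ofOff t 1 w = 0 := by
      intro w hgw
      apply mul_left_cancel₀ hα
      rw [S.plane_eq_off (t := t), S.off_ofOff hα, hoff]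
      simp only [hh, Fin.cons_succ, ofOff, Fin.cons_zero]
      linear_combination hgw
    obtain ⟨c₁, z₁, hz₁, he₁⟩ := (S.mem_section_iff hα hμ _).1 ⟨hw₁, hpl _ rfl⟩
    obtain ⟨c₂, z₂, hz₂, he₂⟩ := (S.mem_section_iff hα hμ _).1 ⟨hw₂, hpl _ hgw.symm⟩
    have hne : z₁ ≠ z₂ := by
      rintro rfl
      apply hw
      have h01 := congrFun he₁ 0
      have h02 := congrFun he₂ 0
      have hc : c₁ = c₂ := by
        have h3 : S.secPoint t h z₁ 0 = S.den.eval t * S.secNorm t h := by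
          rw [S.secPoint_eq hα]; rfl
        simp only [ofOff, Fin.cons_zero, Pi.smul_apply, smul_eq_mul, h3] at h01 h02
        exact mul_right_cancel₀ (mul_ne_zero hα hμ) (h01.symm.trans h02)
      have h4 : S.ofOff t 1 w₁ = S.ofOff t 1 w₂ := by rw [he₁, he₂, hc]
      have h5 : w₁ = w₂ := by
        rw [← S.off_ofOff hα 1 w₁, h4, S.off_ofOff hα]
      rw [h5, sub_self, zero_dotProduct]
    obtain rfl : z₂ = -z₁ := by
      rcases sq_eq_sq_iff_eq_or_eq_neg.1 (hz₂.trans hz₁.symm) with h | h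
      · exact absurd h.symm hne
      · exact h
    have hz0 : z₁ ≠ 0 := by rintro rfl; simp at hne
    rw [he₁, eval_smul_of_isHomogeneous hf, he' _ _ _ hz₁] at hf₁
    rw [he₂, eval_smul_of_isHomogeneous hf, he' _ _ _ hz₂] at hf₂
    rintro rfl
    have h6 := hP t h
    simp only [Polynomial.map_zero, eval_zero] at h6
    refine mul_ne_zero (mul_ne_zero (mul_ne_zero ht hμ) ?_) ?_ h6.symm
    · rw [← hz₁]; exact pow_ne_zero _ hz0
    · rw [← hz₁]
      intro H
      refine mul_ne_zero (right_ne_zero_of_mul hf₁) (right_ne_zero_of_mul hf₂) ?_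
      linear_combination H
  · rw [hP] at hPt
    simp only [ne_eq, mul_eq_zero, not_or] at hPt
    obtain ⟨⟨⟨ht, hμ⟩, hδ⟩, hN⟩ := hPt
    have hα := S.den_ne_zero ht
    refine ⟨ht, ?_⟩
    obtain ⟨z, hz⟩ := IsAlgClosed.exists_pow_nat_eq (S.secDiscr t h) two_pos
    have hz0 : z ≠ 0 := by rintro rfl; exact hδ (by rw [← hz]; simp)
    have hz' : (-z) ^ 2 = S.secDiscr t h := by rw [neg_sq, hz]
    have hprod : (e₀ t h + z * e₁ t h) * (e₀ t h + -z * e₁ t h) ≠ 0 := by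
      intro H; apply hN; rw [← hz]; linear_combination H
    refine ⟨_, _, S.secPoint_neg_independent hα hμ hz0, ?_, ?_, fun v => ?_⟩
    · rw [he' _ _ _ hz]; exact left_ne_zero_of_mul hprod
    · rw [he' _ _ _ hz']; exact right_ne_zero_of_mul hprod
    · rw [S.mem_section_iff hα hμ]
      constructor
      · rintro ⟨c, z', hz'', rfl⟩
        rcases sq_eq_sq_iff_eq_or_eq_neg.1 (hz''.trans hz.symm) with rfl | rfl
        · exact ⟨c, .inl rfl⟩
        · exact ⟨c, .inr rfl⟩
      · rintro ⟨c, rfl | rfl⟩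
        · exact ⟨c, _, hz, rfl⟩
        · exact ⟨c, _, hz', rfl⟩

end SphereFamily

/-! ### The vanishing ideal of the union of the characteristic circles -/

/-- The restriction of a polynomial to a line through the origin. -/
theorem exists_poly_line {σ : Type*} (f : MvPolynomial σ ℂ) (v : σ → ℂ) :
    ∃ Q : Polynomial ℂ, (∀ c, Q.eval c = MvPolynomial.eval (c • v) f) ∧
      ∀ n, Q.coeff n = MvPolynomial.eval v (MvPolynomial.homogeneousComponent n f) := by
  refine ⟨∑ n ∈ Finset.range (f.totalDegree + 1), Polynomial.C (MvPolynomial.eval v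
    (MvPolynomial.homogeneousComponent n f)) * Polynomial.X ^ n, fun c => ?_, fun n => ?_⟩
  · conv_rhs => rw [← f.sum_homogeneousComponent]
    rw [Polynomial.eval_finsetSum, map_sum]
    refine Finset.sum_congr rfl fun n _ => ?_
    rw [eval_smul_of_isHomogeneous (f.homogeneousComponent_isHomogeneous n)]
    simp only [Polynomial.eval_mul, Polynomial.eval_C, Polynomial.eval_pow, Polynomial.eval_X]
    ring
  · simp only [Polynomial.finsetSum_coeff, Polynomial.coeff_C_mul_X_pow]
    rw [Finset.sum_ite_eq]
    split_ifs with h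
    · rfl
    · rw [MvPolynomial.homogeneousComponent_eq_zero, map_zero]
      rw [Finset.mem_range] at h
      omega

theorem eval_homogeneousComponent_eq_zero {σ : Type*} {f : MvPolynomial σ ℂ} {v : σ → ℂ}
    (h : ∀ c : ℂ, MvPolynomial.eval (c • v) f = 0) (n : ℕ) :
    MvPolynomial.eval v (MvPolynomial.homogeneousComponent n f) = 0 := by
  obtain ⟨Q, hQ, hc⟩ := exists_poly_line f v
  have : Q = 0 := Polynomial.funext fun c => by rw [hQ, h, Polynomial.eval_zero]
  rw [← hc, this, Polynomial.coeff_zero]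

theorem exists_eval_homogeneousComponent_ne_zero {σ : Type*} {f : MvPolynomial σ ℂ} {v : σ → ℂ}
    (h : MvPolynomial.eval v f ≠ 0) :
    ∃ n, MvPolynomial.eval v (MvPolynomial.homogeneousComponent n f) ≠ 0 := by
  by_contra! H
  apply h
  rw [← f.sum_homogeneousComponent, map_sum]
  exact Finset.sum_eq_zero fun n _ => H n

theorem exists_eval_map_ne_zero {P : Polynomial (MvPolynomial (Fin 4) ℂ)} (hP : P ≠ 0) :
    ∃ t h, (P.map (MvPolynomial.eval h)).eval t ≠ 0 := by
  by_contra! H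
  apply hP
  ext1 n
  apply MvPolynomial.funext
  intro h
  have : P.map (MvPolynomial.eval h) = 0 :=
    Polynomial.funext fun t => by rw [H, Polynomial.eval_zero]
  simpa using congrArg (fun p => p.coeff n) this

namespace SphereFamily

open Polynomial

variable (S : SphereFamily)

/-- The ideal of all polynomials that vanish on the union of the characteristic circles. -/
def idl : Ideal (MvPolynomial (Fin 4) ℂ) := MvPolynomial.vanishingIdeal ℂ S.cone

theorem mem_idl {f : MvPolynomial (Fin 4) ℂ} :
    f ∈ S.idl ↔ ∀ v ∈ S.cone, MvPolynomial.eval v f = 0 := by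
  simp [idl]

theorem smul_mem_cone {v : Fin 4 → ℂ} (c : ℂ) (hv : v ∈ S.cone) : c • v ∈ S.cone := by
  obtain ⟨t, ht, hv⟩ := hv
  exact ⟨t, ht, S.smul_mem_circleCone c hv⟩

theorem homogeneousComponent_mem_idl {f : MvPolynomial (Fin 4) ℂ} (hf : f ∈ S.idl) (n : ℕ) :
    MvPolynomial.homogeneousComponent n f ∈ S.idl :=
  S.mem_idl.2 fun _ hv => eval_homogeneousComponent_eq_zero
    (fun c => S.mem_idl.1 hf _ (S.smul_mem_cone c hv)) n

theorem zero_mem_cone (hS : S.bad ≠ 0) : (0 : Fin 4 → ℂ) ∈ S.cone := by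
  obtain ⟨t, ht⟩ : ∃ t, S.bad.eval t ≠ 0 := by
    by_contra! H
    exact hS (Polynomial.funext fun t => by simp [H t])
  exact ⟨t, ht, by simp [circleCone, quad, lin, off]⟩

/-- Irreducibility of X. For generic t and h, the sections belonging to two polynomials outside the
ideal are the same pair of lines, so some vector of a circle has a nonzero component of each
polynomial. On the line through it both restrict to nonzero polynomials, and so does the product. -/
theorem idl_isPrime (hS : S.bad ≠ 0) : S.idl.IsPrime := by
  refine ⟨fun h => ?_, fun {f g} hfg => ?_⟩
  · have : (1 : MvPolynomial (Fin 4) ℂ) ∈ S.idl := h ▸ Submodule.mem_top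
    simpa using S.mem_idl.1 this _ (S.zero_mem_cone hS)
  · by_contra! H
    simp only [mem_idl, not_forall] at H
    obtain ⟨⟨v, hv, hfv⟩, ⟨w, hw, hgw⟩⟩ := H
    obtain ⟨m, hm⟩ := exists_eval_homogeneousComponent_ne_zero hfv
    obtain ⟨n, hn⟩ := exists_eval_homogeneousComponent_ne_zero hgw
    obtain ⟨P, hP, hP'⟩ := S.exists_generic_section hv
      (f.homogeneousComponent_isHomogeneous m) hm
    obtain ⟨Q, hQ, hQ'⟩ := S.exists_generic_section hw
      (g.homogeneousComponent_isHomogeneous n) hn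
    obtain ⟨t, h, hth⟩ := exists_eval_map_ne_zero (mul_ne_zero hP hQ)
    rw [Polynomial.map_mul, eval_mul] at hth
    obtain ⟨ht, x, y, hli, hx, hy, hxy⟩ := hP' t h (left_ne_zero_of_mul hth)
    obtain ⟨-, x', y', -, hx', hy', hxy'⟩ := hQ' t h (right_ne_zero_of_mul hth)
    have hxs := (hxy x).2 ⟨1, by simp⟩
    have hgx : MvPolynomial.eval x (MvPolynomial.homogeneousComponent n g) ≠ 0 := by
      have hx0 : x ≠ 0 := hli.ne_zero 0
      obtain ⟨c, hc⟩ := (hxy' x).1 hxs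
      have hc0 : c ≠ 0 := by
        rintro rfl
        simp only [zero_smul, or_self] at hc
        exact hx0 hc
      rcases hc with hc | hc <;>
        rw [hc, eval_smul_of_isHomogeneous (g.homogeneousComponent_isHomogeneous n)]
      · exact mul_ne_zero (pow_ne_zero _ hc0) hx'
      · exact mul_ne_zero (pow_ne_zero _ hc0) hy'
    obtain ⟨F, hF, hFc⟩ := exists_poly_line f x
    obtain ⟨G, hG, hGc⟩ := exists_poly_line g x
    have hF0 : F ≠ 0 := by rintro rfl; apply hx; rw [← hFc, coeff_zero]
    have hG0 : G ≠ 0 := by rintro rfl; apply hgx; rw [← hGc, coeff_zero]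
    refine mul_ne_zero hF0 hG0 (Polynomial.funext fun c => ?_)
    rw [eval_mul, hF, hG, ← map_mul, eval_zero]
    exact S.mem_idl.1 hfg _ ⟨t, ht, S.smul_mem_circleCone c hxs.1⟩

/-- The prime ideal contains an irreducible factor F₁ of F. Zeros of F₁ are zeros of F, hence of the
whole ideal, and the Nullstellensatz puts the ideal into (F₁). -/
theorem idl_eq_span (hS : S.bad ≠ 0) {F : MvPolynomial (Fin 4) ℂ}
    (hF : ∀ v, (∀ f ∈ S.idl, MvPolynomial.eval v f = 0) ↔ MvPolynomial.eval v F = 0) :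
    ∃ F₁, S.idl = Ideal.span {F₁} ∧ (F₁ = 0 ∨ Irreducible F₁) := by
  have hprime := S.idl_isPrime hS
  by_cases hF0 : F = 0
  · refine ⟨0, ?_, .inl rfl⟩
    rw [eq_comm, Ideal.span_singleton_eq_bot.2 rfl, eq_comm, eq_bot_iff]
    intro f hf
    exact MvPolynomial.funext fun v => by
      rw [(hF v).2 (by rw [hF0, map_zero]) f hf, map_zero]
  · have hFI : F ∈ S.idl := S.mem_idl.2 fun v hv => (hF v).1 fun f hf => S.mem_idl.1 hf v hv
    have hprod := UniqueFactorizationMonoid.factors_prod hF0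
    have hm : (UniqueFactorizationMonoid.factors F).prod ∈ S.idl :=
      (S.idl.mem_iff_of_associated hprod).2 hFI
    obtain ⟨F₁, hF₁, hF₁I⟩ := (hprime.multiset_prod_mem_iff_exists_mem _).1 hm
    have hirr := UniqueFactorizationMonoid.irreducible_of_factor _ hF₁
    refine ⟨F₁, le_antisymm (fun f hf => ?_) ?_, .inr hirr⟩
    · have hp : (Ideal.span {F₁}).IsPrime :=
        (Ideal.span_singleton_prime hirr.ne_zero).2 hirr.prime
      rw [← hp.isRadical.radical, ← MvPolynomial.vanishingIdeal_zeroLocus_eq_radical (K := ℂ)]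
      intro v hv
      have h1 : MvPolynomial.eval v F₁ = 0 := by
        simpa using hv F₁ (Ideal.mem_span_singleton_self _)
      rw [MvPolynomial.aeval_eq_eval]
      refine (hF v).2 ?_ f hf
      obtain ⟨G, rfl⟩ := UniqueFactorizationMonoid.dvd_of_mem_factors hF₁
      rw [map_mul, h1, zero_mul]
    · rwa [Ideal.span_singleton_le_iff_mem]

end SphereFamily

/-! ### Elimination at a generic point -/

/-- The Nullstellensatz for two univariate polynomials over an arbitrary field. -/
theorem exists_pow_eq_of_common_roots {K Ω : Type*} [Field K] [Field Ω] [Algebra K Ω]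
    [IsAlgClosed Ω] {f g z : Polynomial K}
    (h : ∀ τ : Ω, Polynomial.aeval τ f = 0 → Polynomial.aeval τ g = 0 →
      Polynomial.aeval τ z = 0) :
    ∃ (n : ℕ) (A B : Polynomial K), z ^ n = A * f + B * g := by
  let e := MvPolynomial.uniqueAlgEquiv K PUnit.{1}
  have hev : ∀ (x : PUnit → Ω) (q : Polynomial K),
      MvPolynomial.aeval x (e.symm q) = Polynomial.aeval (x PUnit.unit) q := by
    intro x q
    have : ((MvPolynomial.aeval x).comp e.symm.toAlgHom : Polynomial K →ₐ[K] Ω) =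
        Polynomial.aeval (x PUnit.unit) := by
      ext
      simp [e]
    exact DFunLike.congr_fun this q
  have hz : e.symm z ∈ (Ideal.span {e.symm f, e.symm g}).radical := by
    rw [← MvPolynomial.vanishingIdeal_zeroLocus_eq_radical (K := Ω)]
    intro x hx
    rw [hev]
    refine h _ ?_ ?_
    · rw [← hev]; exact hx _ (Ideal.subset_span (by simp))
    · rw [← hev]; exact hx _ (Ideal.subset_span (by simp))
  obtain ⟨n, hn⟩ := hz
  obtain ⟨a, b, hab⟩ := Ideal.mem_span_pair.1 hn
  refine ⟨n, e a, e b, ?_⟩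
  have := congrArg e hab
  simp only [map_add, map_mul, map_pow, AlgEquiv.apply_symm_apply] at this
  exact this.symm

/-- An algebraic element in characteristic zero without other conjugates is rational. -/
theorem mem_range_of_forall_conj_eq {K Ω : Type*} [Field K] [CharZero K] [Field Ω] [Algebra K Ω]
    [IsAlgClosed Ω] {τ : Ω} (hτ : IsIntegral K τ)
    (h : ∀ τ' : Ω, Polynomial.aeval τ' (minpoly K τ) = 0 → τ' = τ) :
    τ ∈ (algebraMap K Ω).range := by
  -- The minimal polynomial is separable, so its degree is the number of its distinct roots, all of
  -- which equal τ.
  rw [← minpoly.natDegree_eq_one_iff]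
  have hsep : (minpoly K τ).Separable := (minpoly.irreducible hτ).separable
  have hcard := (IsAlgClosed.splits ((minpoly K τ).map (algebraMap K Ω))).natDegree_eq_card_roots
  rw [Polynomial.natDegree_map] at hcard
  have hnd := Polynomial.nodup_roots (hsep.map (f := algebraMap K Ω))
  have hall : ∀ τ' ∈ ((minpoly K τ).map (algebraMap K Ω)).roots, τ' = τ := fun τ' hτ' => by
    apply h
    have := Polynomial.isRoot_of_mem_roots hτ'
    rwa [Polynomial.IsRoot, Polynomial.eval_map_algebraMap] at this
  have hle : Multiset.card ((minpoly K τ).map (algebraMap K Ω)).roots ≤ 1 := by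
    rw [Multiset.eq_replicate_of_mem hall, ← Multiset.coe_replicate, Multiset.coe_nodup,
      List.nodup_replicate] at hnd
    exact hnd
  have := minpoly.natDegree_pos hτ
  omega

/-! ### Circle parameters of the generic point -/

namespace SphereFamily

open Polynomial

variable (S : SphereFamily)

/-- A generic point of the union of the characteristic circles: the field is generated by the
coordinates, and the relations between them are the elements of the ideal. -/
structure IsGenericPoint {K : Type*} [Field K] [Algebra ℂ K] (p : Fin 4 → K) : Prop where
  aeval_eq_zero_iff : ∀ f : MvPolynomial (Fin 4) ℂ, MvPolynomial.aeval p f = 0 ↔ f ∈ S.idl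
  exists_div : ∀ x : K, ∃ a b : MvPolynomial (Fin 4) ℂ, MvPolynomial.aeval p b ≠ 0 ∧
    x * MvPolynomial.aeval p b = MvPolynomial.aeval p a

/-- A common root of the equations of the sphere and of the plane, at a given point. -/
def IsCircleParam {A : Type*} [CommRing A] [Algebra ℂ A] (p : Fin 4 → A) (t : A) : Prop :=
  S.quad p t = 0 ∧ S.lin p t = 0

variable {S}
variable {K : Type*} [Field K] [Algebra ℂ K] {p : Fin 4 → K}

/-- Together with `eval_eq_zero_of_map_eq_zero` this carries identities in K[X] over to all vectors
of the circles: after multiplication by denominators outside the ideal, the coefficients of the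
difference of the two sides are elements of the ideal. -/
theorem IsGenericPoint.exists_clear (hp : S.IsGenericPoint p) (f : K[X]) :
    ∃ (c : MvPolynomial (Fin 4) ℂ) (g : (MvPolynomial (Fin 4) ℂ)[X]), c ∉ S.idl ∧
      g.map (MvPolynomial.aeval p).toRingHom = C (MvPolynomial.aeval p c) * f := by
  induction f using Polynomial.induction_on' with
  | add f g hf hg =>
    obtain ⟨c, f', hc, hf⟩ := hf
    obtain ⟨d, g', hd, hg⟩ := hg
    refine ⟨c * d, C d * f' + C c * g', ?_, ?_⟩
    · rw [← hp.aeval_eq_zero_iff] at hc hd ⊢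
      rw [map_mul]; exact mul_ne_zero hc hd
    · rw [Polynomial.map_add, Polynomial.map_mul, Polynomial.map_mul, hf, hg]
      simp only [map_C, AlgHom.toRingHom_eq_coe, RingHom.coe_coe, map_mul]
      ring
  | monomial n x =>
    obtain ⟨a, b, hb, hab⟩ := hp.exists_div x
    refine ⟨b, monomial n a, by rwa [← hp.aeval_eq_zero_iff], ?_⟩
    rw [map_monomial, C_mul_monomial, mul_comm, hab]
    rfl

theorem aeval_quad {Ω : Type*} [Field Ω] [Algebra K Ω] [Algebra ℂ Ω] [IsScalarTower ℂ K Ω] (τ : Ω) :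
    aeval τ (S.quad (fun i => C (p i)) X) = S.quad (fun i => algebraMap K Ω (p i)) τ := by
  have := S.map_quad ((aeval τ : K[X] →ₐ[K] Ω).restrictScalars ℂ) (fun i => C (p i)) X
  simpa using this

theorem aeval_lin {Ω : Type*} [Field Ω] [Algebra K Ω] [Algebra ℂ Ω] [IsScalarTower ℂ K Ω] (τ : Ω) :
    aeval τ (S.lin (fun i => C (p i)) X) = S.lin (fun i => algebraMap K Ω (p i)) τ := by
  have := S.map_lin ((aeval τ : K[X] →ₐ[K] Ω).restrictScalars ℂ) (fun i => C (p i)) X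
  simpa using this

variable (S) in
/-- The equation of the sphere, as a polynomial in the parameter. -/
def quadPoly : (MvPolynomial (Fin 4) ℂ)[X] := S.quad (fun i => C (MvPolynomial.X i)) X

variable (S) in
/-- The equation of the plane, as a polynomial in the parameter. -/
def linPoly : (MvPolynomial (Fin 4) ℂ)[X] := S.lin (fun i => C (MvPolynomial.X i)) X

theorem map_quadPoly {A : Type*} [CommRing A] [Algebra ℂ A] (p : Fin 4 → A) :
    S.quadPoly.map (MvPolynomial.aeval p).toRingHom = S.quad (fun i => C (p i)) X := by
  have := S.map_quad (Polynomial.mapAlgHom (MvPolynomial.aeval (R := ℂ) p))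
    (fun i => C (MvPolynomial.X i)) X
  simpa [quadPoly, linPoly] using this

theorem map_linPoly {A : Type*} [CommRing A] [Algebra ℂ A] (p : Fin 4 → A) :
    S.linPoly.map (MvPolynomial.aeval p).toRingHom = S.lin (fun i => C (p i)) X := by
  have := S.map_lin (Polynomial.mapAlgHom (MvPolynomial.aeval (R := ℂ) p))
    (fun i => C (MvPolynomial.X i)) X
  simpa [quadPoly, linPoly] using this

theorem eval_map_quadPoly (v : Fin 4 → ℂ) (t : ℂ) :
    (S.quadPoly.map (MvPolynomial.eval v)).eval t = S.quad v t := by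
  have := aeval_quad (S := S) (p := v) (Ω := ℂ) t
  rw [← map_quadPoly] at this
  exact this

theorem eval_map_linPoly (v : Fin 4 → ℂ) (t : ℂ) :
    (S.linPoly.map (MvPolynomial.eval v)).eval t = S.lin v t := by
  have := aeval_lin (S := S) (p := v) (Ω := ℂ) t
  rw [← map_linPoly] at this
  exact this

theorem IsGenericPoint.eval_eq_zero_of_map_eq_zero (hp : S.IsGenericPoint p)
    {z : (MvPolynomial (Fin 4) ℂ)[X]} (hz : z.map (MvPolynomial.aeval p).toRingHom = 0)
    {v : Fin 4 → ℂ} (hv : v ∈ S.cone) : z.map (MvPolynomial.eval v) = 0 := by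
  ext1 n
  rw [coeff_map, coeff_zero]
  refine S.mem_idl.1 ((hp.aeval_eq_zero_iff _).1 ?_) v hv
  have := congrArg (fun q => q.coeff n) hz
  simpa using this

variable {Ω : Type*} [Field Ω] [Algebra K Ω] [Algebra ℂ Ω] [IsScalarTower ℂ K Ω] [IsAlgClosed Ω]

/-- A polynomial in the parameter that vanishes at all circle parameters of the generic point
vanishes, up to a denominator, at all parameters of characteristic circles. -/
theorem IsGenericPoint.exists_mul_pow_eq_zero (hp : S.IsGenericPoint p)
    (z : (MvPolynomial (Fin 4) ℂ)[X])
    (hz : ∀ τ : Ω, S.IsCircleParam (fun i => algebraMap K Ω (p i)) τ →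
      aeval τ (z.map (MvPolynomial.aeval p).toRingHom) = 0) :
    ∃ (c : MvPolynomial (Fin 4) ℂ) (n : ℕ), c ∉ S.idl ∧ ∀ t, S.bad.eval t ≠ 0 →
      ∀ v ∈ S.circleCone t,
        MvPolynomial.eval v c * (z.map (MvPolynomial.eval v)).eval t ^ n = 0 := by
  -- Over K, some power of z is a combination of `quad` and `lin`. Cleared of denominators, this
  -- identity specializes to the circles, where `quad` and `lin` vanish.
  obtain ⟨n, A, B, hAB⟩ := exists_pow_eq_of_common_roots (Ω := Ω)
    (f := S.quad (fun i => C (p i)) X) (g := S.lin (fun i => C (p i)) X)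
    (z := z.map (MvPolynomial.aeval p).toRingHom) (fun τ h1 h2 => hz τ
      ⟨by rwa [aeval_quad] at h1, by rwa [aeval_lin] at h2⟩)
  obtain ⟨c, A', hc, hA⟩ := hp.exists_clear A
  obtain ⟨d, B', hd, hB⟩ := hp.exists_clear B
  refine ⟨c * d, n, ?_, fun t ht v hv => ?_⟩
  · rw [← hp.aeval_eq_zero_iff] at hc hd ⊢
    rw [map_mul]; exact mul_ne_zero hc hd
  · have h0 : (C (c * d) * z ^ n - (C d * A' * S.quadPoly + C c * B' * S.linPoly)).map
        (MvPolynomial.aeval p).toRingHom = 0 := by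
      rw [Polynomial.map_sub, Polynomial.map_add, Polynomial.map_mul, Polynomial.map_mul,
        Polynomial.map_mul, Polynomial.map_mul, Polynomial.map_mul, Polynomial.map_pow, hAB, hA, hB,
        map_quadPoly, map_linPoly, map_C, map_C, map_C]
      simp only [AlgHom.toRingHom_eq_coe, RingHom.coe_coe, map_mul]
      ring
    have h1 := hp.eval_eq_zero_of_map_eq_zero h0 ⟨t, ht, hv⟩
    have h2 := congrArg (fun q => q.eval t) h1
    simp only [Polynomial.map_sub, Polynomial.map_add, Polynomial.map_mul, Polynomial.map_pow,
      eval_sub, eval_add, eval_mul, eval_pow, map_C, eval_C, eval_map_quadPoly, eval_map_linPoly,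
      hv.1, hv.2, eval_zero, map_mul] at h2
    rw [map_mul]
    linear_combination h2

/-- There is a circle parameter of the generic point that is not exceptional. -/
theorem IsGenericPoint.exists_param (hp : S.IsGenericPoint p) :
    ∃ τ : Ω, S.IsCircleParam (fun i => algebraMap K Ω (p i)) τ ∧ aeval τ S.bad ≠ 0 := by
  -- If all circle parameters were roots of `bad`, then c · `bad` ^ n would vanish on the genuine
  -- circles, where `bad` is nonzero, and c would be in the ideal.
  by_contra! H
  obtain ⟨c, n, hc, h⟩ := hp.exists_mul_pow_eq_zero (Ω := Ω) (S.bad.map MvPolynomial.C)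
    (fun τ hτ => by
      rw [Polynomial.map_map,
        show (MvPolynomial.aeval p).toRingHom.comp MvPolynomial.C = algebraMap ℂ K by ext; simp,
        aeval_map_algebraMap]
      exact H τ hτ)
  apply hc
  refine S.mem_idl.2 fun v ⟨t, ht, hv⟩ => ?_
  have h1 := h t ht v hv
  rw [Polynomial.map_map, show (MvPolynomial.eval v).comp MvPolynomial.C = RingHom.id ℂ by ext; simp,
    Polynomial.map_id] at h1
  exact (mul_eq_zero.1 h1).resolve_right (pow_ne_zero _ ht)

/-- If the generic point is on only one characteristic circle, then the parameter is a rational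
function of the point. -/
theorem IsGenericPoint.exists_rational_param (hp : S.IsGenericPoint p) [Algebra.IsAlgebraic K Ω]
    (huniq : ∀ τ τ' : Ω, S.IsCircleParam (fun i => algebraMap K Ω (p i)) τ → aeval τ S.bad ≠ 0 →
      S.IsCircleParam (fun i => algebraMap K Ω (p i)) τ' → aeval τ' S.bad ≠ 0 → τ = τ') :
    ∃ (d : ℕ) (a b : MvPolynomial (Fin 4) ℂ), a.IsHomogeneous d ∧ b.IsHomogeneous d ∧ b ∉ S.idl ∧
      ∀ t, S.bad.eval t ≠ 0 → ∀ v ∈ S.circleCone t,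
        MvPolynomial.eval v b * t = MvPolynomial.eval v a := by
  have : CharZero K := charZero_of_injective_algebraMap (algebraMap ℂ K).injective
  obtain ⟨τ, hτ, hbad⟩ := hp.exists_param (Ω := Ω)
  have hint : IsIntegral K τ := Algebra.IsIntegral.isIntegral τ
  obtain ⟨x, rfl⟩ : τ ∈ (algebraMap K Ω).range := by
    -- A conjugate of τ satisfies the same polynomial relations over K, so it is again a circle
    -- parameter that is not exceptional.
    refine mem_range_of_forall_conj_eq hint fun τ' hτ' => ?_
    have tr : ∀ q : K[X], aeval τ q = 0 → aeval τ' q = 0 := fun q hq => by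
      obtain ⟨r, hr⟩ := minpoly.dvd K τ hq
      rw [hr, map_mul, hτ', zero_mul]
    have heq : minpoly K τ = minpoly K τ' :=
      minpoly.eq_of_irreducible_of_monic (minpoly.irreducible hint) hτ' (minpoly.monic hint)
    refine huniq τ' τ ⟨?_, ?_⟩ ?_ hτ hbad
    · rw [← aeval_quad]; exact tr _ (by rw [aeval_quad]; exact hτ.1)
    · rw [← aeval_lin]; exact tr _ (by rw [aeval_lin]; exact hτ.2)
    · intro h0
      apply hbad
      rw [← aeval_map_algebraMap K] at h0 ⊢
      obtain ⟨r, hr⟩ := minpoly.dvd K τ' h0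
      rw [hr, map_mul, ← heq, minpoly.aeval, zero_mul]
  obtain ⟨a, b, hb, hab⟩ := hp.exists_div x
  -- The factor `bad` takes care of the exceptional circle parameters, to which uniqueness does not
  -- apply.
  obtain ⟨c, n, hc, h⟩ := hp.exists_mul_pow_eq_zero (Ω := Ω)
    (S.bad.map MvPolynomial.C * (C b * X - C a)) (fun τ' hτ' => by
      by_cases h0 : aeval τ' S.bad = 0
      · rw [Polynomial.map_mul, Polynomial.map_map, map_mul]
        rw [show (MvPolynomial.aeval p).toRingHom.comp MvPolynomial.C = algebraMap ℂ K by ext; simp,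
          aeval_map_algebraMap, h0, zero_mul]
      · rw [huniq τ' _ hτ' h0 hτ hbad]
        simp only [Polynomial.map_mul, Polynomial.map_sub, map_C, map_X, map_mul, map_sub, aeval_C,
          aeval_X, AlgHom.toRingHom_eq_coe, RingHom.coe_coe, ← hab]
        ring)
  have hcb : c * b ∉ S.idl := by
    rw [← hp.aeval_eq_zero_iff] at hc ⊢
    rw [map_mul]; exact mul_ne_zero hc hb
  have key : ∀ t, S.bad.eval t ≠ 0 → ∀ v ∈ S.circleCone t,
      MvPolynomial.eval v (c * b) * t = MvPolynomial.eval v (c * a) := by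
    intro t ht v hv
    have h1 := h t ht v hv
    rw [Polynomial.map_mul, Polynomial.map_map,
      show (MvPolynomial.eval v).comp MvPolynomial.C = RingHom.id ℂ by ext; simp,
      Polynomial.map_id] at h1
    simp only [Polynomial.map_sub, Polynomial.map_mul, map_C, map_X, eval_mul, eval_sub, eval_C,
      eval_X] at h1
    rw [map_mul, map_mul]
    rcases mul_eq_zero.1 h1 with h2 | h2
    · rw [h2]; ring
    · have h3 : S.bad.eval t * (MvPolynomial.eval v b * t - MvPolynomial.eval v a) = 0 := by
        by_contra h3
        exact pow_ne_zero n h3 h2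
      linear_combination MvPolynomial.eval v c * (mul_eq_zero.1 h3).resolve_left ht
  -- Scaling a vector of a circle does not change t, so the relation holds in every degree
  -- separately. The degree is chosen such that the denominator stays outside the ideal.
  obtain ⟨d, hd⟩ : ∃ d, MvPolynomial.homogeneousComponent d (c * b) ∉ S.idl := by
    by_contra! H
    apply hcb
    rw [← (c * b).sum_homogeneousComponent]
    exact S.idl.sum_mem fun n _ => H n
  refine ⟨d, _, _, MvPolynomial.homogeneousComponent_isHomogeneous d (c * a),
    MvPolynomial.homogeneousComponent_isHomogeneous d (c * b), hd, fun t ht v hv => ?_⟩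
  have h0 := eval_homogeneousComponent_eq_zero (f := MvPolynomial.C t * (c * b) - c * a) (v := v)
    (fun r => by
      rw [map_sub, map_mul, MvPolynomial.eval_C, ← key t ht _ (S.smul_mem_circleCone r hv)]
      ring) d
  rw [map_sub, MvPolynomial.homogeneousComponent_C_mul, map_sub, map_mul, MvPolynomial.eval_C] at h0
  linear_combination h0

end SphereFamily

/-! ### The generic point is on only one characteristic circle -/

/-- A common point of the zero sets of the relations between some elements of a field extension
at which a given nonzero polynomial expression stays nonzero. -/
theorem exists_specialization {σ Ω : Type*} [Finite σ] [Field Ω] [Algebra ℂ Ω] (x : σ → Ω)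
    {f : MvPolynomial σ ℂ} (hf : MvPolynomial.aeval x f ≠ 0) :
    ∃ c : σ → ℂ, MvPolynomial.eval c f ≠ 0 ∧
      ∀ g : MvPolynomial σ ℂ, MvPolynomial.aeval x g = 0 → MvPolynomial.eval c g = 0 := by
  set I : Ideal (MvPolynomial σ ℂ) := RingHom.ker (MvPolynomial.aeval (R := ℂ) x) with hI
  have hp : I.IsPrime := RingHom.ker_isPrime _
  by_contra! H
  apply hf
  change f ∈ I
  rw [← hp.isRadical.radical, ← MvPolynomial.vanishingIdeal_zeroLocus_eq_radical (K := ℂ)]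
  intro c hc
  by_contra hfc
  obtain ⟨g, hg, hgc⟩ := H c hfc
  exact hgc (hc g hg)

/-- The condition for two spheres with centers `n / d`, `n' / d'` and squared radii `q / d`,
`q' / d'` to be tangent. -/
def tangency {A : Type*} [CommRing A] (n n' : Fin 3 → A) (d d' q q' : A) : A :=
  (∑ i, (n i * d' - n' i * d) ^ 2 - q * d * d' ^ 2 - q' * d' * d ^ 2) ^ 2 -
    4 * q * q' * d ^ 3 * d' ^ 3

theorem Polynomial.exists_eq_add_sub_mul (f : Polynomial ℂ) (t : ℂ) :
    ∃ g : Polynomial ℂ, f = C (f.eval t) + (X - C t) * g ∧ g.eval t = (derivative f).eval t := by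
  obtain ⟨g, hg⟩ := Polynomial.X_sub_C_dvd_sub_C_eval (p := f) (a := t)
  have hf : f = C (f.eval t) + (X - C t) * g := by rw [← hg]; ring
  refine ⟨g, hf, ?_⟩
  conv_rhs => rw [hf]
  simp

namespace SphereFamily

open Polynomial

variable (S : SphereFamily)

/-- The spheres of the family are not all tangent to each other. -/
theorem exists_not_tangent {t : ℂ} (ht : S.bad.eval t ≠ 0) :
    ∃ u : ℂ, tangency (fun i => (S.ctr i).eval t) (fun i => (S.ctr i).eval u) (S.den.eval t)
      (S.den.eval u) (S.rad.eval t) (S.rad.eval u) ≠ 0 := by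
  by_contra! H
  have hα := S.den_ne_zero ht
  have hκ := S.discr_ne_zero ht
  obtain ⟨d', hd, hd'⟩ := S.den.exists_eq_add_sub_mul t
  obtain ⟨q', hq, hq'⟩ := S.rad.exists_eq_add_sub_mul t
  choose n' hn hn' using fun i => (S.ctr i).exists_eq_add_sub_mul t
  set d := S.den.eval t with hdd
  set q := S.rad.eval t with hqd
  set n := fun i => (S.ctr i).eval t with hnd
  set a : ℂ[X] := ∑ i, (C (n i) * d' - n' i * C d) ^ 2 with ha
  set b : ℂ[X] := C q * S.den + S.rad * C d with hb
  -- With `den`, `rad` and `ctr` expanded at t, the sum of squares is (u - t)² a, and the rest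
  -- simplifies by b² - 4 q d · `rad` · `den` = (q · `den` - `rad` · d)², again divisible by (u -
  -- t)². At u = t the second factor is -d³(4 · `rad` · `speed` - `den` · `radVel` ^ 2).
  have hpoly : (X - C t) ^ 2 * ((X - C t) ^ 2 * a ^ 2 - 2 * a * (C d * S.den * b) +
      C d ^ 2 * S.den ^ 2 * (C q * d' - q' * C d) ^ 2) = 0 := by
    refine Polynomial.funext fun u => ?_
    have h := H u
    have e1 : S.den.eval u = d + (u - t) * d'.eval u := by
      conv_lhs => rw [hd]
      simp
    have e2 : S.rad.eval u = q + (u - t) * q'.eval u := by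
      conv_lhs => rw [hq]
      simp
    have e3 : ∀ i, (S.ctr i).eval u = n i + (u - t) * (n' i).eval u := by
      intro i
      conv_lhs => rw [hn i]
      simp [hnd]
    simp only [tangency, Fin.sum_univ_three, e1, e2, e3] at h
    simp only [ha, hb, Fin.sum_univ_three, eval_mul, eval_pow, eval_sub, eval_add, eval_X, eval_C,
      eval_zero, eval_ofNat, e1, e2]
    linear_combination h
  have h1 := (mul_eq_zero.1 hpoly).resolve_left (pow_ne_zero _ (X_sub_C_ne_zero t))
  have h2 := congrArg (fun p => p.eval t) h1
  simp only [ha, hb, Fin.sum_univ_three, eval_mul, eval_pow, eval_sub, eval_add, eval_X, eval_C,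
      eval_zero, eval_ofNat, hn', hq', hd', ← hdd, ← hqd] at h2
  simp only [vel, radVel, Fin.sum_univ_three, eval_sub, eval_mul] at hκ
  refine mul_ne_zero (pow_ne_zero 3 hα) hκ ?_
  simp only [hnd] at h2
  linear_combination -h2

end SphereFamily

/-! ### The spheres touch the surface at the generic point -/

namespace SphereFamily

open Polynomial

theorem aeval_X_eq_map {K : Type*} [CommRing K] [Algebra ℂ K] (q : ℂ[X]) :
    aeval (X : K[X]) q = q.map (algebraMap ℂ K) := by
  rw [aeval_def, Polynomial.map]; rfl

variable (S : SphereFamily)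

/-- The relation Σ' = ∂Σ/∂t after clearing denominators. Where `den` is nonzero, it makes every
circle parameter a multiple root of `quad`. -/
theorem den_mul_derivative_quad {K : Type*} [CommRing K] [Algebra ℂ K] (p : Fin 4 → K) :
    S.den.map (algebraMap ℂ K) * derivative (S.quad (fun i => C (p i)) X) =
      2 * (derivative S.den).map (algebraMap ℂ K) * S.quad (fun i => C (p i)) X +
        C (p 0) * S.lin (fun i => C (p i)) X := by
  simp only [quad, lin, off, aeval_X_eq_map, vel, radVel, Fin.sum_univ_three, derivative_sub,
    derivative_add, derivative_mul, derivative_pow, derivative_C, derivative_map,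
    Polynomial.map_sub, Polynomial.map_mul, Nat.cast_ofNat, Nat.add_one_sub_one, pow_one, mul_zero,
    add_zero, map_ofNat]
  ring

/-- The polar form of the equation of the sphere. -/
def polar {A : Type*} [CommRing A] [Algebra ℂ A] (p w : Fin 4 → A) (t : A) : A :=
  2 * ∑ i, S.off p t i * S.off w t i - 2 * (aeval t S.den * aeval t S.rad * p 0 * w 0)

section DualNumber

variable {Ω : Type*} [Field Ω] [Algebra ℂ Ω]

theorem aeval_inl (q : ℂ[X]) (τ : Ω) :
    aeval (TrivSqZeroExt.inl τ : DualNumber Ω) q = TrivSqZeroExt.inl (aeval τ q) :=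
  aeval_algHom_apply (TrivSqZeroExt.inlAlgHom ℂ Ω Ω) τ q

theorem off_dual (p w : Fin 4 → Ω) (τ : Ω) (i : Fin 3) :
    S.off (fun i => (TrivSqZeroExt.inl (p i) + TrivSqZeroExt.inr (w i) : DualNumber Ω))
      (TrivSqZeroExt.inl τ) i =
      TrivSqZeroExt.inl (S.off p τ i) + TrivSqZeroExt.inr (S.off w τ i) := by
  ext <;> simp [off, aeval_inl]

theorem snd_quad_dual (p w : Fin 4 → Ω) (τ : Ω) :
    TrivSqZeroExt.snd (S.quad
      (fun i => (TrivSqZeroExt.inl (p i) + TrivSqZeroExt.inr (w i) : DualNumber Ω))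
      (TrivSqZeroExt.inl τ)) = S.polar p w τ := by
  simp only [quad, off_dual, polar, aeval_inl, Fin.sum_univ_three, sq]
  simp
  ring

end DualNumber

variable {S}
variable {K : Type*} [Field K] [Algebra ℂ K] {p : Fin 4 → K}
variable {Ω : Type*} [Field Ω] [Algebra K Ω] [Algebra ℂ Ω] [IsScalarTower ℂ K Ω]

/-- The spheres that touch the canal surface at the generic point have the same tangent plane. -/
theorem IsGenericPoint.exists_polar_eq (hp : S.IsGenericPoint p) [Algebra.IsAlgebraic K Ω]
    {F : MvPolynomial (Fin 4) ℂ} (hF : S.idl = Ideal.span {F}) {τ : Ω}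
    (hτ : S.IsCircleParam (fun i => algebraMap K Ω (p i)) τ) (hbad : aeval τ S.bad ≠ 0) :
    ∃ α : Ω, ∀ w : Fin 4 → Ω, S.polar (fun i => algebraMap K Ω (p i)) w τ =
      α * TrivSqZeroExt.snd (MvPolynomial.aeval (fun i => (TrivSqZeroExt.inl (algebraMap K Ω (p i)) +
        TrivSqZeroExt.inr (w i) : DualNumber Ω)) F) := by
  have : CharZero K := charZero_of_injective_algebraMap (algebraMap ℂ K).injective
  have hint : IsIntegral K τ := Algebra.IsIntegral.isIntegral τ
  have hden : aeval τ S.den ≠ 0 := by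
    intro h; apply hbad; rw [bad, map_mul, map_mul, h, zero_mul, zero_mul]
  -- τ is a multiple root of `quad`, whereas its minimal polynomial has only simple roots.
  obtain ⟨q, hq⟩ : minpoly K τ ^ 2 ∣ S.quad (fun i => C (p i)) X := by
    obtain ⟨q, hq⟩ := minpoly.dvd K τ (p := S.quad (fun i => C (p i)) X)
      (by rw [aeval_quad]; exact hτ.1)
    have h1 := congrArg (aeval τ) (S.den_mul_derivative_quad p)
    rw [map_mul, map_add, map_mul, map_mul _ (C (p 0)), aeval_quad, aeval_lin, hτ.1, hτ.2, mul_zero,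
      mul_zero, zero_add, aeval_map_algebraMap] at h1
    have h2 := (mul_eq_zero.1 h1).resolve_left hden
    rw [hq, derivative_mul, map_add, map_mul, map_mul, minpoly.aeval, zero_mul, add_zero] at h2
    have h3 := (minpoly.irreducible hint).separable.aeval_derivative_ne_zero (minpoly.aeval K τ)
    obtain ⟨r, hr⟩ := minpoly.dvd K τ ((mul_eq_zero.1 h2).resolve_left h3)
    exact ⟨r, by rw [hq, hr]; ring⟩
  obtain ⟨c, m', hc, hm⟩ := hp.exists_clear (minpoly K τ)
  obtain ⟨d, q', hd, hq'⟩ := hp.exists_clear q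
  have h0 : (C (c ^ 2 * d) * S.quadPoly - m' ^ 2 * q').map (MvPolynomial.aeval p).toRingHom = 0 := by
    rw [Polynomial.map_sub, Polynomial.map_mul, Polynomial.map_mul, Polynomial.map_pow, hm, hq',
      map_quadPoly, hq, map_C]
    simp only [AlgHom.toRingHom_eq_coe, RingHom.coe_coe, map_mul, map_pow]
    ring
  -- Without denominators the factorization of `quad` holds modulo F, coefficient by coefficient.
  obtain ⟨e, he⟩ : C F ∣ C (c ^ 2 * d) * S.quadPoly - m' ^ 2 * q' := by
    rw [C_dvd_iff_dvd_coeff]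
    intro n
    rw [← Ideal.mem_span_singleton, ← hF, ← hp.aeval_eq_zero_iff]
    have := congrArg (fun q => q.coeff n) h0
    rw [coeff_map, coeff_zero] at this
    exact this
  set P : Fin 4 → Ω := fun i => algebraMap K Ω (p i) with hP
  have hPa : ∀ f : MvPolynomial (Fin 4) ℂ,
      MvPolynomial.aeval P f = algebraMap K Ω (MvPolynomial.aeval p f) := fun f => by
    rw [hP]; exact MvPolynomial.aeval_algebraMap_apply _ _ _
  have hc0 : MvPolynomial.aeval P (c ^ 2 * d) ≠ 0 := by
    rw [← hp.aeval_eq_zero_iff] at hc hd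
    rw [hPa, map_mul, map_pow]
    exact (_root_.map_ne_zero _).2 (mul_ne_zero (pow_ne_zero 2 hc) hd)
  -- evaluation at a first order deformation of the generic point
  let P' (w : Fin 4 → Ω) (i : Fin 4) : DualNumber Ω :=
    TrivSqZeroExt.inl (P i) + TrivSqZeroExt.inr (w i)
  let Θ (w : Fin 4 → Ω) : (MvPolynomial (Fin 4) ℂ)[X] →+* DualNumber Ω :=
    eval₂RingHom (MvPolynomial.aeval (P' w)).toRingHom (TrivSqZeroExt.inl τ)
  let E : (MvPolynomial (Fin 4) ℂ)[X] →+* Ω :=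
    eval₂RingHom (MvPolynomial.aeval P).toRingHom τ
  have hfst : ∀ w z, TrivSqZeroExt.fst (Θ w z) = E z := by
    intro w z
    have : ((TrivSqZeroExt.fstHom ℂ Ω Ω).toRingHom).comp (Θ w) = E := by
      apply Polynomial.ringHom_ext'
      · apply MvPolynomial.ringHom_ext
        · intro r; simp [Θ, E]
        · intro i; simp [Θ, E, P']
      · simp [Θ, E]
    exact congrArg (fun f => f z) this
  have hΘC : ∀ w f, Θ w (C f) = MvPolynomial.aeval (P' w) f := fun w f => by simp [Θ]
  have hEC : ∀ f, E (C f) = MvPolynomial.aeval P f := fun f => by simp [E]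
  have hΘq : ∀ w, Θ w S.quadPoly = S.quad (P' w) (TrivSqZeroExt.inl τ) := by
    intro w
    have : Θ w S.quadPoly =
        aeval (TrivSqZeroExt.inl τ : DualNumber Ω) (S.quadPoly.map (MvPolynomial.aeval (P' w)).toRingHom) := by
      simp only [Θ, coe_eval₂RingHom]
      rw [aeval_def, eval₂_map]
      rfl
    rw [this, map_quadPoly]
    have := S.map_quad ((aeval (TrivSqZeroExt.inl τ) :
      (DualNumber Ω)[X] →ₐ[DualNumber Ω] DualNumber Ω).restrictScalars ℂ) (fun i => C (P' w i)) X
    simpa using this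
  have hEm : E m' = 0 := by
    have : E m' = aeval τ (m'.map (MvPolynomial.aeval p).toRingHom) := by
      rw [aeval_def, eval₂_map]
      simp only [E, coe_eval₂RingHom]
      congr 1
      ext <;> simp [P]
      exact IsScalarTower.algebraMap_apply ℂ K Ω _
    rw [this, hm, map_mul, minpoly.aeval, mul_zero]
  have hEF : MvPolynomial.aeval P F = 0 := by
    rw [hPa, (hp.aeval_eq_zero_iff F).2 (by rw [hF]; exact Ideal.mem_span_singleton_self F), map_zero]
  refine ⟨E e / MvPolynomial.aeval P (c ^ 2 * d), fun w => ?_⟩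
  -- In the infinitesimal part the square of m' contributes nothing, as m' vanishes at (P, τ), and F
  -- e contributes only e(P, τ) · dF(w), as F(P) = 0. So the polar form is proportional to dF.
  have h1 := congrArg TrivSqZeroExt.snd (congrArg (Θ w) he)
  generalize c ^ 2 * d = cd at h1 hc0 ⊢
  rw [map_sub, map_mul, map_mul, map_mul, map_pow, sq (Θ w m')] at h1
  rw [TrivSqZeroExt.snd_sub, TrivSqZeroExt.snd_mul, TrivSqZeroExt.snd_mul, TrivSqZeroExt.snd_mul,
    TrivSqZeroExt.snd_mul, TrivSqZeroExt.fst_mul, hfst, hfst, hfst, hfst, hfst, hfst, hEm, hEC, hEC,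
    hEF] at h1
  have hEq : E S.quadPoly = 0 := by
    rw [← hfst w, hΘq, ← hτ.1, quad, quad]
    simp only [P', off_dual, aeval_inl, Fin.sum_univ_three, sq]
    simp
  rw [hEq, hΘC, hΘC, hΘq, snd_quad_dual] at h1
  simp only [smul_eq_mul, mul_zero, zero_mul, add_zero, zero_add, MulOpposite.op_zero, zero_smul,
    sub_zero, MulOpposite.smul_eq_mul_unop, MulOpposite.unop_op, smul_zero] at h1
  rw [div_mul_eq_mul_div, eq_div_iff hc0]
  linear_combination h1

end SphereFamily

/-! ### Properness and transcendence degree at the generic point -/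

namespace SphereFamily

open Polynomial

variable {S : SphereFamily}

/-- The center is a generically injective function of the parameter. -/
def IsProper (S : SphereFamily) : Prop :=
  ∃ E : Finset ℂ, ∀ t u, t ∉ E → u ∉ E → S.den.eval t ≠ 0 → S.den.eval u ≠ 0 →
    (∀ i, (S.ctr i).eval t * S.den.eval u = (S.ctr i).eval u * S.den.eval t) → t = u

theorem eval_aeval_X {σ : Type*} (c : σ → ℂ) (i : σ) (q : ℂ[X]) :
    MvPolynomial.eval c (aeval (MvPolynomial.X i) q) = q.eval (c i) := by
  have := aeval_algHom_apply (MvPolynomial.aeval (R := ℂ) c) (MvPolynomial.X i) q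
  rw [MvPolynomial.aeval_X] at this
  exact this.symm

theorem aeval_aeval_X {σ Ω : Type*} [CommRing Ω] [Algebra ℂ Ω] (x : σ → Ω) (i : σ) (q : ℂ[X]) :
    MvPolynomial.aeval x (aeval (MvPolynomial.X i : MvPolynomial σ ℂ) q) = aeval (x i) q := by
  rw [← aeval_algHom_apply, MvPolynomial.aeval_X]

/-- Generic injectivity holds over every extension field. -/
theorem IsProper.eq_of_aeval (hS : S.IsProper) {Ω : Type*} [Field Ω] [Algebra ℂ Ω] {t u : Ω}
    (ht : t ∉ (algebraMap ℂ Ω).range) (hu : u ∉ (algebraMap ℂ Ω).range)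
    (hdt : aeval t S.den ≠ 0) (hdu : aeval u S.den ≠ 0)
    (h : ∀ i, aeval t (S.ctr i) * aeval u S.den = aeval u (S.ctr i) * aeval t S.den) : t = u := by
  obtain ⟨E, hE⟩ := hS
  by_contra hne
  let x : Fin 2 → Ω := ![t, u]
  -- A pair t ≠ u would specialize to complex numbers with the same relations, off the diagonal, the
  -- roots of `den` and the exceptional set. The last is possible since t and u are not constants.
  let f : MvPolynomial (Fin 2) ℂ := (MvPolynomial.X 0 - MvPolynomial.X 1) *
    (aeval (MvPolynomial.X 0) S.den * aeval (MvPolynomial.X 1) S.den) *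
    ((∏ e ∈ E, (MvPolynomial.X 0 - MvPolynomial.C e)) *
      ∏ e ∈ E, (MvPolynomial.X 1 - MvPolynomial.C e))
  have hf : MvPolynomial.aeval x f ≠ 0 := by
    simp only [f, map_mul, map_sub, map_prod, MvPolynomial.aeval_X, aeval_aeval_X,
      MvPolynomial.algHom_C, x, Matrix.cons_val_zero, Matrix.cons_val_one]
    refine mul_ne_zero (mul_ne_zero (sub_ne_zero.2 hne) (mul_ne_zero hdt hdu)) (mul_ne_zero ?_ ?_)
    · exact Finset.prod_ne_zero_iff.2 fun e _ => sub_ne_zero.2 fun h => ht ⟨e, h.symm⟩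
    · exact Finset.prod_ne_zero_iff.2 fun e _ => sub_ne_zero.2 fun h => hu ⟨e, h.symm⟩
  obtain ⟨c, hc, hg⟩ := exists_specialization x hf
  simp only [f, map_mul, map_sub, map_prod, MvPolynomial.eval_X, eval_aeval_X,
    MvPolynomial.eval_C, ne_eq, mul_eq_zero, not_or, Finset.prod_eq_zero_iff, not_exists,
    not_and, sub_eq_zero] at hc
  obtain ⟨⟨h1, h2, h3⟩, h4, h5⟩ := hc
  refine h1 (hE (c 0) (c 1) (fun h => h4 _ h rfl) (fun h => h5 _ h rfl) h2 h3 fun i => ?_)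
  have := hg (aeval (MvPolynomial.X 0) (S.ctr i) * aeval (MvPolynomial.X 1) S.den -
    aeval (MvPolynomial.X 1) (S.ctr i) * aeval (MvPolynomial.X 0) S.den) (by
      simp only [map_sub, map_mul, aeval_aeval_X, x, Matrix.cons_val_zero, Matrix.cons_val_one]
      rw [h i, sub_self])
  simpa only [map_sub, map_mul, eval_aeval_X, sub_eq_zero] using this

/-- The vanishing ideal does not contain a power of the linear form and the quadratic form of one
characteristic circle, if it is principal. -/
theorem lin_not_mem_idl {F : MvPolynomial (Fin 4) ℂ} (hF : S.idl = Ideal.span {F})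
    (hirr : F = 0 ∨ Irreducible F) {c : ℂ} (hc : S.bad.eval c ≠ 0)
    (hlin : S.lin MvPolynomial.X (MvPolynomial.C c) ∈ S.idl)
    (hquad : S.quad MvPolynomial.X (MvPolynomial.C c) ∈ S.idl) : False := by
  have hα := S.den_ne_zero hc
  have hσ : S.velAt c ⬝ᵥ S.velAt c ≠ 0 := by
    simpa [dotProduct, velAt, sq] using S.speed_ne_zero hc
  have hl : ∀ v, MvPolynomial.eval v (S.lin MvPolynomial.X (MvPolynomial.C c)) = S.lin v c := by
    intro v
    have := S.map_lin (MvPolynomial.aeval (R := ℂ) v) MvPolynomial.X (MvPolynomial.C c)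
    simpa using this
  have hq : ∀ v, MvPolynomial.eval v (S.quad MvPolynomial.X (MvPolynomial.C c)) = S.quad v c := by
    intro v
    have := S.map_quad (MvPolynomial.aeval (R := ℂ) v) MvPolynomial.X (MvPolynomial.C c)
    simpa using this
  rw [hF, Ideal.mem_span_singleton] at hlin hquad
  obtain ⟨G, hG⟩ := hlin
  obtain ⟨Q, hQ⟩ := hquad
  have hoff : ∀ w, S.off (S.ofOff c 0 w) c = w := S.off_ofOff hα 0
  have hlin0 : ∀ w, S.lin (S.ofOff c 0 w) c = -2 * (S.velAt c ⬝ᵥ w) := by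
    intro w
    rw [lin]
    simp only [dotProduct, hoff, velAt, coe_aeval_eq_eval]
    simp [ofOff]
  have hquad0 : ∀ w, S.quad (S.ofOff c 0 w) c = w ⬝ᵥ w := by
    intro w
    rw [quad]
    simp only [dotProduct, hoff]
    simp [ofOff, sq]
  have hlne : S.lin MvPolynomial.X (MvPolynomial.C c) ≠ 0 := by
    intro h0
    have := hl (S.ofOff c 0 (S.velAt c))
    rw [h0, map_zero, hlin0] at this
    exact mul_ne_zero (by norm_num) hσ this.symm
  have hF0 : F ≠ 0 := by rintro rfl; rw [zero_mul] at hG; exact hlne hG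
  have hG0 : G ≠ 0 := by rintro rfl; rw [mul_zero] at hG; exact hlne hG
  have hFirr := hirr.resolve_left hF0
  -- F is not constant and divides a form of degree one, so it is `lin` up to a constant, and `quad`
  -- vanishes on the plane `lin` = 0. But that plane contains e + f at infinity, where `quad` has
  -- the value (e + f)·(e + f) = 2.
  have hdeg : (S.lin MvPolynomial.X (MvPolynomial.C c)).totalDegree ≤ 1 := by
    have hC : ∀ q : ℂ[X], aeval (MvPolynomial.C c : MvPolynomial (Fin 4) ℂ) q =
        MvPolynomial.C (q.eval c) := by
      intro q
      rw [← MvPolynomial.algebraMap_eq, aeval_algebraMap_apply, coe_aeval_eq_eval]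
    have hX : ∀ (a : ℂ) (i : Fin 4), (MvPolynomial.C a * MvPolynomial.X i).totalDegree ≤ 1 := by
      intro a i
      refine (MvPolynomial.totalDegree_mul _ _).trans ?_
      rw [MvPolynomial.totalDegree_C, MvPolynomial.totalDegree_X]
    have hlinC : S.lin MvPolynomial.X (MvPolynomial.C c) =
        ∑ i, MvPolynomial.C (-2 * (S.vel i).eval c * S.den.eval c) * MvPolynomial.X i.succ +
          MvPolynomial.C (2 * (∑ i, (S.vel i).eval c * (S.ctr i).eval c) -
            S.den.eval c * S.radVel.eval c) * MvPolynomial.X 0 := by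
      simp only [lin, off, hC, Fin.sum_univ_three, map_mul, map_sub, map_add, map_neg, map_ofNat]
      ring
    rw [hlinC]
    refine (MvPolynomial.totalDegree_add _ _).trans (max_le ?_ (hX _ _))
    exact MvPolynomial.totalDegree_finsetSum_le fun i _ => hX _ _
  have hFdeg : F.totalDegree ≠ 0 := by
    intro h
    rw [MvPolynomial.totalDegree_eq_zero_iff_eq_C] at h
    apply hFirr.not_isUnit
    rw [h]
    refine IsUnit.map MvPolynomial.C (isUnit_iff_ne_zero.2 fun h1 => hF0 ?_)
    rw [h, h1, map_zero]
  have hGdeg : G.totalDegree = 0 := by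
    rw [hG, MvPolynomial.totalDegree_mul_of_isDomain hF0 hG0] at hdeg
    omega
  rw [MvPolynomial.totalDegree_eq_zero_iff_eq_C] at hGdeg
  have hg0 : G.coeff 0 ≠ 0 := by
    intro h; apply hG0; rw [hGdeg, h, map_zero]
  obtain ⟨e, f, hne, hnf, hee, hff, hef, -⟩ := exists_hyperbolic_pair _ hσ
  have h1 : S.lin (S.ofOff c 0 (e + f)) c = 0 := by
    rw [hlin0, dotProduct_add, hne, hnf, add_zero, mul_zero]
  have h2 : MvPolynomial.eval (S.ofOff c 0 (e + f)) F = 0 := by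
    rw [← hl, hG, map_mul, hGdeg, MvPolynomial.eval_C] at h1
    exact (mul_eq_zero.1 h1).resolve_right hg0
  have h3 := hq (S.ofOff c 0 (e + f))
  rw [hQ, map_mul, h2, zero_mul, hquad0] at h3
  simp only [add_dotProduct, dotProduct_add, hee, hff, hef, dotProduct_comm f e] at h3
  norm_num at h3

theorem X_zero_not_mem_idl (hS : S.bad ≠ 0) : MvPolynomial.X 0 ∉ S.idl := by
  obtain ⟨t, ht, hv⟩ := S.zero_mem_cone hS
  obtain ⟨w, -, hw, -⟩ := S.exists_pair_of_eval_ne_zero ht hv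
    (MvPolynomial.isHomogeneous_one (Fin 4) ℂ) (by simp)
  intro h
  have := S.mem_idl.1 h _ ⟨t, ht, hw⟩
  simp [ofOff] at this

variable {K : Type*} [Field K] [Algebra ℂ K] {p : Fin 4 → K}
variable {Ω : Type*} [Field Ω] [Algebra K Ω] [Algebra ℂ Ω] [IsScalarTower ℂ K Ω]

theorem IsGenericPoint.aeval_algebraMap_eq_zero_iff (hp : S.IsGenericPoint p)
    (f : MvPolynomial (Fin 4) ℂ) :
    MvPolynomial.aeval (fun i => algebraMap K Ω (p i)) f = 0 ↔ f ∈ S.idl := by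
  have : MvPolynomial.aeval (fun i => algebraMap K Ω (p i)) f =
      algebraMap K Ω (MvPolynomial.aeval p f) := MvPolynomial.aeval_algebraMap_apply _ _ _
  rw [this, _root_.map_eq_zero, hp.aeval_eq_zero_iff]

/-- The parameter of a circle through the generic point is transcendental. -/
theorem IsGenericPoint.param_not_mem_range (hp : S.IsGenericPoint p) {F : MvPolynomial (Fin 4) ℂ}
    (hF : S.idl = Ideal.span {F}) (hirr : F = 0 ∨ Irreducible F) {τ : Ω}
    (hτ : S.IsCircleParam (fun i => algebraMap K Ω (p i)) τ) (hbad : aeval τ S.bad ≠ 0) :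
    τ ∉ (algebraMap ℂ Ω).range := by
  -- If the parameter were a constant c, the equations of the circle at c would hold at the generic
  -- point, hence on all of X.
  rintro ⟨c, rfl⟩
  have hc : S.bad.eval c ≠ 0 := by
    intro h; apply hbad
    rw [aeval_algebraMap_apply, coe_aeval_eq_eval, h, map_zero]
  refine lin_not_mem_idl hF hirr hc ?_ ?_
  · rw [← hp.aeval_algebraMap_eq_zero_iff (Ω := Ω), map_lin]
    simpa using hτ.2
  · rw [← hp.aeval_algebraMap_eq_zero_iff (Ω := Ω), map_quad]
    simpa using hτ.1

/-- The coordinates of the generic point do not all lie in the algebraic closure of a field of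
transcendence degree at most two. -/
theorem IsGenericPoint.exists_not_isAlgebraic (hp : S.IsGenericPoint p)
    {F : MvPolynomial (Fin 4) ℂ} (hF : S.idl = Ideal.span {F}) (hirr : F = 0 ∨ Irreducible F)
    {s : Set Ω} (hs : (AlgebraicIndependent.matroid ℂ Ω).eRk s ≤ 2) :
    ∃ i, ¬IsAlgebraic (Algebra.adjoin ℂ s) (algebraMap K Ω (p i)) := by
  by_contra! H
  set P : Fin 4 → Ω := fun i => algebraMap K Ω (p i) with hP
  have hcl : ∀ i, P i ∈ (AlgebraicIndependent.matroid ℂ Ω).closure s := fun i => by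
    rw [AlgebraicIndependent.matroid_closure_eq]
    exact H i
  -- In rank at most two any three coordinates are dependent. A relation without the variable i is a
  -- nonzero multiple of F, so F does not contain this variable either. For all i together, F is
  -- constant and not irreducible.
  have hdep : ∀ i : Fin 4, i ∉ F.vars ∧ F ≠ 0 := by
    intro i
    have hna : ¬AlgebraicIndependent ℂ (P ∘ i.succAbove) := by
      intro hai
      have h1 : (AlgebraicIndependent.matroid ℂ Ω).Indep (Set.range (P ∘ i.succAbove)) := by
        rw [AlgebraicIndependent.matroid_indep_iff]
        exact hai.coe_range
      have h2 := h1.eRk_eq_encard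
      have h3 : (Set.range (P ∘ i.succAbove)).encard = 3 := by
        rw [← Set.image_univ, hai.injective.encard_image]
        simp
      have h4 : (AlgebraicIndependent.matroid ℂ Ω).eRk (Set.range (P ∘ i.succAbove)) ≤ 2 := by
        refine le_trans ((AlgebraicIndependent.matroid ℂ Ω).eRk_mono ?_)
          (((AlgebraicIndependent.matroid ℂ Ω).eRk_closure_eq s).le.trans hs)
        rintro _ ⟨j, rfl⟩
        exact hcl _
      rw [h2, h3] at h4
      exact absurd h4 (by decide)
    rw [algebraicIndependent_iff] at hna
    push Not at hna
    obtain ⟨f, hf, hf0⟩ := hna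
    have hmem : MvPolynomial.rename i.succAbove f ∈ S.idl := by
      rw [← hp.aeval_algebraMap_eq_zero_iff (Ω := Ω), MvPolynomial.aeval_rename]
      exact hf
    have hne : MvPolynomial.rename i.succAbove f ≠ 0 := by
      rw [Ne, MvPolynomial.rename_eq_zero_iff_of_injective _ Fin.succAbove_right_injective]
      exact hf0
    rw [hF, Ideal.mem_span_singleton] at hmem
    obtain ⟨G, hG⟩ := hmem
    have hF0 : F ≠ 0 := by rintro rfl; rw [zero_mul] at hG; exact hne hG
    have hG0 : G ≠ 0 := by rintro rfl; rw [mul_zero] at hG; exact hne hG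
    refine ⟨fun hi => ?_, hF0⟩
    have hi' : i ∈ (MvPolynomial.rename i.succAbove f).vars := by
      rw [MvPolynomial.vars_def, Multiset.mem_toFinset] at hi ⊢
      rw [hG, MvPolynomial.degrees_mul_eq hF0 hG0]
      exact Multiset.mem_add.2 (.inl hi)
    have := MvPolynomial.vars_rename i.succAbove f hi'
    simp at this
  have hF0 := (hdep 0).2
  have hv : F.vars = ∅ := Finset.eq_empty_of_forall_notMem fun i => (hdep i).1
  rw [MvPolynomial.vars_eq_empty_iff_eq_C] at hv
  apply (hirr.resolve_left hF0).not_isUnit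
  rw [hv]
  refine IsUnit.map MvPolynomial.C (isUnit_iff_ne_zero.2 fun h1 => hF0 ?_)
  rw [hv, h1, map_zero]

end SphereFamily

theorem map_tangency {A B : Type*} [CommRing A] [CommRing B] (φ : A →+* B) (n n' : Fin 3 → A)
    (d d' q q' : A) : φ (tangency n n' d d' q q') =
      tangency (fun i => φ (n i)) (fun i => φ (n' i)) (φ d) (φ d') (φ q) (φ q') := by
  simp [tangency, map_ofNat]

/-- Two spheres with a common tangent plane at a common point are tangent. -/
theorem tangency_eq_zero {Ω : Type*} [Field Ω] {n n' y y' P : Fin 3 → Ω} {d d' q q' P₀ κ : Ω}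
    (hP₀ : P₀ ≠ 0) (hy : ∀ i, y i = d * P i - n i * P₀) (hy' : ∀ i, y' i = d' * P i - n' i * P₀)
    (hq : ∑ i, y i ^ 2 = d * q * P₀ ^ 2) (hq' : ∑ i, y' i ^ 2 = d' * q' * P₀ ^ 2)
    (hκ : ∀ i, y' i = κ * y i) :
    tangency n n' d d' q q' = 0 ∧ (∀ i, y i * (κ * d - d') = (n i * d' - n' i * d) * P₀) ∧
      ∑ i, (n i * d' - n' i * d) ^ 2 = (κ * d - d') ^ 2 * (d * q) := by
  -- The offsets are proportional, so both centers and the common point are collinear. This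
  -- expresses the distance of the centers and the second radius through the first radius and κ, and
  -- tangency becomes an identity.
  have h1 : ∀ i, y i * (κ * d - d') = (n i * d' - n' i * d) * P₀ := by
    intro i
    have := hκ i
    linear_combination -d * this + d * hy' i - d' * hy i
  have h2 : ∑ i, (n i * d' - n' i * d) ^ 2 = (κ * d - d') ^ 2 * (d * q) := by
    apply mul_right_cancel₀ (pow_ne_zero 2 hP₀)
    rw [Finset.sum_mul, mul_assoc, ← hq, Finset.mul_sum]
    refine Finset.sum_congr rfl fun i _ => ?_
    rw [← mul_pow, ← h1 i]; ring
  have h3 : q' * d' = κ ^ 2 * (d * q) := by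
    apply mul_right_cancel₀ (pow_ne_zero 2 hP₀)
    have : ∑ i, y' i ^ 2 = κ ^ 2 * ∑ i, y i ^ 2 := by
      rw [Finset.mul_sum]
      exact Finset.sum_congr rfl fun i _ => by rw [hκ i]; ring
    rw [hq, hq'] at this
    linear_combination this
  refine ⟨?_, h1, h2⟩
  rw [tangency, h2]
  have e : 4 * q * q' * d ^ 3 * d' ^ 3 = 4 * q * d ^ 3 * d' ^ 2 * (q' * d') := by ring
  have e' : q' * d' * d ^ 2 = (q' * d') * d ^ 2 := rfl
  rw [e, h3]
  ring

/-- An element of an extension of an algebraically closed field that is a root of a nonzero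
polynomial is in the base field. -/
theorem aeval_ne_zero_of_not_mem_range {Ω : Type*} [Field Ω] [Algebra ℂ Ω] {τ : Ω}
    (hτ : τ ∉ (algebraMap ℂ Ω).range) {q : Polynomial ℂ} (hq : q ≠ 0) :
    Polynomial.aeval τ q ≠ 0 := by
  intro h
  apply hτ
  have hint : IsIntegral ℂ τ := isAlgebraic_iff_isIntegral.1 ⟨q, hq, h⟩
  exact minpoly.mem_range_of_degree_eq_one ℂ τ
    (IsAlgClosed.degree_eq_one_of_irreducible ℂ (minpoly.irreducible hint))

/-- A common point of two spheres with the same tangent plane is algebraic over the field generated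
by the data of the spheres. -/
theorem isAlgebraic_of_tangent {R Ω : Type*} [CommRing R] [IsDomain R] [Field Ω] [Algebra R Ω]
    {n n' y P : Fin 3 → Ω} {d d' q P₀ e : Ω} (he : e ≠ 0) (hd : d ≠ 0) (hq : q ≠ 0)
    (hy : ∀ i, y i = d * P i - n i * P₀)
    (hye : ∀ i, y i * e = (n i * d' - n' i * d) * P₀)
    (hsum : ∑ i, (n i * d' - n' i * d) ^ 2 = e ^ 2 * (d * q))
    (an : ∀ i, IsAlgebraic R (n i)) (an' : ∀ i, IsAlgebraic R (n' i)) (ad : IsAlgebraic R d)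
    (ad' : IsAlgebraic R d') (aq : IsAlgebraic R q) (aP : IsAlgebraic R P₀) (i : Fin 3) :
    IsAlgebraic R (P i) := by
  have hdiff : ∀ i, IsAlgebraic R (n i * d' - n' i * d) := fun i =>
    ((an i).mul ad').sub ((an' i).mul ad)
  have hk : IsAlgebraic R e := by
    refine IsAlgebraic.of_pow two_pos ?_
    have h5 : e ^ 2 = (∑ i, (n i * d' - n' i * d) ^ 2) * (d * q)⁻¹ := by
      rw [hsum, mul_assoc, mul_inv_cancel₀ (mul_ne_zero hd hq), mul_one]
    rw [h5, Fin.sum_univ_three]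
    exact ((((hdiff _).pow 2).add ((hdiff _).pow 2)).add ((hdiff _).pow 2)).mul (ad.mul aq).inv
  have h6 : P i = ((n i * d' - n' i * d) * P₀ * e⁻¹ + n i * P₀) * d⁻¹ := by
    rw [← hye i, mul_assoc, mul_inv_cancel₀ he, mul_one, hy i, eq_mul_inv_iff_mul_eq₀ hd]
    ring
  rw [h6]
  exact ((((hdiff i).mul aP).mul hk.inv).add ((an i).mul aP)).mul ad.inv

theorem isAlgebraic_adjoin_aeval {Ω : Type*} [Field Ω] [Algebra ℂ Ω] {s : Set Ω} {a : Ω}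
    (ha : a ∈ s) (q : Polynomial ℂ) :
    IsAlgebraic (Algebra.adjoin ℂ s) (Polynomial.aeval a q) :=
  isAlgebraic_algebraMap (A := Ω) (⟨Polynomial.aeval a q,
    Algebra.adjoin_mono (Set.singleton_subset_iff.2 ha)
      (Polynomial.aeval_mem_adjoin_singleton ℂ a)⟩ : Algebra.adjoin ℂ s)

/-- A dependent pair has rank at most one, and a further element adds at most one. -/
theorem eRk_insert_pair_le {Ω : Type*} [Field Ω] [Algebra ℂ Ω] {a b : Ω} (c : Ω) (hne : a ≠ b)
    (h : ¬AlgebraicIndependent ℂ ![a, b]) :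
    (AlgebraicIndependent.matroid ℂ Ω).eRk {c, a, b} ≤ 2 := by
  have h1 : ¬(AlgebraicIndependent.matroid ℂ Ω).Indep {a, b} := by
    intro h'
    apply h
    rw [AlgebraicIndependent.matroid_indep_iff] at h'
    have := h'.comp (fun i : Fin 2 => (⟨![a, b] i, by fin_cases i <;> simp⟩ : ({a, b} : Set Ω)))
      (by
        intro i j hij
        rw [Subtype.mk.injEq] at hij
        fin_cases i <;> fin_cases j
        · rfl
        · exact absurd hij hne
        · exact absurd hij.symm hne
        · rfl)
    exact this
  have h2 : (AlgebraicIndependent.matroid ℂ Ω).eRk {a, b} < 2 := by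
    rw [← Set.encard_pair hne]
    exact Matroid.eRk_lt_encard_of_dep_of_finite (Set.toFinite _) ⟨h1, by simp⟩
  refine ((AlgebraicIndependent.matroid ℂ Ω).eRk_insert_le_add_one _ _).trans ?_
  exact Order.add_one_le_of_lt h2

/-! ### Uniqueness of the circle through the generic point -/

namespace SphereFamily

open Polynomial

variable {S : SphereFamily}
variable {K : Type*} [Field K] [Algebra ℂ K] {p : Fin 4 → K}
variable {Ω : Type*} [Field Ω] [Algebra K Ω] [Algebra ℂ Ω] [IsScalarTower ℂ K Ω]

theorem polar_single_succ (S : SphereFamily) (P : Fin 4 → Ω) (τ : Ω) (j : Fin 3) :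
    S.polar P (Pi.single j.succ 1) τ = 2 * (S.off P τ j * aeval τ S.den) := by
  have h : ∀ i, S.off (Pi.single j.succ 1 : Fin 4 → Ω) τ i = if i = j then aeval τ S.den else 0 := by
    intro i
    by_cases hij : i = j
    · subst hij
      simp [off]
    · have : i.succ ≠ j.succ := fun h => hij (Fin.succ_injective _ h)
      simp [off, hij, this]
  simp [polar, h]

theorem polar_single_zero (S : SphereFamily) (P : Fin 4 → Ω) (τ : Ω) :
    S.polar P (Pi.single 0 1) τ = -2 * ∑ i, S.off P τ i * aeval τ (S.ctr i) -
      2 * (aeval τ S.den * aeval τ S.rad * P 0) := by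
  have h : ∀ i, S.off (Pi.single 0 1 : Fin 4 → Ω) τ i = -aeval τ (S.ctr i) := by
    intro i
    simp [off]
  simp [polar, h]

/-- The generic point is on at most one characteristic circle. -/
theorem IsGenericPoint.param_unique (hp : S.IsGenericPoint p) (hprop : S.IsProper)
    [Algebra.IsAlgebraic K Ω] {F : MvPolynomial (Fin 4) ℂ} (hF : S.idl = Ideal.span {F})
    (hirr : F = 0 ∨ Irreducible F) {τ τ' : Ω}
    (hτ : S.IsCircleParam (fun i => algebraMap K Ω (p i)) τ) (hbad : aeval τ S.bad ≠ 0)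
    (hτ' : S.IsCircleParam (fun i => algebraMap K Ω (p i)) τ') (hbad' : aeval τ' S.bad ≠ 0) :
    τ = τ' := by
  have : CharZero Ω := charZero_of_injective_algebraMap (algebraMap ℂ Ω).injective
  have hS : S.bad ≠ 0 := by rintro h; rw [h, map_zero] at hbad; exact hbad rfl
  have hr := hp.param_not_mem_range hF hirr hτ hbad
  have hr' := hp.param_not_mem_range hF hirr hτ' hbad'
  obtain ⟨α, hα⟩ := hp.exists_polar_eq hF hτ hbad
  obtain ⟨α', hα'⟩ := hp.exists_polar_eq hF hτ' hbad'
  have hP₀ : algebraMap K Ω (p 0) ≠ 0 := by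
    have := mt (hp.aeval_algebraMap_eq_zero_iff (Ω := Ω) _).1 (X_zero_not_mem_idl hS)
    simpa using this
  set P : Fin 4 → Ω := fun i => algebraMap K Ω (p i) with hP
  have hden : ∀ σ : Ω, aeval σ S.bad ≠ 0 → aeval σ S.den ≠ 0 := by
    intro σ hσ h; apply hσ; rw [bad, map_mul, map_mul, h, zero_mul, zero_mul]
  have hd := hden _ hbad
  have hd' := hden _ hbad'
  have hrad : S.rad ≠ 0 := by
    intro h; apply hS; simp [bad, radVel, h]
  have hq0 := aeval_ne_zero_of_not_mem_range hr hrad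
  -- A zero polar form would place the point at the center of a sphere of radius zero, but the
  -- nonzero polynomial `rad` has no transcendental root.
  have hα0 : α ≠ 0 := by
    rintro rfl
    have h0 : ∀ w, S.polar P w τ = 0 := fun w => by rw [hα, zero_mul]
    have h1 : ∀ j, S.off P τ j = 0 := by
      intro j
      have := h0 (Pi.single j.succ 1)
      rw [polar_single_succ] at this
      exact (mul_eq_zero.1 ((mul_eq_zero.1 this).resolve_left two_ne_zero)).resolve_right hd
    have h2 := h0 (Pi.single 0 1)
    rw [polar_single_zero] at h2
    simp only [h1, zero_mul, Finset.sum_const_zero, mul_zero, zero_sub, neg_eq_zero] at h2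
    exact mul_ne_zero two_ne_zero (mul_ne_zero (mul_ne_zero hd hq0) hP₀) h2
  -- Both `den` · `off` at τ and `den` · `off` at τ' are multiples of the gradient of F; eliminating
  -- the gradient gives this ratio of the offsets.
  set κ := aeval τ S.den * α' / (aeval τ' S.den * α) with hκd
  have hκ : ∀ i, S.off P τ' i = κ * S.off P τ i := by
    intro i
    have h1 := hα (Pi.single i.succ 1)
    have h2 := hα' (Pi.single i.succ 1)
    rw [polar_single_succ] at h1 h2
    rw [hκd, div_mul_eq_mul_div, eq_div_iff (mul_ne_zero hd' hα0)]
    apply mul_left_cancel₀ (two_ne_zero (α := Ω))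
    linear_combination α * h2 - α' * h1
  obtain ⟨htan, hy, hsum⟩ := tangency_eq_zero (P := fun i => P i.succ) (P₀ := P 0)
    (n := fun i => aeval τ (S.ctr i)) (n' := fun i => aeval τ' (S.ctr i)) (q := aeval τ S.rad)
    (q' := aeval τ' S.rad) hP₀ (fun i => rfl) (fun i => rfl)
    (sub_eq_zero.1 hτ.1) (sub_eq_zero.1 hτ'.1) hκ
  -- In this case the centers coincide and properness applies.
  by_cases hc : κ * aeval τ S.den - aeval τ' S.den = 0
  · refine hprop.eq_of_aeval hr hr' hd hd' fun i => ?_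
    have h1 := hy i
    rw [hc, mul_zero, eq_comm, mul_eq_zero, or_iff_left hP₀] at h1
    exact sub_eq_zero.1 h1
  by_contra hne
  -- For distinct centers the point of contact is algebraic over τ, τ' and `P 0`. If τ and τ' were
  -- dependent, the coordinates of the generic point would have transcendence degree at most two.
  have hdep : AlgebraicIndependent ℂ ![τ, τ'] := by
    by_contra hnot
    obtain ⟨i, hi⟩ := hp.exists_not_isAlgebraic hF hirr (eRk_insert_pair_le (P 0) hne hnot)
    apply hi
    have hpτ := isAlgebraic_adjoin_aeval (s := {P 0, τ, τ'}) (a := τ) (by simp)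
    have hpτ' := isAlgebraic_adjoin_aeval (s := {P 0, τ, τ'}) (a := τ') (by simp)
    have h0 := isAlgebraic_adjoin_aeval (s := {P 0, τ, τ'}) (a := P 0) (by simp) X
    rw [aeval_X] at h0
    refine Fin.cases h0 (fun j => ?_) i
    exact isAlgebraic_of_tangent (P := fun i => P i.succ) hc hd hq0 (fun i => rfl) hy hsum
      (fun i => hpτ _) (fun i => hpτ' _) (hpτ _) (hpτ' _) (hpτ _) h0 j
  let f : MvPolynomial (Fin 2) ℂ := tangency (fun i => aeval (MvPolynomial.X 0) (S.ctr i))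
    (fun i => aeval (MvPolynomial.X 1) (S.ctr i)) (aeval (MvPolynomial.X 0) S.den)
    (aeval (MvPolynomial.X 1) S.den) (aeval (MvPolynomial.X 0) S.rad)
    (aeval (MvPolynomial.X 1) S.rad)
  -- A condition satisfied by independent parameters is an identity, so any two spheres of the
  -- family would be tangent.
  have hf : f = 0 := by
    refine (algebraicIndependent_iff.1 hdep) f ?_
    have := map_tangency (MvPolynomial.aeval (R := ℂ) ![τ, τ']).toRingHom
      (fun i => aeval (MvPolynomial.X 0) (S.ctr i))
      (fun i => aeval (MvPolynomial.X 1) (S.ctr i)) (aeval (MvPolynomial.X 0) S.den)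
      (aeval (MvPolynomial.X 1) S.den) (aeval (MvPolynomial.X 0) S.rad)
      (aeval (MvPolynomial.X 1) S.rad)
    refine this.trans ?_
    simp only [AlgHom.toRingHom_eq_coe, RingHom.coe_coe, aeval_aeval_X]
    exact htan
  obtain ⟨t, ht, -⟩ := S.zero_mem_cone hS
  obtain ⟨u, hu⟩ := S.exists_not_tangent ht
  apply hu
  have := map_tangency (MvPolynomial.eval ![t, u])
      (fun i => aeval (MvPolynomial.X 0) (S.ctr i))
      (fun i => aeval (MvPolynomial.X 1) (S.ctr i)) (aeval (MvPolynomial.X 0) S.den)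
      (aeval (MvPolynomial.X 1) S.den) (aeval (MvPolynomial.X 0) S.rad)
      (aeval (MvPolynomial.X 1) S.rad)
  rw [show tangency _ _ _ _ _ _ = f from rfl, hf, map_zero] at this
  simp only [eval_aeval_X] at this
  exact this.symm

/-- A principal vanishing ideal of the union of the characteristic circles is not zero. -/
theorem IsGenericPoint.ne_zero (hp : S.IsGenericPoint p) [Algebra.IsAlgebraic K Ω] [IsAlgClosed Ω]
    (hS : S.bad ≠ 0) {F : MvPolynomial (Fin 4) ℂ} (hF : S.idl = Ideal.span {F})
    (hirr : F = 0 ∨ Irreducible F) : F ≠ 0 := by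
  -- For F = 0 the gradient vanishes, and so does the polar form of the sphere, which is excluded as
  -- in `param_unique`.
  rintro rfl
  have : CharZero Ω := charZero_of_injective_algebraMap (algebraMap ℂ Ω).injective
  obtain ⟨τ, hτ, hbad⟩ := hp.exists_param (Ω := Ω)
  have hr := hp.param_not_mem_range hF hirr hτ hbad
  obtain ⟨α, hα⟩ := hp.exists_polar_eq hF hτ hbad
  simp only [map_zero, TrivSqZeroExt.snd_zero, mul_zero] at hα
  have hP₀ : algebraMap K Ω (p 0) ≠ 0 := by
    have := mt (hp.aeval_algebraMap_eq_zero_iff (Ω := Ω) _).1 (X_zero_not_mem_idl hS)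
    simpa using this
  have hd : aeval τ S.den ≠ 0 := by
    intro h; apply hbad; rw [bad, map_mul, map_mul, h, zero_mul, zero_mul]
  have hrad : S.rad ≠ 0 := by
    intro h; apply hS; simp [bad, radVel, h]
  have h1 : ∀ j, S.off (fun i => algebraMap K Ω (p i)) τ j = 0 := by
    intro j
    have := hα (Pi.single j.succ 1)
    rw [polar_single_succ] at this
    exact (mul_eq_zero.1 ((mul_eq_zero.1 this).resolve_left two_ne_zero)).resolve_right hd
  have h2 := hα (Pi.single 0 1)
  rw [polar_single_zero] at h2
  simp only [h1, zero_mul, Finset.sum_const_zero, mul_zero, zero_sub, neg_eq_zero] at h2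
  exact mul_ne_zero two_ne_zero (mul_ne_zero (mul_ne_zero hd
    (aeval_ne_zero_of_not_mem_range hr hrad)) hP₀) h2

end SphereFamily

/-! ### The parameter as a rational function on the surface -/

namespace SphereFamily

open Polynomial

variable {S : SphereFamily}

theorem exists_isGenericPoint [hI : S.idl.IsPrime] : S.IsGenericPoint
    (fun i => algebraMap (MvPolynomial (Fin 4) ℂ ⧸ S.idl)
      (FractionRing (MvPolynomial (Fin 4) ℂ ⧸ S.idl)) (Ideal.Quotient.mk S.idl (MvPolynomial.X i))) := by
  have key : ∀ f : MvPolynomial (Fin 4) ℂ, MvPolynomial.aeval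
      (fun i => algebraMap (MvPolynomial (Fin 4) ℂ ⧸ S.idl)
      (FractionRing (MvPolynomial (Fin 4) ℂ ⧸ S.idl)) (Ideal.Quotient.mk S.idl (MvPolynomial.X i))) f =
      algebraMap (MvPolynomial (Fin 4) ℂ ⧸ S.idl)
        (FractionRing (MvPolynomial (Fin 4) ℂ ⧸ S.idl)) (Ideal.Quotient.mk S.idl f) := by
    intro f
    refine (MvPolynomial.aeval_algebraMap_apply _
      (fun i => Ideal.Quotient.mk S.idl (MvPolynomial.X i)) f).trans ?_
    congr 1
    have : MvPolynomial.aeval (R := ℂ) (fun i => Ideal.Quotient.mk S.idl (MvPolynomial.X i)) =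
        Ideal.Quotient.mkₐ ℂ S.idl := by
      ext i; simp
    rw [this]; rfl
  refine ⟨fun f => ?_, fun x => ?_⟩
  · rw [key, FaithfulSMul.algebraMap_eq_zero_iff, Ideal.Quotient.eq_zero_iff_mem]
  · obtain ⟨a, b, hb, rfl⟩ := IsFractionRing.div_surjective (A := MvPolynomial (Fin 4) ℂ ⧸ S.idl) x
    obtain ⟨a, rfl⟩ := Ideal.Quotient.mk_surjective a
    obtain ⟨b, rfl⟩ := Ideal.Quotient.mk_surjective b
    have hb0 : algebraMap (MvPolynomial (Fin 4) ℂ ⧸ S.idl)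
        (FractionRing (MvPolynomial (Fin 4) ℂ ⧸ S.idl)) (Ideal.Quotient.mk S.idl b) ≠ 0 := by
      rw [Ne, FaithfulSMul.algebraMap_eq_zero_iff]
      exact nonZeroDivisors.ne_zero hb
    exact ⟨a, b, by rwa [key], by rw [key, key, div_mul_cancel₀ _ hb0]⟩

/-- The parameter of the characteristic circle is a rational function on the canal surface. -/
theorem exists_rational_inverse (hS : S.bad ≠ 0) (hprop : S.IsProper)
    {F : MvPolynomial (Fin 4) ℂ} (hF : S.idl = Ideal.span {F}) (hirr : F = 0 ∨ Irreducible F) :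
    F ≠ 0 ∧ ∃ (d : ℕ) (a b : MvPolynomial (Fin 4) ℂ),
      a.IsHomogeneous d ∧ b.IsHomogeneous d ∧ b ∉ S.idl ∧
      ∀ t, S.bad.eval t ≠ 0 → ∀ v ∈ S.circleCone t,
        MvPolynomial.eval v b * t = MvPolynomial.eval v a := by
  have := S.idl_isPrime hS
  have hp := exists_isGenericPoint (S := S)
  exact ⟨hp.ne_zero (Ω := AlgebraicClosure (FractionRing (MvPolynomial (Fin 4) ℂ ⧸ S.idl)))
      hS hF hirr,
    hp.exists_rational_param
      (Ω := AlgebraicClosure (FractionRing (MvPolynomial (Fin 4) ℂ ⧸ S.idl)))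
      (fun τ τ' h1 h2 h3 h4 => hp.param_unique hprop hF hirr h1 h2 h3 h4)⟩

end SphereFamily

/-! ### The projective closure of a rational curve -/

/-- Over an infinite field, finitely many nonzero vectors of the quotient by q are outside the
kernel of one common functional. -/
theorem exists_dotProduct_ne_zero {n : ℕ} {ι : Type*} [Finite ι] (q : Fin n → ℂ) (w : ι → Fin n → ℂ)
    (hw : ∀ i, w i ∉ Submodule.span ℂ {q}) :
    ∃ l : Fin n → ℂ, l ⬝ᵥ q = 0 ∧ ∀ i, l ⬝ᵥ w i ≠ 0 := by
  obtain ⟨f, hf⟩ := Module.exists_dual_forall_apply_ne_zero (K := ℂ)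
    (fun i => (Submodule.span ℂ {q}).mkQ (w i))
    (fun i => by simpa [Submodule.Quotient.mk_eq_zero] using hw i)
  have key : ∀ x, (fun i => f ((Submodule.span ℂ {q}).mkQ (Pi.single i 1))) ⬝ᵥ x =
      f ((Submodule.span ℂ {q}).mkQ x) := by
    intro x
    conv_rhs => rw [pi_eq_sum_univ' x]
    simp [dotProduct, map_sum, mul_comm]
  refine ⟨fun i => f ((Submodule.span ℂ {q}).mkQ (Pi.single i 1)), ?_, fun i => ?_⟩
  · rw [key]
    have : (Submodule.span ℂ {q}).mkQ q = 0 := by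
      simp [Submodule.Quotient.mk_eq_zero, Submodule.mem_span_singleton_self]
    rw [this, map_zero]
  · rw [key]; exact hf i

theorem not_mem_span_singleton_symm {n : ℕ} {q w : Fin n → ℂ} (hw : w ≠ 0)
    (h : q ∉ Submodule.span ℂ {w}) : w ∉ Submodule.span ℂ {q} := by
  intro h'
  obtain ⟨c, rfl⟩ := Submodule.mem_span_singleton.mp h'
  have hc : c ≠ 0 := by rintro rfl; simp at hw
  exact h (Submodule.mem_span_singleton.mpr ⟨c⁻¹, by rw [smul_smul, inv_mul_cancel₀ hc, one_smul]⟩)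

open Polynomial in
/-- A point of the projective closure of a polynomial curve without base points lies on the curve
or is its point at infinity. -/
theorem mem_span_of_forall_eval_eq_zero {n : ℕ} {s : Fin n → ℂ[X]} {m : ℕ}
    (hm : ∀ i, (s i).natDegree ≤ m) (hm' : (fun i => (s i).coeff m) ≠ 0)
    (hs : ∀ τ, (fun i => (s i).eval τ) ≠ 0) {q : Fin n → ℂ}
    (hq : ∀ f : MvPolynomial (Fin n) ℂ,
      (∀ (τ c : ℂ), MvPolynomial.eval (fun i => c * (s i).eval τ) f = 0) →
        MvPolynomial.eval q f = 0) :
    q ∈ Submodule.span ℂ {fun i => (s i).coeff m} ∨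
      ∃ τ, q ∈ Submodule.span ℂ {fun i => (s i).eval τ} := by
  by_contra! H
  obtain ⟨H1, H2⟩ := H
  have hq0 : q ≠ 0 := by rintro rfl; exact H1 (Submodule.zero_mem _)
  obtain ⟨l, hlq, hl⟩ := exists_dotProduct_ne_zero q (fun _ : Unit => fun i => (s i).coeff m)
    (fun _ => not_mem_span_singleton_symm hm' H1)
  have hl := hl ()
  set P : (Fin n → ℂ) → ℂ[X] := fun l => ∑ i, C (l i) * s i with hP
  have hPdeg : ∀ l, (P l).natDegree ≤ m := fun l =>
    natDegree_sum_le_of_forall_le _ _ fun i _ => (natDegree_C_mul_le _ _).trans (hm i)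
  have hPcoeff : ∀ l, (P l).coeff m = l ⬝ᵥ fun i => (s i).coeff m := fun l => by
    simp [hP, finsetSum_coeff, dotProduct]
  have hPeval : ∀ l τ, (P l).eval τ = l ⬝ᵥ fun i => (s i).eval τ := fun l τ => by
    simp [hP, eval_finsetSum, dotProduct]
  have hu : (P l).natDegree = m := le_antisymm (hPdeg l)
    (le_natDegree_of_ne_zero (by rw [hPcoeff]; exact hl))
  -- The polynomial `P l` has degree exactly m, and `P l'` is made nonzero at each of its roots, so
  -- their resultant is nonzero.
  obtain ⟨l', hlq', hl'⟩ := exists_dotProduct_ne_zero q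
    (fun z : {z // z ∈ (P l).roots.toFinset} => fun i => (s i).eval z.1)
    (fun z => not_mem_span_singleton_symm (hs _) (H2 _))
  obtain ⟨i₀, hi₀⟩ : ∃ i, q i ≠ 0 := by by_contra! h; exact hq0 (funext h)
  set l'' : Fin n → ℂ := Pi.single i₀ (q i₀)⁻¹
  have hlq'' : l'' ⬝ᵥ q = 1 := by simp [l'', hi₀]
  let L : (Fin n → ℂ) → MvPolynomial (Fin n) ℂ := fun l => ∑ i, MvPolynomial.C (l i) * MvPolynomial.X i
  have hL : ∀ l p, MvPolynomial.eval p (L l) = l ⬝ᵥ p := fun l p => by simp [L, dotProduct]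
  -- For m = 0 the curve is a single point, which a linear form separates from q.
  have hm0 : m ≠ 0 := by
    rintro rfl
    obtain ⟨k, hk, hk'⟩ := exists_dotProduct_ne_zero (fun i => (s i).coeff 0) (fun _ : Unit => q)
      (fun _ => H1)
    apply hk' ()
    rw [← hL]
    refine hq _ fun τ c => ?_
    have h0 : (fun i => c * (s i).eval τ) = c • fun i => (s i).coeff 0 := by
      funext i
      conv_lhs => rw [eq_C_of_natDegree_le_zero (hm i)]
      rw [eval_C]; rfl
    rw [hL, h0, dotProduct_smul, hk, smul_zero]
  -- At a point p = c s(τ) of the curve, `Q l` and `Q l'` have the common root τ. At p = q they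
  -- become `P l` and `P l'`. Their resultant is therefore a polynomial in p that vanishes on the
  -- curve and not at q.
  let Q : (Fin n → ℂ) → (MvPolynomial (Fin n) ℂ)[X] := fun l =>
    C (L l'') * (P l).map MvPolynomial.C - C (L l) * (P l'').map MvPolynomial.C
  have hQ : ∀ l p, (Q l).map (MvPolynomial.eval p) = C (l'' ⬝ᵥ p) * P l - C (l ⬝ᵥ p) * P l'' := by
    intro l p
    simp only [Q, Polynomial.map_sub, Polynomial.map_mul, map_C, hL, map_map]
    have : (MvPolynomial.eval p).comp (MvPolynomial.C (σ := Fin n)) = RingHom.id ℂ := by ext; simp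
    rw [this, map_id, map_id]
  have key := hq (resultant (Q l) (Q l') m m) ?_
  · rw [← resultant_map_map, hQ, hQ, hlq, hlq', hlq''] at key
    rw [show (C (1:ℂ) * P l - C (0:ℂ) * P l'') = P l by simp,
      show (C (1:ℂ) * P l' - C (0:ℂ) * P l'') = P l' by simp] at key
    have h := resultant_eq_prod_eval (P l) (P l') m (hPdeg _) (IsAlgClosed.splits _)
    rw [hu, key] at h
    rcases mul_eq_zero.mp h.symm with h | h
    · have h0 : P l = 0 := leadingCoeff_eq_zero.mp (pow_eq_zero_iff hm0 |>.mp h)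
      apply hl; rw [← hPcoeff, h0, coeff_zero]
    · rw [Multiset.prod_eq_zero_iff, Multiset.mem_map] at h
      obtain ⟨z, hz, hz'⟩ := h
      exact hl' ⟨z, Multiset.mem_toFinset.mpr hz⟩ (by rw [← hPeval]; exact hz')
  · intro τ c
    rw [← resultant_map_map, hQ, hQ]
    have hdeg : ∀ (x y : ℂ) (k : Fin n → ℂ), (C x * P k - C y * P l'').natDegree ≤ m :=
      fun x y k => (natDegree_sub_le_of_le ((natDegree_C_mul_le _ _).trans (hPdeg _))
        ((natDegree_C_mul_le _ _).trans (hPdeg _))).trans (max_self m).le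
    obtain ⟨a, b, -, -, hab⟩ := exists_mul_add_mul_eq_C_resultant
      (C (l'' ⬝ᵥ fun i => c * (s i).eval τ) * P l - C (l ⬝ᵥ fun i => c * (s i).eval τ) * P l'')
      (C (l'' ⬝ᵥ fun i => c * (s i).eval τ) * P l' - C (l' ⬝ᵥ fun i => c * (s i).eval τ) * P l'')
      (hdeg _ _ _) (hdeg _ _ _) (Or.inl hm0)
    have h := congrArg (Polynomial.eval τ) hab
    have hd : ∀ l : Fin n → ℂ, (l ⬝ᵥ fun i => c * (s i).eval τ) = c * (P l).eval τ := fun l => by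
      rw [hPeval]; simp only [dotProduct, Finset.mul_sum]
      exact Finset.sum_congr rfl fun i _ => by ring
    simp only [eval_add, eval_mul, eval_sub, eval_C, hd] at h ⊢
    rw [← h]; ring

open Polynomial in
/-- All but finitely many points of the projective closure of a rational curve lie on the curve. -/
theorem exists_finset_closure {n : ℕ} (s : Fin (n + 1) → ℂ[X]) (hs : s 0 ≠ 0) :
    ∃ W : Finset (Fin (n + 1) → ℂ), ∀ q : Fin (n + 1) → ℂ,
      (∀ f : MvPolynomial (Fin (n + 1)) ℂ, (∀ (τ c : ℂ), (s 0).eval τ ≠ 0 →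
        MvPolynomial.eval (fun i => c * (s i).eval τ) f = 0) → MvPolynomial.eval q f = 0) →
      (∃ w ∈ W, q ∈ Submodule.span ℂ {w}) ∨
        ∃ τ, (s 0).eval τ ≠ 0 ∧ q ∈ Submodule.span ℂ {fun i => (s i).eval τ} := by
  classical
  -- Division by the greatest common divisor removes the base points. Then only the point at
  -- infinity and the points at the roots of `s 0` are exceptional.
  obtain ⟨g, hg⟩ := (IsPrincipalIdealRing.principal (Ideal.span (Set.range s))).principal
  have hdvd : ∀ i, g ∣ s i := fun i => by
    rw [← Ideal.mem_span_singleton]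
    exact hg.le (Ideal.subset_span ⟨i, rfl⟩)
  choose r hr using hdvd
  have hg0 : g ≠ 0 := by rintro rfl; exact hs (by rw [hr, zero_mul])
  have hgm : g ∈ Ideal.span (Set.range s) := by
    rw [hg]; exact Ideal.mem_span_singleton_self g
  obtain ⟨c, hc⟩ := (Ideal.mem_span_range_iff_exists_fun).mp hgm
  have hone : ∑ i, c i * r i = 1 := by
    apply mul_left_cancel₀ hg0
    rw [mul_one, Finset.mul_sum]
    conv_rhs => rw [← hc]
    exact Finset.sum_congr rfl fun i _ => by rw [hr i]; ring
  have hrne : ∀ τ, (fun i => (r i).eval τ) ≠ 0 := by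
    intro τ h
    have := congrArg (eval τ) hone
    simp only [eval_finsetSum, eval_mul, fun i => congrFun h i, Pi.zero_apply, mul_zero,
      Finset.sum_const_zero, eval_one] at this
    exact zero_ne_one this
  have hr0 : r 0 ≠ 0 := by intro h; exact hs (by rw [hr, h, mul_zero])
  set m := Finset.univ.sup fun i => (r i).natDegree with hm
  obtain ⟨j, -, hj⟩ := Finset.exists_mem_eq_sup Finset.univ Finset.univ_nonempty
    fun i => (r i).natDegree
  have hmle : ∀ i, (r i).natDegree ≤ m := fun i => Finset.le_sup (f := fun i => (r i).natDegree)
    (Finset.mem_univ i)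
  have hm' : (fun i => (r i).coeff m) ≠ 0 := by
    by_cases hrj : r j = 0
    · have hm0 : m = 0 := by rw [hm, hj, hrj, natDegree_zero]
      intro h
      apply hr0
      have h0 := congrFun h 0
      rw [hm0] at h0
      rw [eq_C_of_natDegree_le_zero ((hmle 0).trans hm0.le)]
      exact (congrArg C h0).trans C_0
    · intro h
      have := congrFun h j
      rw [hm, hj] at this
      exact hrj (leadingCoeff_eq_zero.mp this)
  refine ⟨insert (fun i => (r i).coeff m)
    ((s 0).roots.toFinset.image fun τ i => (r i).eval τ), fun q hq => ?_⟩
  rcases mem_span_of_forall_eval_eq_zero hmle hm' hrne (q := q) (fun f hf => hq f fun τ c _ => by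
    have := hf τ (c * g.eval τ)
    convert this using 3
    funext i
    rw [hr i, eval_mul]; ring) with h | ⟨τ, h⟩
  · exact Or.inl ⟨_, Finset.mem_insert_self _ _, h⟩
  · by_cases hτ : (s 0).eval τ = 0
    · refine Or.inl ⟨_, Finset.mem_insert_of_mem (Finset.mem_image_of_mem _ ?_), h⟩
      rw [Multiset.mem_toFinset, mem_roots hs]; exact hτ
    · refine Or.inr ⟨τ, hτ, ?_⟩
      obtain ⟨a, rfl⟩ := Submodule.mem_span_singleton.mp h
      have hgτ : g.eval τ ≠ 0 := by intro h; apply hτ; rw [hr, eval_mul, h, zero_mul]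
      refine Submodule.mem_span_singleton.mpr ⟨a * (g.eval τ)⁻¹, ?_⟩
      funext i
      simp only [Pi.smul_apply, smul_eq_mul]
      rw [hr i, eval_mul]; field_simp

/-! ### Generic plane sections of an irreducible surface -/

section Section

open Polynomial

/-- By Gauss's lemma f and b are coprime over the fraction field, so their resultant is a nonzero
combination of them. If f has degree zero, it can serve as r itself. -/
theorem exists_bezout_of_irreducible {R : Type*} [CommRing R] [IsDomain R]
    [UniqueFactorizationMonoid R] {f b : R[X]} (hf : Irreducible f) (hb : ¬ f ∣ b) :
    ∃ r : R, r ≠ 0 ∧ ∃ x y, f * x + b * y = C r := by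
  by_cases h0 : f.natDegree = 0
  · have hf' := eq_C_of_natDegree_eq_zero h0
    exact ⟨f.coeff 0, fun h => hf.ne_zero (by rw [hf', h, C_0]), 1, 0, by rw [← hf']; ring⟩
  · have hprim := hf.isPrimitive h0
    have hirr := (hprim.irreducible_iff_irreducible_map_fraction_map (K := FractionRing R)).1 hf
    have hndvd : ¬ f.map (algebraMap R (FractionRing R)) ∣ b.map (algebraMap R (FractionRing R)) :=
      fun h => hb (hprim.dvd_of_fraction_map_dvd_fraction_map h)
    have hcop := (hirr.coprime_iff_not_dvd).2 hndvd
    have hinj := IsFractionRing.injective R (FractionRing R)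
    obtain ⟨x, y, -, -, hxy⟩ := exists_mul_add_mul_eq_C_resultant f b le_rfl le_rfl (Or.inl h0)
    refine ⟨_, fun h => ?_, x, y, hxy⟩
    have h1 : resultant (f.map (algebraMap R (FractionRing R)))
        (b.map (algebraMap R (FractionRing R))) = 0 := by
      rw [natDegree_map_eq_of_injective hinj, natDegree_map_eq_of_injective hinj,
        resultant_map_map, h, map_zero]
    exact (resultant_eq_zero_iff.1 h1).2 hcop

theorem dvd_of_forall_eval_eq_zero {n : ℕ} {φ c : MvPolynomial (Fin n) ℂ} (hφ : Prime φ)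
    (h : ∀ P, MvPolynomial.eval P φ = 0 → MvPolynomial.eval P c = 0) : φ ∣ c := by
  rw [← Ideal.mem_span_singleton, ← ((Ideal.span_singleton_prime hφ.ne_zero).2 hφ).isRadical.radical,
    ← MvPolynomial.vanishingIdeal_zeroLocus_eq_radical (K := ℂ)]
  intro v hv
  rw [MvPolynomial.aeval_eq_eval]
  exact h v (by simpa using hv φ (Ideal.mem_span_singleton_self _))

/-- Otherwise a coefficient of f not divisible by φ, times any variable, would vanish on φ = 0, and
φ would divide two different variables. P ≠ 0 matters because P supplies the coefficients of a
linear form in `exists_generic_not_dvd`. -/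
theorem exists_eval_map_ne_zero_of_not_dvd {n : ℕ} {φ : MvPolynomial (Fin (n + 2)) ℂ} (hφ : Prime φ)
    {f : (MvPolynomial (Fin (n + 2)) ℂ)[X]} (hf : ¬ C φ ∣ f) :
    ∃ P, P ≠ 0 ∧ MvPolynomial.eval P φ = 0 ∧ f.map (MvPolynomial.eval P) ≠ 0 := by
  by_contra! H
  rw [C_dvd_iff_dvd_coeff] at hf
  push Not at hf
  obtain ⟨k, hk⟩ := hf
  have hX : ∀ j, φ ∣ MvPolynomial.X j := fun j => by
    refine (hφ.dvd_or_dvd (dvd_of_forall_eval_eq_zero hφ (c := f.coeff k * MvPolynomial.X j)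
      fun P hP => ?_)).resolve_left hk
    by_cases hP0 : P = 0
    · rw [hP0]; simp
    · have := congrArg (fun g => coeff g k) (H P hP0 hP)
      simp only [coeff_map, coeff_zero] at this
      rw [map_mul, this, zero_mul]
  have hX0 : Irreducible (MvPolynomial.X 0 : MvPolynomial (Fin (n + 2)) ℂ) :=
    MvPolynomial.X_prime.irreducible
  have h10 : (MvPolynomial.X 0 : MvPolynomial (Fin (n + 2)) ℂ) ∣ MvPolynomial.X 1 :=
    ((hX0.dvd_iff.1 (hX 0)).resolve_left hφ.not_isUnit).dvd.trans (hX 1)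
  simp [MvPolynomial.X_dvd_X] at h10

/-- The expression of the first coordinate through the others on the plane `h`. -/
def planeCoord {n : ℕ} (h : Fin (n + 1) → ℂ) : MvPolynomial (Fin n) ℂ :=
  -∑ i, MvPolynomial.C (h i.succ / h 0) * MvPolynomial.X i

theorem eval_planeCoord {n : ℕ} (h : Fin (n + 1) → ℂ) (x : Fin n → ℂ) :
    MvPolynomial.eval x (planeCoord h) = -∑ i, h i.succ / h 0 * x i := by
  simp [planeCoord]

theorem eval_eval_planeCoord {n : ℕ} (h : Fin (n + 1) → ℂ) (x : Fin n → ℂ)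
    (f : (MvPolynomial (Fin n) ℂ)[X]) : MvPolynomial.eval x (f.eval (planeCoord h)) =
      (f.map (MvPolynomial.eval x)).eval (MvPolynomial.eval x (planeCoord h)) := by
  rw [eval_map_apply]

/-- At a fixed zero P of φ, f is a nonzero polynomial in the first coordinate, with finitely many
roots z. If the plane avoids the points (z, P), then f restricted to the plane is nonzero at P,
where φ vanishes. -/
theorem exists_generic_not_dvd {n : ℕ} {φ : MvPolynomial (Fin (n + 2)) ℂ} (hφ : Prime φ)
    {f : (MvPolynomial (Fin (n + 2)) ℂ)[X]} (hf : ¬ C φ ∣ f) :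
    ∃ G : MvPolynomial (Fin (n + 3)) ℂ, G ≠ 0 ∧ ∀ h : Fin (n + 3) → ℂ, h 0 ≠ 0 →
      MvPolynomial.eval h G ≠ 0 → ¬ φ ∣ f.eval (planeCoord h) := by
  obtain ⟨P, hP0, hPφ, hPf⟩ := exists_eval_map_ne_zero_of_not_dvd hφ hf
  let L : ℂ → MvPolynomial (Fin (n + 3)) ℂ := fun z =>
    MvPolynomial.C z * MvPolynomial.X 0 + ∑ i, MvPolynomial.C (P i) * MvPolynomial.X i.succ
  have hL : ∀ z h, MvPolynomial.eval h (L z) = z * h 0 + ∑ i, P i * h i.succ := by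
    intro z h; simp [L]
  refine ⟨∏ z ∈ (f.map (MvPolynomial.eval P)).roots.toFinset, L z,
    Finset.prod_ne_zero_iff.2 fun z _ hz => ?_, fun h h0 hG hdvd => ?_⟩
  · obtain ⟨i, hi⟩ : ∃ i, P i ≠ 0 := by by_contra! h; exact hP0 (funext h)
    have := hL z (Pi.single i.succ 1)
    rw [hz, map_zero] at this
    rw [Finset.sum_eq_single i (fun j _ hj => by
      rw [Pi.single_eq_of_ne (by simpa using hj), mul_zero]) (by simp)] at this
    simp [(Fin.succ_ne_zero i).symm] at this
    exact hi this.symm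
  · obtain ⟨g, hg⟩ := hdvd
    have h1 := congrArg (MvPolynomial.eval P) hg
    rw [map_mul, hPφ, zero_mul, eval_eval_planeCoord] at h1
    rw [map_prod, Finset.prod_ne_zero_iff] at hG
    refine hG _ (by rw [Multiset.mem_toFinset, mem_roots hPf]; exact h1) ?_
    rw [hL, eval_planeCoord, neg_mul, Finset.sum_mul, neg_add_eq_zero]
    exact Finset.sum_congr rfl fun i _ => by field_simp

/-- The Bézout element r does not involve the eliminated coordinate, so it survives the restriction
to any plane. A common factor of the restrictions divides r, and only the finitely many prime
factors of r have to be avoided. -/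
theorem exists_generic_isRelPrime {n : ℕ} {f b : (MvPolynomial (Fin (n + 2)) ℂ)[X]}
    (hf : Irreducible f) (hb : ¬ f ∣ b) :
    ∃ G : MvPolynomial (Fin (n + 3)) ℂ, G ≠ 0 ∧ ∀ h : Fin (n + 3) → ℂ,
      MvPolynomial.eval h G ≠ 0 → h 0 ≠ 0 ∧
        IsRelPrime (f.eval (planeCoord h)) (b.eval (planeCoord h)) := by
  classical
  obtain ⟨r, hr, x, y, hxy⟩ := exists_bezout_of_irreducible hf hb
  have hfac : ∀ φ ∈ UniqueFactorizationMonoid.factors r, ∃ G : MvPolynomial (Fin (n + 3)) ℂ,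
      G ≠ 0 ∧ ∀ h : Fin (n + 3) → ℂ, h 0 ≠ 0 → MvPolynomial.eval h G ≠ 0 →
        ¬ (φ ∣ f.eval (planeCoord h) ∧ φ ∣ b.eval (planeCoord h)) := by
    intro φ hφ
    have hp := UniqueFactorizationMonoid.prime_of_factor φ hφ
    by_cases h1 : C φ ∣ f
    · have h2 : ¬ C φ ∣ b := fun h2 => hb
        (((hf.dvd_iff.1 h1).resolve_left fun h => hp.not_isUnit (isUnit_C.1 h)).dvd.trans h2)
      obtain ⟨G, hG, hG'⟩ := exists_generic_not_dvd hp h2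
      exact ⟨G, hG, fun h h0 hh hd => hG' h h0 hh hd.2⟩
    · obtain ⟨G, hG, hG'⟩ := exists_generic_not_dvd hp h1
      exact ⟨G, hG, fun h h0 hh hd => hG' h h0 hh hd.1⟩
  choose! G hG hG' using hfac
  refine ⟨MvPolynomial.X 0 * ∏ φ ∈ (UniqueFactorizationMonoid.factors r).toFinset, G φ,
    mul_ne_zero (MvPolynomial.X_ne_zero 0) (Finset.prod_ne_zero_iff.2 fun φ hφ =>
      hG φ (Multiset.mem_toFinset.1 hφ)), fun h hh => ?_⟩
  rw [map_mul, MvPolynomial.eval_X, map_prod] at hh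
  have h0 := left_ne_zero_of_mul hh
  have h1 := Finset.prod_ne_zero_iff.1 (right_ne_zero_of_mul hh)
  have hsum : f.eval (planeCoord h) * x.eval (planeCoord h) +
      b.eval (planeCoord h) * y.eval (planeCoord h) = r := by
    rw [← eval_mul, ← eval_mul, ← eval_add, hxy, eval_C]
  refine ⟨h0, WfDvdMonoid.isRelPrime_of_no_irreducible_factors (fun hz => ?_) fun z hz hzf hzb => ?_⟩
  · rw [hz.1, hz.2, zero_mul, zero_mul, add_zero] at hsum
    exact hr hsum.symm
  · have hzr : z ∣ r := hsum ▸ dvd_add (hzf.mul_right _) (hzb.mul_right _)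
    obtain ⟨φ, hφ, hzφ⟩ := UniqueFactorizationMonoid.exists_mem_factors_of_dvd hr hz hzr
    exact hG' φ hφ h h0 (h1 φ (Multiset.mem_toFinset.2 hφ))
      ⟨hzφ.symm.dvd.trans hzf, hzφ.symm.dvd.trans hzb⟩

/-- A generic plane section of an irreducible surface has no component in a given other surface. -/
theorem exists_generic_dense {n : ℕ} {f b : MvPolynomial (Fin (n + 3)) ℂ} (hf : Irreducible f)
    (hb : ¬ f ∣ b) :
    ∃ G : MvPolynomial (Fin (n + 3)) ℂ, G ≠ 0 ∧ ∀ h : Fin (n + 3) → ℂ,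
      MvPolynomial.eval h G ≠ 0 → ∀ g : MvPolynomial (Fin (n + 3)) ℂ,
        (∀ v, MvPolynomial.eval v f = 0 → h ⬝ᵥ v = 0 → MvPolynomial.eval v b ≠ 0 →
          MvPolynomial.eval v g = 0) →
        ∀ v, MvPolynomial.eval v f = 0 → h ⬝ᵥ v = 0 → MvPolynomial.eval v g = 0 := by
  let e := MvPolynomial.finSuccEquiv ℂ (n + 2)
  obtain ⟨G, hG, hG'⟩ := exists_generic_isRelPrime (f := e f) (b := e b)
    ((MulEquiv.irreducible_iff e).2 hf) (fun h => hb ((map_dvd_iff e).1 h))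
  refine ⟨G, hG, fun h hh g hg v hfv hhv => ?_⟩
  obtain ⟨h0, hrel⟩ := hG' h hh
  have hev : ∀ (p : MvPolynomial (Fin (n + 3)) ℂ) (x : Fin (n + 2) → ℂ),
      MvPolynomial.eval x ((e p).eval (planeCoord h)) =
        MvPolynomial.eval (Fin.cons (MvPolynomial.eval x (planeCoord h)) x) p := by
    intro p x
    rw [eval_eval_planeCoord, MvPolynomial.eval_eq_eval_mv_eval']
  have hpl : ∀ x : Fin (n + 2) → ℂ,
      h ⬝ᵥ (Fin.cons (MvPolynomial.eval x (planeCoord h)) x : Fin (n + 3) → ℂ) = 0 := by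
    intro x
    rw [dotProduct, Fin.sum_univ_succ, Fin.cons_zero, eval_planeCoord]
    simp only [Fin.cons_succ]
    rw [mul_neg, Finset.mul_sum, neg_add_eq_zero]
    exact Finset.sum_congr rfl fun i _ => by field_simp
  -- On the plane, g b vanishes where f does, so f divides a power of g b. Being prime to b, it
  -- divides a power of g.
  have hmem : ((e g).eval (planeCoord h)) * ((e b).eval (planeCoord h)) ∈
      (Ideal.span {(e f).eval (planeCoord h)}).radical := by
    rw [← MvPolynomial.vanishingIdeal_zeroLocus_eq_radical (K := ℂ)]
    intro x hx
    have hx : MvPolynomial.eval x ((e f).eval (planeCoord h)) = 0 := by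
      simpa using hx _ (Ideal.mem_span_singleton_self _)
    rw [MvPolynomial.aeval_eq_eval, map_mul]
    by_cases hbx : MvPolynomial.eval x ((e b).eval (planeCoord h)) = 0
    · rw [hbx, mul_zero]
    · rw [hev] at hbx hx ⊢
      rw [hg _ hx (hpl x) hbx, zero_mul]
  obtain ⟨k, hk⟩ := hmem
  rw [mul_pow, Ideal.mem_span_singleton] at hk
  obtain ⟨q, hq⟩ := hrel.pow_right.dvd_of_dvd_mul_right hk
  have hv : (Fin.cons (MvPolynomial.eval (Fin.tail v) (planeCoord h)) (Fin.tail v) :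
      Fin (n + 3) → ℂ) = v := by
    conv_rhs => rw [← Fin.cons_self_tail v]
    congr 1
    rw [dotProduct, Fin.sum_univ_succ] at hhv
    rw [eval_planeCoord, ← mul_right_inj' h0, mul_neg, Finset.mul_sum, ← sub_eq_zero, ← neg_eq_zero,
      ← hhv]
    rw [neg_sub, sub_neg_eq_add]
    congr 1
    exact Finset.sum_congr rfl fun i _ => by simp only [Fin.tail]; field_simp
  have h1 := congrArg (MvPolynomial.eval (Fin.tail v)) hq
  rw [map_mul, map_pow, hev, hev, hv, hfv, zero_mul] at h1
  exact eq_zero_of_pow_eq_zero h1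

end Section

/-! ### Common denominators -/

section RatFunc

open Polynomial

theorem exists_common_denominator {ι : Type*} [Fintype ι] (f : ι → RatFunc ℝ) :
    ∃ (D : ℂ[X]) (N : ι → ℂ[X]), D ≠ 0 ∧ (∀ t, D.eval t ≠ 0 ↔ ∀ i, RegularAt (f i) t) ∧
      ∀ t, D.eval t ≠ 0 → ∀ i, ratVal (f i) t = (N i).eval t / D.eval t := by
  classical
  have hden : ∀ i t, ((f i).denom.map (algebraMap ℝ ℂ)).eval t = aeval t (f i).denom := fun i t =>
    eval_map_algebraMap _ _
  -- The product of the reduced denominators vanishes exactly at the poles.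
  refine ⟨∏ i, (f i).denom.map (algebraMap ℝ ℂ),
    fun i => (f i).num.map (algebraMap ℝ ℂ) *
      ∏ j ∈ Finset.univ.erase i, (f j).denom.map (algebraMap ℝ ℂ), ?_, fun t => ?_, fun t ht i => ?_⟩
  · exact Finset.prod_ne_zero_iff.2 fun i _ =>
      (Polynomial.map_ne_zero_iff (algebraMap ℝ ℂ).injective).2 (f i).denom_ne_zero
  · simp only [eval_prod, Finset.prod_ne_zero_iff, hden, RegularAt, Finset.mem_univ, true_imp_iff]
  · rw [eval_prod] at ht ⊢
    have hi := Finset.prod_ne_zero_iff.1 ht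
    rw [← Finset.mul_prod_erase _ _ (Finset.mem_univ i), eval_mul, eval_prod, ratVal, RatFunc.eval,
      mul_div_mul_right, eval_map, eval_map]
    exact Finset.prod_ne_zero_iff.2 fun j _ => hi j (Finset.mem_univ j)

theorem ratDeriv_eq {f : RatFunc ℝ} {D N : ℂ[X]}
    (h : ∀ t, D.eval t ≠ 0 → ratVal f t = N.eval t / D.eval t) {t : ℂ} (ht : D.eval t ≠ 0) :
    ratDeriv f t = (derivative N * D - N * derivative D).eval t / D.eval t ^ 2 := by
  have hev : (fun z => ratVal f z) =ᶠ[nhds t] fun z => N.eval z / D.eval z := by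
    filter_upwards [D.continuous.continuousAt.eventually_ne ht] with z hz using h z hz
  rw [ratDeriv, hev.deriv_eq]
  have := (N.hasDerivAt t).fun_div (D.hasDerivAt t) ht
  rw [this.deriv]
  simp only [eval_sub, eval_mul]

end RatFunc

/-! ### The family of spheres of a rational squared medial axis transform -/

/-- `S` is the family `M` with its denominators cleared. -/
structure SphereFamily.Represents (S : SphereFamily) (M : SquaredMAT) : Prop where
  regular : ∀ t, S.den.eval t ≠ 0 ↔ (∀ i, RegularAt (M.s i) t) ∧ RegularAt M.R t
  center : ∀ t, S.den.eval t ≠ 0 → ∀ i, ratVal (M.s i) t = (S.ctr i).eval t / S.den.eval t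
  radius : ∀ t, S.den.eval t ≠ 0 → ratVal M.R t = S.rad.eval t / S.den.eval t

theorem SquaredMAT.exists_represents (M : SquaredMAT) : ∃ S : SphereFamily, S.Represents M := by
  obtain ⟨D, N, -, h1, h2⟩ := exists_common_denominator (Fin.cons M.R M.s : Fin 4 → RatFunc ℝ)
  refine ⟨⟨D, N 0, fun i => N i.succ⟩, fun t => ?_, fun t ht i => ?_, fun t ht => ?_⟩
  · change D.eval t ≠ 0 ↔ _
    rw [h1, Fin.forall_fin_succ, Fin.cons_zero, and_comm]
    simp only [Fin.cons_succ]
  · simpa using h2 t ht i.succ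
  · simpa using h2 t ht 0

namespace SphereFamily.Represents

variable {S : SphereFamily} {M : SquaredMAT} (hSM : S.Represents M)
include hSM

theorem deriv_center {t : ℂ} (ht : S.den.eval t ≠ 0) (i : Fin 3) :
    ratDeriv (M.s i) t = (S.vel i).eval t / S.den.eval t ^ 2 :=
  ratDeriv_eq (fun t ht => hSM.center t ht i) ht

theorem deriv_radius {t : ℂ} (ht : S.den.eval t ≠ 0) :
    ratDeriv M.R t = S.radVel.eval t / S.den.eval t ^ 2 :=
  ratDeriv_eq hSM.radius ht

theorem admissible_iff {t : ℂ} : M.Admissible t ↔ S.bad.eval t ≠ 0 := by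
  by_cases hD : S.den.eval t = 0
  · refine iff_of_false (fun h => (hSM.regular t).2 ⟨h.1, h.2.1⟩ hD) ?_
    simp [SphereFamily.bad, hD]
  · have h1 := (hSM.regular t).1 hD
    simp only [SquaredMAT.Admissible, h1.1, h1.2, implies_true, true_and, hSM.deriv_center hD,
      hSM.deriv_radius hD, hSM.radius t hD, SphereFamily.bad, Polynomial.eval_mul,
      Polynomial.eval_sub, Polynomial.eval_pow, Polynomial.eval_ofNat, SphereFamily.speed,
      Polynomial.eval_finsetSum, mul_ne_zero_iff, ne_eq, hD, not_false_eq_true, div_pow,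
      ← Finset.sum_div]
    refine and_congr (not_congr ?_) (not_congr ?_)
    · rw [div_eq_zero_iff, or_iff_left (by positivity)]
    · rw [← sub_eq_zero (b := _ / _)]
      rw [show ∀ a b c e : ℂ, c ≠ 0 → (4 * (a / c) * (b / (c ^ 2) ^ 2) - e ^ 2 / (c ^ 2) ^ 2 = 0 ↔
        4 * a * b - c * e ^ 2 = 0) from fun a b c e hc => by
          rw [show 4 * (a / c) * (b / (c ^ 2) ^ 2) - e ^ 2 / (c ^ 2) ^ 2 =
            (4 * a * b - c * e ^ 2) / c ^ 5 by field_simp, div_eq_zero_iff,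
            or_iff_left (pow_ne_zero _ hc)]]
      exact hD

theorem mem_charCircle_iff {t : ℂ} (ht : S.den.eval t ≠ 0) {p : P3} :
    p ∈ M.charCircle t ↔ p.rep ∈ S.circleCone t := by
  have e : ∀ a b c : ℂ, c ≠ 0 → (a / c = b ↔ a = c * b) := fun a b c hc => by
    rw [div_eq_iff hc, mul_comm]
  rw [SquaredMAT.charCircle, SquaredMAT.sphere, SquaredMAT.normalPlane, Set.mem_inter_iff,
    Set.mem_ofPred_eq, Set.mem_ofPred_eq, SphereFamily.circleCone, Set.mem_ofPred_eq]
  simp only [hSM.center t ht, hSM.deriv_center ht, hSM.radius t ht, hSM.deriv_radius ht]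
  refine and_congr ?_ ?_
  · have : S.quad p.rep t = S.den.eval t ^ 2 *
        (∑ i : Fin 3, (p.rep i.succ - (S.ctr i).eval t / S.den.eval t * p.rep 0) ^ 2 -
          S.rad.eval t / S.den.eval t * p.rep 0 ^ 2) := by
      simp only [SphereFamily.quad, S.off_eq_eval, Fin.sum_univ_three, Polynomial.coe_aeval_eq_eval]
      field_simp
    rw [this, mul_eq_zero, or_iff_right (pow_ne_zero _ ht)]
  · have : S.lin p.rep t = S.den.eval t ^ 3 *
        (-2 * ∑ i : Fin 3, (S.vel i).eval t / S.den.eval t ^ 2 *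
          (p.rep i.succ - (S.ctr i).eval t / S.den.eval t * p.rep 0) -
          S.radVel.eval t / S.den.eval t ^ 2 * p.rep 0) := by
      simp only [SphereFamily.lin, S.off_eq_eval, Fin.sum_univ_three, Polynomial.coe_aeval_eq_eval]
      field_simp
    rw [this, mul_eq_zero, or_iff_right (pow_ne_zero _ ht)]

theorem isProper (hM : M.Proper) : S.IsProper := by
  obtain ⟨E, hE, hinj⟩ := hM
  refine ⟨hE.toFinset, fun t u ht hu hDt hDu h => hinj (by simpa using ht) (by simpa using hu) ?_⟩
  funext i
  change ratVal (M.s i) t = ratVal (M.s i) u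
  rw [hSM.center t hDt, hSM.center u hDu, div_eq_div_iff hDt hDu, h i]

theorem bad_ne_zero (hM : ∃ t, M.Admissible t) : S.bad ≠ 0 := by
  obtain ⟨t, ht⟩ := hM
  intro h
  have := hSM.admissible_iff.1 ht
  rw [h, Polynomial.eval_zero] at this
  exact this rfl

end SphereFamily.Represents

/-! ### Points of projective space -/

theorem exists_rep_mk (v : Fin 4 → ℂ) (hv : v ≠ 0) :
    ∃ c : ℂ, c ≠ 0 ∧ (Projectivization.mk ℂ v hv).rep = c • v := by
  obtain ⟨a, ha⟩ := Projectivization.exists_smul_eq_mk_rep ℂ v hv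
  exact ⟨a, a.ne_zero, ha.symm⟩

theorem mk_eq_of_rep_eq_smul {p : P3} {v : Fin 4 → ℂ} (hv : v ≠ 0) {c : ℂ} (h : p.rep = c • v) :
    p = Projectivization.mk ℂ v hv := by
  conv_lhs => rw [← p.mk_rep]
  exact (Projectivization.mk_eq_mk_iff' ℂ _ _ _ _).2 ⟨c, h.symm⟩

theorem eval_smul_eq_zero_iff {f : MvPolynomial (Fin 4) ℂ} {d : ℕ} (hf : f.IsHomogeneous d) {c : ℂ}
    (hc : c ≠ 0) (v : Fin 4 → ℂ) :
    MvPolynomial.eval (c • v) f = 0 ↔ MvPolynomial.eval v f = 0 := by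
  rw [eval_smul_of_isHomogeneous hf, mul_eq_zero, or_iff_right (pow_ne_zero _ hc)]

theorem mk_mem_projZeros_iff {f : MvPolynomial (Fin 4) ℂ} {d : ℕ} (hf : f.IsHomogeneous d)
    {v : Fin 4 → ℂ} (hv : v ≠ 0) :
    Projectivization.mk ℂ v hv ∈ projZeros f ↔ MvPolynomial.eval v f = 0 := by
  obtain ⟨c, hc, h⟩ := exists_rep_mk v hv
  rw [projZeros, Set.mem_ofPred_eq, h, eval_smul_eq_zero_iff hf hc]

theorem mem_planeOf_iff {h : Fin 4 → ℂ} {p : P3} : p ∈ planeOf h ↔ h ⬝ᵥ p.rep = 0 := Iff.rfl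

theorem planeOf_smul {c : ℂ} (hc : c ≠ 0) (h : Fin 4 → ℂ) : planeOf (c • h) = planeOf h := by
  ext p
  rw [mem_planeOf_iff, mem_planeOf_iff, smul_dotProduct, smul_eq_zero, or_iff_right hc]

/-- Genericity of a property of planes may be tested with an inhomogeneous polynomial. -/
theorem ForGenericPlane.of_ne_zero {Q : Set P3 → Prop} {G : MvPolynomial (Fin 4) ℂ} (hG : G ≠ 0)
    (h : ∀ k, MvPolynomial.eval k G ≠ 0 → Q (planeOf k)) : ForGenericPlane fun k => Q (planeOf k) := by
  obtain ⟨k, hk⟩ : ∃ k, MvPolynomial.eval k G ≠ 0 := by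
    by_contra! H
    exact hG (MvPolynomial.funext fun k => by rw [H k, map_zero])
  obtain ⟨n, hn⟩ := exists_eval_homogeneousComponent_ne_zero hk
  refine ⟨n, _, G.homogeneousComponent_isHomogeneous n, fun h0 => hn (by rw [h0, map_zero]),
    fun v _ hv => ?_⟩
  -- A plane does not change when its coefficients are scaled, so it suffices that G is nonzero at
  -- some nonzero multiple of v. The additional factor `X` excludes the multiple 0.
  obtain ⟨P, hP, hPc⟩ := exists_poly_line G v
  have hP0 : P * Polynomial.X ≠ 0 := by
    refine mul_ne_zero ?_ Polynomial.X_ne_zero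
    rintro rfl
    apply hv; rw [← hPc, Polynomial.coeff_zero]
  obtain ⟨c, hc⟩ : ∃ c, (P * Polynomial.X).eval c ≠ 0 := by
    by_contra! H
    exact hP0 (Polynomial.funext fun c => by rw [H c, Polynomial.eval_zero])
  rw [Polynomial.eval_mul, Polynomial.eval_X, hP] at hc
  rw [← planeOf_smul (right_ne_zero_of_mul hc)]
  exact h _ (left_ne_zero_of_mul hc)

/-! ### The canal surface and the vanishing ideal -/

theorem SphereFamily.exists_mem_cone_ne_zero (S : SphereFamily) (hS : S.bad ≠ 0) :
    ∃ w ∈ S.cone, w 0 ≠ 0 := by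
  have := S.X_zero_not_mem_idl hS
  rw [S.mem_idl] at this
  push Not at this
  simpa using this

theorem SphereFamily.forall_eval_smul_iff (S : SphereFamily) {c : ℂ} (hc : c ≠ 0) (v : Fin 4 → ℂ) :
    (∀ f ∈ S.idl, MvPolynomial.eval (c • v) f = 0) ↔ ∀ f ∈ S.idl, MvPolynomial.eval v f = 0 := by
  have key : ∀ (c : ℂ) (_ : c ≠ 0) (v : Fin 4 → ℂ), (∀ f ∈ S.idl, MvPolynomial.eval v f = 0) →
      ∀ f ∈ S.idl, MvPolynomial.eval (c • v) f = 0 := by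
    intro c hc v h f hf
    rw [← f.sum_homogeneousComponent, map_sum]
    refine Finset.sum_eq_zero fun n _ => ?_
    rw [eval_smul_of_isHomogeneous (f.homogeneousComponent_isHomogeneous n),
      h _ (S.homogeneousComponent_mem_idl hf n), mul_zero]
  refine ⟨fun h => ?_, key c hc v⟩
  have := key c⁻¹ (inv_ne_zero hc) _ h
  rwa [smul_smul, inv_mul_cancel₀ hc, one_smul] at this

namespace SphereFamily.Represents

variable {S : SphereFamily} {M : SquaredMAT} (hSM : S.Represents M)
include hSM

theorem mem_circles_iff {p : P3} :
    p ∈ {p | ∃ t : ℂ, M.Admissible t ∧ p ∈ M.charCircle t} ↔ p.rep ∈ S.cone := by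
  rw [Set.mem_ofPred_eq, SphereFamily.cone, Set.mem_ofPred_eq]
  refine exists_congr fun t => ?_
  rw [hSM.admissible_iff]
  exact and_congr_right fun ht => hSM.mem_charCircle_iff (S.den_ne_zero ht)

theorem mem_idl_iff_subset (hS : S.bad ≠ 0) {f : MvPolynomial (Fin 4) ℂ} {d : ℕ}
    (hf : f.IsHomogeneous d) : f ∈ S.idl ↔
      {p | ∃ t : ℂ, M.Admissible t ∧ p ∈ M.charCircle t} ⊆ projZeros f := by
  rw [S.mem_idl]
  constructor
  · intro h p hp
    exact h _ (hSM.mem_circles_iff.1 hp)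
  · intro h
    have key : ∀ v ∈ S.cone, v ≠ 0 → MvPolynomial.eval v f = 0 := fun v hv hv0 => by
      rw [← mk_mem_projZeros_iff hf hv0]
      apply h
      rw [hSM.mem_circles_iff]
      obtain ⟨c, -, hc⟩ := exists_rep_mk v hv0
      rw [hc]; exact S.smul_mem_cone c hv
    intro v hv
    -- The zero vector belongs to the cone but to no projective point. A form that vanishes at some
    -- nonzero w vanishes at 0 · w as well, also in degree zero.
    by_cases hv0 : v = 0
    · obtain ⟨w, hw, hw0⟩ := S.exists_mem_cone_ne_zero hS
      have h1 := key w hw (fun h => hw0 (congrFun h 0))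
      rw [hv0, ← zero_smul ℂ w, eval_smul_of_isHomogeneous hf, h1, mul_zero]
    · exact key v hv hv0

theorem mem_surface_iff (hS : S.bad ≠ 0) {p : P3} :
    p ∈ zariskiClosure {p | ∃ t : ℂ, M.Admissible t ∧ p ∈ M.charCircle t} ↔
      ∀ f ∈ S.idl, MvPolynomial.eval p.rep f = 0 := by
  constructor
  · intro hp f hf
    rw [← f.sum_homogeneousComponent, map_sum]
    refine Finset.sum_eq_zero fun n _ => ?_
    exact hp n _ (f.homogeneousComponent_isHomogeneous n)
      ((hSM.mem_idl_iff_subset hS (f.homogeneousComponent_isHomogeneous n)).1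
        (S.homogeneousComponent_mem_idl hf n))
  · intro h d f hf hsub
    exact h f ((hSM.mem_idl_iff_subset hS hf).2 hsub)

theorem forall_eval_idl_iff (hS : S.bad ≠ 0) {X : Set P3} (hX : M.IsCanalSurface X) :
    ∃ F : MvPolynomial (Fin 4) ℂ,
      ∀ v, (∀ f ∈ S.idl, MvPolynomial.eval v f = 0) ↔ MvPolynomial.eval v F = 0 := by
  obtain ⟨-, hX1, d, F, hF, hX2⟩ := hX
  have hF' := hF.map (algebraMap ℝ ℂ)
  have key : ∀ v : Fin 4 → ℂ, v ≠ 0 → ((∀ f ∈ S.idl, MvPolynomial.eval v f = 0) ↔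
      MvPolynomial.eval v (MvPolynomial.map (algebraMap ℝ ℂ) F) = 0) := by
    intro v hv
    obtain ⟨c, hc, h⟩ := exists_rep_mk v hv
    rw [← S.forall_eval_smul_iff hc, ← h, ← hSM.mem_surface_iff hS, ← hX1, hX2,
      mk_mem_projZeros_iff hF' hv]
  refine ⟨MvPolynomial.map (algebraMap ℝ ℂ) F, fun v => ?_⟩
  by_cases hv : v = 0
  · refine iff_of_true (fun f hf => S.mem_idl.1 hf _ (hv ▸ S.zero_mem_cone hS)) ?_
    obtain ⟨w, hw, hw0⟩ := S.exists_mem_cone_ne_zero hS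
    have h1 := (key w fun h => hw0 (congrFun h 0)).1 fun f hf => S.mem_idl.1 hf w hw
    rw [hv, ← zero_smul ℂ w, eval_smul_of_isHomogeneous hF', h1, mul_zero]
  · exact key v hv

end SphereFamily.Represents

/-! ### The spine curve -/

/-- Extends the equations of the spine to the roots of `den`, where the family has a pole but the
homogeneous coordinates of the center still have values. -/
theorem eval_eq_zero_of_eval_ne_zero {s : Fin 4 → Polynomial ℂ} {b : Polynomial ℂ} (hb : b ≠ 0)
    {f : MvPolynomial (Fin 4) ℂ}
    (h : ∀ t, b.eval t ≠ 0 → MvPolynomial.eval (fun i => (s i).eval t) f = 0) (t : ℂ) :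
    MvPolynomial.eval (fun i => (s i).eval t) f = 0 := by
  have hP : ∀ t, (MvPolynomial.aeval s f).eval t = MvPolynomial.eval (fun i => (s i).eval t) f := by
    intro t
    have := MvPolynomial.map_aeval s (Polynomial.evalRingHom t) f
    rw [Polynomial.coe_evalRingHom] at this
    rw [this, MvPolynomial.eval, MvPolynomial.coe_eval₂Hom]
    congr 1
    ext x; simp
  have h0 : b * MvPolynomial.aeval s f = 0 := Polynomial.funext fun t => by
    rw [Polynomial.eval_mul, hP, Polynomial.eval_zero]
    by_cases hbt : b.eval t = 0
    · rw [hbt, zero_mul]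
    · rw [h t hbt, mul_zero]
  rw [← hP, (mul_eq_zero.1 h0).resolve_left hb, Polynomial.eval_zero]

theorem spinePoint_eq_mk {M : SquaredMAT} {t : ℂ} {v : Fin 4 → ℂ} (hv : v ≠ 0)
    (h0 : v 0 ≠ 0) (h : ∀ i : Fin 3, ratVal (M.s i) t = v i.succ / v 0) :
    M.spinePoint t = Projectivization.mk ℂ v hv := by
  rw [SquaredMAT.spinePoint, Projectivization.mk_eq_mk_iff']
  refine ⟨(v 0)⁻¹, funext fun i => ?_⟩
  refine Fin.cases ?_ (fun i => ?_) i
  · simp [h0]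
  · simp [h, div_eq_inv_mul]

/-- All but finitely many points of the spine curve are centers of the family. -/
theorem SquaredMAT.exists_finite_spine (M : SquaredMAT) :
    ∃ T : Set P3, T.Finite ∧ ∀ q ∈ M.spine, q ∉ T → ∃ t, M.spinePoint t = q := by
  -- The poles of the squared radius play no role here: centers at such parameters belong to the
  -- spine as well.
  obtain ⟨D, N, hD, hreg, hval⟩ := exists_common_denominator M.s
  obtain ⟨W, hW⟩ := exists_finset_closure (Fin.cons D N : Fin 4 → Polynomial ℂ) hD
  refine ⟨{p | ∃ w ∈ W, p.rep ∈ Submodule.span ℂ {w}}, ?_, fun q hq hqT => ?_⟩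
  · refine (W.finite_toSet.biUnion fun w _ => ?_ :
      (⋃ w ∈ (W : Set (Fin 4 → ℂ)), {p : P3 | p.rep ∈ Submodule.span ℂ {w}}).Finite).subset ?_
    · refine Set.Subsingleton.finite fun p hp q hq => ?_
      obtain ⟨a, ha⟩ := Submodule.mem_span_singleton.1 hp
      obtain ⟨b, hb⟩ := Submodule.mem_span_singleton.1 hq
      have hw : w ≠ 0 := by
        rintro rfl
        exact p.rep_nonzero (by rw [← ha, smul_zero])
      rw [mk_eq_of_rep_eq_smul hw ha.symm, mk_eq_of_rep_eq_smul hw hb.symm]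
    · rintro p ⟨w, hw, hp⟩
      exact Set.mem_biUnion (Finset.mem_coe.2 hw) hp
  · have key : ∀ f : MvPolynomial (Fin 4) ℂ, (∀ t c : ℂ,
        ((Fin.cons D N : Fin 4 → Polynomial ℂ) 0).eval t ≠ 0 → MvPolynomial.eval
          (fun i => c * ((Fin.cons D N : Fin 4 → Polynomial ℂ) i).eval t) f = 0) →
        MvPolynomial.eval q.rep f = 0 := by
      intro f hf
      rw [← f.sum_homogeneousComponent, map_sum]
      refine Finset.sum_eq_zero fun n _ => ?_
      refine hq n _ (f.homogeneousComponent_isHomogeneous n) ?_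
      rintro _ ⟨t, ht, rfl⟩
      have hDt := (hreg t).2 ht
      have hne : (fun i => ((Fin.cons D N : Fin 4 → Polynomial ℂ) i).eval t) ≠ 0 :=
        fun h => hDt (congrFun h 0)
      rw [spinePoint_eq_mk hne hDt fun i => hval t hDt i,
        mk_mem_projZeros_iff (f.homogeneousComponent_isHomogeneous n)]
      exact eval_homogeneousComponent_eq_zero (fun c => hf t c hDt) n
    rcases hW q.rep key with h | ⟨t, ht, h⟩
    · exact absurd h hqT
    · obtain ⟨c, hc⟩ := Submodule.mem_span_singleton.1 h
      have hne : (fun i => ((Fin.cons D N : Fin 4 → Polynomial ℂ) i).eval t) ≠ 0 :=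
        fun h => ht (congrFun h 0)
      refine ⟨t, ?_⟩
      rw [mk_eq_of_rep_eq_smul hne hc.symm]
      exact spinePoint_eq_mk hne ht fun i => hval t ht i

/-! ### Substitution of a fraction -/

section Subst

open Polynomial

variable {σ : Type*}

/-- The polynomial `b ^ m * P (a / b)`, for `m` at least the degree of `P`. -/
def fracSubst (P : (MvPolynomial σ ℂ)[X]) (m : ℕ) (a b : MvPolynomial σ ℂ) : MvPolynomial σ ℂ :=
  ∑ j ∈ Finset.range (m + 1), P.coeff j * (a ^ j * b ^ (m - j))

theorem eval_fracSubst {P : (MvPolynomial σ ℂ)[X]} {m : ℕ} (hP : P.natDegree ≤ m)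
    {a b : MvPolynomial σ ℂ} {v : σ → ℂ} {t : ℂ}
    (ht : MvPolynomial.eval v b * t = MvPolynomial.eval v a) :
    MvPolynomial.eval v (fracSubst P m a b) =
      MvPolynomial.eval v b ^ m * (P.map (MvPolynomial.eval v)).eval t := by
  rw [eval_eq_sum_range' (Nat.lt_succ_of_le (natDegree_map_le.trans hP)), Finset.mul_sum, fracSubst,
    map_sum]
  refine Finset.sum_congr rfl fun j hj => ?_
  have hj : j ≤ m := Nat.lt_succ_iff.1 (Finset.mem_range.1 hj)
  obtain ⟨k, rfl⟩ := Nat.exists_eq_add_of_le hj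
  rw [Nat.add_sub_cancel_left, map_mul, map_mul, map_pow, map_pow, ← ht, coeff_map]
  ring

/-- The only term without a factor b is the one with j = m, and its coefficient is zero because m
exceeds the degree. For this reason `centerForm` uses the maximal degree plus one: ξ is undefined
wherever b vanishes, so that no stray points enter the fibers. -/
theorem eval_fracSubst_eq_zero {P : (MvPolynomial σ ℂ)[X]} {m : ℕ} (hP : P.natDegree < m)
    {a b : MvPolynomial σ ℂ} {v : σ → ℂ} (hb : MvPolynomial.eval v b = 0) :
    MvPolynomial.eval v (fracSubst P m a b) = 0 := by
  rw [fracSubst, map_sum]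
  refine Finset.sum_eq_zero fun j hj => ?_
  rw [Finset.mem_range, Nat.lt_succ_iff] at hj
  rcases hj.lt_or_eq with hj | rfl
  · rw [map_mul, map_mul, map_pow, map_pow, hb, zero_pow (Nat.sub_ne_zero_of_lt hj), mul_zero,
      mul_zero]
  · rw [coeff_eq_zero_of_natDegree_lt hP, zero_mul, map_zero]

theorem fracSubst_isHomogeneous (p : ℂ[X]) (m : ℕ) {a b : MvPolynomial σ ℂ} {d : ℕ}
    (ha : a.IsHomogeneous d) (hb : b.IsHomogeneous d) :
    (fracSubst (p.map MvPolynomial.C) m a b).IsHomogeneous (d * m) := by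
  refine MvPolynomial.IsHomogeneous.sum _ _ _ fun j hj => ?_
  rw [Finset.mem_range, Nat.lt_succ_iff] at hj
  obtain ⟨k, rfl⟩ := Nat.exists_eq_add_of_le hj
  rw [coeff_map, Nat.add_sub_cancel_left]
  have := (MvPolynomial.isHomogeneous_C σ (p.coeff j)).mul ((ha.pow j).mul (hb.pow k))
  rwa [show 0 + (d * j + d * k) = d * (j + k) by ring] at this

theorem map_C_map_eval (p : ℂ[X]) (v : σ → ℂ) :
    (p.map (MvPolynomial.C (σ := σ))).map (MvPolynomial.eval v) = p := by
  rw [map_map]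
  have : (MvPolynomial.eval v).comp (MvPolynomial.C (σ := σ)) = RingHom.id ℂ := by ext; simp
  rw [this, map_id]

end Subst

/-! ### The rational map to the spine curve and its fibers -/

namespace SphereFamily

variable (S : SphereFamily)

/-- Homogeneous coordinates of the centers. -/
def homCtr : Fin 4 → Polynomial ℂ := Fin.cons S.den S.ctr

/-- The center at the parameter `a / b`, in homogeneous coordinates without denominators. -/
def centerForm (a b : MvPolynomial (Fin 4) ℂ) (i : Fin 4) : MvPolynomial (Fin 4) ℂ :=
  fracSubst ((S.homCtr i).map MvPolynomial.C)
    ((Finset.univ.sup fun i => (S.homCtr i).natDegree) + 1) a b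

variable {S}

theorem eval_centerForm {a b : MvPolynomial (Fin 4) ℂ} {v : Fin 4 → ℂ} {t : ℂ}
    (ht : MvPolynomial.eval v b * t = MvPolynomial.eval v a) :
    (fun i => MvPolynomial.eval v (S.centerForm a b i)) =
      (MvPolynomial.eval v b ^ ((Finset.univ.sup fun i => (S.homCtr i).natDegree) + 1)) •
        fun i => (S.homCtr i).eval t := by
  funext i
  have hi := Finset.le_sup (f := fun i => (S.homCtr i).natDegree) (Finset.mem_univ i)
  rw [centerForm, eval_fracSubst (Polynomial.natDegree_map_le.trans (hi.trans (Nat.le_succ _))) ht,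
    map_C_map_eval]
  rfl

theorem eval_centerForm_eq_zero {a b : MvPolynomial (Fin 4) ℂ} {v : Fin 4 → ℂ}
    (hb : MvPolynomial.eval v b = 0) : (fun i => MvPolynomial.eval v (S.centerForm a b i)) = 0 := by
  funext i
  have hi := Finset.le_sup (f := fun i => (S.homCtr i).natDegree) (Finset.mem_univ i)
  exact eval_fracSubst_eq_zero
    (Polynomial.natDegree_map_le.trans_lt (Nat.lt_succ_of_le hi)) hb

/-- On the zero set of the vanishing ideal, the rational inverse recovers the circle. -/
theorem mem_circleCone_of_inverse {a b : MvPolynomial (Fin 4) ℂ}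
    (hab : ∀ t, S.bad.eval t ≠ 0 → ∀ v ∈ S.circleCone t,
      MvPolynomial.eval v b * t = MvPolynomial.eval v a)
    {v : Fin 4 → ℂ} (hv : ∀ f ∈ S.idl, MvPolynomial.eval v f = 0) {t : ℂ}
    (hb : MvPolynomial.eval v b ≠ 0) (ht : MvPolynomial.eval v b * t = MvPolynomial.eval v a) :
    v ∈ S.circleCone t := by
  -- A relation between point and parameter that holds along all circles gives, with a/b in place of
  -- t and without denominators, an element of the ideal, which vanishes at v.
  have key : ∀ P : Polynomial (MvPolynomial (Fin 4) ℂ), (∀ u, ∀ w ∈ S.circleCone u,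
      (P.map (MvPolynomial.eval w)).eval u = 0) → (P.map (MvPolynomial.eval v)).eval t = 0 := by
    intro P hP
    have h1 : fracSubst P P.natDegree a b ∈ S.idl := by
      rw [S.mem_idl]
      rintro w ⟨u, hu, hw⟩
      rw [eval_fracSubst le_rfl (hab u hu w hw), hP u w hw, mul_zero]
    have h2 := hv _ h1
    rw [eval_fracSubst le_rfl ht] at h2
    exact (mul_eq_zero.1 h2).resolve_left (pow_ne_zero _ hb)
  refine ⟨?_, ?_⟩
  · rw [← S.eval_map_quadPoly]
    exact key _ fun u w hw => by rw [S.eval_map_quadPoly]; exact hw.1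
  · rw [← S.eval_map_linPoly]
    exact key _ fun u w hw => by rw [S.eval_map_linPoly]; exact hw.2

namespace Represents

variable {M : SquaredMAT} (hSM : S.Represents M)
include hSM

theorem spinePoint_eq {t : ℂ} (ht : S.den.eval t ≠ 0) {c : ℂ} (hc : c ≠ 0)
    (hne : c • (fun i => (S.homCtr i).eval t) ≠ 0) :
    M.spinePoint t = Projectivization.mk ℂ (c • fun i => (S.homCtr i).eval t) hne := by
  refine spinePoint_eq_mk hne (mul_ne_zero hc ht) fun i => ?_
  rw [hSM.center t ht]
  exact (mul_div_mul_left _ _ hc).symm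

theorem mk_mem_spine (hS : S.bad ≠ 0) {t : ℂ} {c : ℂ}
    (hne : c • (fun i => (S.homCtr i).eval t) ≠ 0) :
    Projectivization.mk ℂ (c • fun i => (S.homCtr i).eval t) hne ∈ M.spine := by
  intro d f hf hsub
  have hden : S.den ≠ 0 := by
    intro h; apply hS; simp [SphereFamily.bad, h]
  rw [mk_mem_projZeros_iff hf, eval_smul_of_isHomogeneous hf,
    eval_eq_zero_of_eval_ne_zero hden (fun u hu => ?_) t, mul_zero]
  have hne' : (1 : ℂ) • (fun i => (S.homCtr i).eval u) ≠ 0 := fun h =>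
    hu (by simpa [homCtr] using congrFun h 0)
  have h1 := hsub ⟨u, ((hSM.regular u).1 hu).1, rfl⟩
  rwa [hSM.spinePoint_eq hu one_ne_zero hne', mk_mem_projZeros_iff hf, one_smul] at h1

theorem spinePoint_injective {E : Finset ℂ} (hE : ∀ t u, t ∉ E → u ∉ E → S.den.eval t ≠ 0 →
    S.den.eval u ≠ 0 → (∀ i, (S.ctr i).eval t * S.den.eval u = (S.ctr i).eval u * S.den.eval t) →
      t = u) {t u : ℂ} (ht : t ∉ E) (hu : u ∉ E) (hDt : S.den.eval t ≠ 0)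
    (hDu : S.den.eval u ≠ 0) (h : M.spinePoint t = M.spinePoint u) : t = u := by
  refine hE t u ht hu hDt hDu fun i => ?_
  rw [SquaredMAT.spinePoint, SquaredMAT.spinePoint, Projectivization.mk_eq_mk_iff'] at h
  obtain ⟨c, hc⟩ := h
  have h0 := congrFun hc 0
  have hi := congrFun hc i.succ
  simp only [Pi.smul_apply, Fin.cons_zero, Fin.cons_succ, smul_eq_mul, mul_one] at h0 hi
  rw [h0, one_mul, hSM.center t hDt, hSM.center u hDu, div_eq_div_iff hDu hDt] at hi
  exact hi.symm

/-- The rational map from a plane section of the canal surface to the spine curve. -/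
def spineMap (hS : S.bad ≠ 0) {a b : MvPolynomial (Fin 4) ℂ} {d : ℕ} (ha : a.IsHomogeneous d)
    (hb : b.IsHomogeneous d) (H : Set P3)
    (hdense : H ⊆ zariskiClosure
      {p | p ∈ H ∧ (fun i => MvPolynomial.eval p.rep (S.centerForm a b i)) ≠ 0}) :
    RationalMap H M.spine where
  degree := _
  coord := S.centerForm a b
  homogeneous i := fracSubst_isHomogeneous _ _ ha hb
  dense := hdense
  mapsTo p _ hp := by
    have hbp : MvPolynomial.eval p.rep b ≠ 0 := fun h => hp (eval_centerForm_eq_zero h)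
    have ht : MvPolynomial.eval p.rep b * (MvPolynomial.eval p.rep a / MvPolynomial.eval p.rep b) =
      MvPolynomial.eval p.rep a := mul_div_cancel₀ _ hbp
    have hev := eval_centerForm (S := S) ht
    simp only [hev] at hp ⊢
    exact hSM.mk_mem_spine hS hp

theorem exists_coherent (hS : S.bad ≠ 0) (hprop : S.IsProper) {X : Set P3}
    (hX : ∀ p, p ∈ X ↔ ∀ f ∈ S.idl, MvPolynomial.eval p.rep f = 0)
    {a b : MvPolynomial (Fin 4) ℂ} {d : ℕ} (ha : a.IsHomogeneous d) (hb : b.IsHomogeneous d)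
    (hab : ∀ t, S.bad.eval t ≠ 0 → ∀ v ∈ S.circleCone t,
      MvPolynomial.eval v b * t = MvPolynomial.eval v a)
    {h : Fin 4 → ℂ} (hdense : X ∩ planeOf h ⊆ zariskiClosure {p | p ∈ X ∩ planeOf h ∧
      (fun i => MvPolynomial.eval p.rep (S.centerForm a b i)) ≠ 0})
    {P : Polynomial ℂ} (hP : P ≠ 0) (hsec : ∀ t, P.eval t ≠ 0 → S.bad.eval t ≠ 0 ∧
      ∃ x y, LinearIndependent ℂ ![x, y] ∧ MvPolynomial.eval x b ≠ 0 ∧ MvPolynomial.eval y b ≠ 0 ∧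
        ∀ v, (v ∈ S.circleCone t ∧ h ⬝ᵥ v = 0) ↔ ∃ c : ℂ, v = c • x ∨ v = c • y) :
    ∃ ξ : RationalMap (X ∩ planeOf h) M.spine, IsCoherent M h ξ := by
  refine ⟨hSM.spineMap hS ha hb _ hdense, ?_⟩
  obtain ⟨E, hE⟩ := hprop
  obtain ⟨T, hT, hT'⟩ := M.exists_finite_spine
  -- Excluded are the points of the closure that are not centers, and the centers of parameters at
  -- which injectivity may fail or the section is not a good pair of points.
  refine ⟨T ∪ M.spinePoint '' (E ∪ P.roots.toFinset : Set ℂ),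
    hT.union ((E.finite_toSet.union (Finset.finite_toSet _)).image _), fun q hq hqT => ?_⟩
  simp only [Set.mem_union, not_or] at hqT
  obtain ⟨t, ht⟩ := hT' q hq hqT.1
  have hgood : ∀ u, M.spinePoint u = q → u ∉ E ∧ P.eval u ≠ 0 := fun u hu => by
    refine ⟨fun h => hqT.2 ⟨u, .inl h, hu⟩, fun h => hqT.2 ⟨u, .inr ?_, hu⟩⟩
    rw [Finset.mem_coe, Multiset.mem_toFinset, Polynomial.mem_roots hP]; exact h
  obtain ⟨hbad, x, y, hxy, hbx, hby, hmem⟩ := hsec t (hgood t ht).2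
  have hden := S.den_ne_zero hbad
  have huniq : ∀ u, S.den.eval u ≠ 0 → M.spinePoint u = q → u = t := fun u hu huq =>
    hSM.spinePoint_injective hE (hgood u huq).1 (hgood t ht).1 hu hden (huq.trans ht.symm)
  have hcirc : ∀ p, p ∈ planeOf h ∩ M.charCircleAt q ↔ p.rep ∈ S.circleCone t ∧ h ⬝ᵥ p.rep = 0 := by
    intro p
    rw [Set.mem_inter_iff, mem_planeOf_iff, and_comm]
    refine and_congr_left fun _ => ⟨?_, fun hp => ?_⟩
    · rintro ⟨u, hu, huq, hpu⟩
      have hDu := S.den_ne_zero (hSM.admissible_iff.1 hu)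
      rw [← huniq u hDu huq]
      exact (hSM.mem_charCircle_iff hDu).1 hpu
    · exact ⟨t, hSM.admissible_iff.2 hbad, ht, (hSM.mem_charCircle_iff hden).2 hp⟩
  have hx0 : x ≠ 0 := hxy.ne_zero 0
  have hy0 : y ≠ 0 := hxy.ne_zero 1
  constructor
  · ext p
    rw [hcirc]
    constructor
    · rintro ⟨⟨hpX, hph⟩, hne, hmk⟩
      change (fun i => MvPolynomial.eval p.rep (S.centerForm a b i)) ≠ 0 at hne
      change Projectivization.mk ℂ (fun i => MvPolynomial.eval p.rep (S.centerForm a b i)) hne = q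
        at hmk
      refine ⟨?_, hph⟩
      have hbp : MvPolynomial.eval p.rep b ≠ 0 := fun h => hne (eval_centerForm_eq_zero h)
      have hu : MvPolynomial.eval p.rep b *
        (MvPolynomial.eval p.rep a / MvPolynomial.eval p.rep b) = MvPolynomial.eval p.rep a :=
        mul_div_cancel₀ _ hbp
      have hev := eval_centerForm (S := S) hu
      simp only [hev] at hne hmk
      -- A root of `den` would give an image point at infinity, whereas q is a center.
      have hDu : S.den.eval (MvPolynomial.eval p.rep a / MvPolynomial.eval p.rep b) ≠ 0 := by
        intro h0
        rw [← ht, SquaredMAT.spinePoint, Projectivization.mk_eq_mk_iff'] at hmk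
        obtain ⟨c, hc⟩ := hmk
        have h1 := congrFun hc 0
        simp only [Pi.smul_apply, Fin.cons_zero, smul_eq_mul, mul_one, homCtr, h0, mul_zero] at h1
        rw [h1, zero_smul] at hc
        exact hne hc.symm
      rw [← hSM.spinePoint_eq hDu (pow_ne_zero _ hbp)] at hmk
      rw [huniq _ hDu hmk] at hu
      exact mem_circleCone_of_inverse hab ((hX p).1 hpX) hbp hu
    · rintro ⟨hp, hph⟩
      have hbp : MvPolynomial.eval p.rep b ≠ 0 := by
        obtain ⟨c, hc⟩ := (hmem _).1 ⟨hp, hph⟩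
        have hc0 : c ≠ 0 := by
          rintro rfl
          simp only [zero_smul, or_self] at hc
          exact p.rep_nonzero hc
        rcases hc with hc | hc <;> rw [hc, ne_eq, eval_smul_eq_zero_iff hb hc0]
        · exact hbx
        · exact hby
      have hu := hab t hbad _ hp
      have hev := eval_centerForm (S := S) hu
      have hne : (fun i => MvPolynomial.eval p.rep (S.centerForm a b i)) ≠ 0 := by
        rw [hev]
        intro h0
        exact mul_ne_zero (pow_ne_zero _ hbp) hden (congrFun h0 0)
      refine ⟨⟨(hX p).2 fun f hf => S.mem_idl.1 hf _ ⟨t, hbad, hp⟩, hph⟩, hne, ?_⟩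
      change Projectivization.mk ℂ (fun i => MvPolynomial.eval p.rep (S.centerForm a b i)) hne = q
      simp only [hev] at hne ⊢
      rw [← hSM.spinePoint_eq hden (pow_ne_zero _ hbp), ht]
  · have hset : planeOf h ∩ M.charCircleAt q =
        {Projectivization.mk ℂ x hx0, Projectivization.mk ℂ y hy0} := by
      ext p
      rw [hcirc, hmem, Set.mem_insert_iff, Set.mem_singleton_iff]
      constructor
      · rintro ⟨c, hc | hc⟩
        · exact .inl (mk_eq_of_rep_eq_smul hx0 hc)
        · exact .inr (mk_eq_of_rep_eq_smul hy0 hc)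
      · rintro (rfl | rfl)
        · obtain ⟨c, -, hc⟩ := exists_rep_mk x hx0
          exact ⟨c, .inl hc⟩
        · obtain ⟨c, -, hc⟩ := exists_rep_mk y hy0
          exact ⟨c, .inr hc⟩
    rw [hset, Set.ncard_pair]
    intro heq
    obtain ⟨c, hc⟩ := (Projectivization.mk_eq_mk_iff' ℂ _ _ _ _).1 heq
    have := LinearIndependent.pair_iff.1 hxy 1 (-c) (by rw [hc.symm]; simp)
    exact one_ne_zero this.1

end Represents

end SphereFamily

theorem mainTheorem4 (M : SquaredMAT) (hM : M.Proper) (X : Set P3) (hX : M.IsCanalSurface X) :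
    ForGenericPlane (fun h =>
      ∃ ξ : RationalMap (X ∩ planeOf h) M.spine, IsCoherent M h ξ) := by
  obtain ⟨S, hSM⟩ := M.exists_represents
  have hS := hSM.bad_ne_zero hX.1
  have hprop := hSM.isProper hM
  obtain ⟨F, hF⟩ := hSM.forall_eval_idl_iff hS hX
  obtain ⟨F₁, hF₁, hirr⟩ := S.idl_eq_span hS hF
  obtain ⟨hF0, d, a, b, ha, hb, hbI, hab⟩ := SphereFamily.exists_rational_inverse hS hprop hF₁ hirr
  have hirr := hirr.resolve_left hF0
  have hXmem : ∀ p, p ∈ X ↔ ∀ f ∈ S.idl, MvPolynomial.eval p.rep f = 0 := fun p => by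
    rw [hX.2.1, hSM.mem_surface_iff hS]
  have hXF : ∀ v, (∀ f ∈ S.idl, MvPolynomial.eval v f = 0) ↔ MvPolynomial.eval v F₁ = 0 := by
    intro v
    refine ⟨fun h => h _ (hF₁ ▸ Ideal.mem_span_singleton_self F₁), fun h f hf => ?_⟩
    obtain ⟨g, rfl⟩ := Ideal.mem_span_singleton.1 (hF₁ ▸ hf)
    rw [map_mul, h, zero_mul]
  obtain ⟨v, hv, hbv⟩ : ∃ v ∈ S.cone, MvPolynomial.eval v b ≠ 0 := by
    rw [S.mem_idl] at hbI; push Not at hbI; exact hbI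
  obtain ⟨P, hP, hsec⟩ := S.exists_generic_section hv hb hbv
  -- On a circle the first form of the map equals a power of b times `den`, so it is not identically
  -- zero on X. The factor `X 0` keeps the vectors used for density nonzero, so that they represent
  -- points of the projective space.
  have hndvd : ¬ F₁ ∣ MvPolynomial.X 0 * S.centerForm a b 0 := by
    rw [← Ideal.mem_span_singleton, ← hF₁]
    have hprime := S.idl_isPrime hS
    intro h
    rcases hprime.mem_or_mem h with h | h
    · exact S.X_zero_not_mem_idl hS h
    · obtain ⟨t, ht, hvt⟩ := hv
      have h1 := S.mem_idl.1 h v ⟨t, ht, hvt⟩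
      rw [congrFun (SphereFamily.eval_centerForm (hab t ht v hvt)) 0] at h1
      exact mul_ne_zero (pow_ne_zero _ hbv) (S.den_ne_zero ht) h1
  obtain ⟨G, hG, hdense⟩ := exists_generic_dense hirr hndvd
  -- Coherence depends on the plane only as a set, so an inhomogeneous condition on h suffices.
  -- Where the leading coefficient of P is nonzero, P remains a nonzero polynomial in t, and all but
  -- finitely many circles have a good section.
  refine ForGenericPlane.of_ne_zero (Q := fun E => ∃ ξ : RationalMap (X ∩ E) M.spine,
    ∃ T : Set P3, T.Finite ∧ ∀ q ∈ M.spine, q ∉ T →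
      ξ.fiber q = E ∩ M.charCircleAt q ∧ (E ∩ M.charCircleAt q).ncard = 2)
    (mul_ne_zero hG (Polynomial.leadingCoeff_ne_zero.2 hP)) fun h hh => ?_
  rw [map_mul] at hh
  refine hSM.exists_coherent hS hprop hXmem ha hb hab (fun p hp e f hf hsub => ?_)
    (P := P.map (MvPolynomial.eval h)) (fun h0 => right_ne_zero_of_mul hh ?_) fun t ht => hsec t h ht
  · refine hdense h (left_ne_zero_of_mul hh) f (fun w hwF hwh hw => ?_) p.rep
      ((hXF _).1 ((hXmem p).1 hp.1)) hp.2
    rw [map_mul, MvPolynomial.eval_X] at hw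
    have hw0 : w ≠ 0 := fun h => left_ne_zero_of_mul hw (congrFun h 0)
    rw [← mk_mem_projZeros_iff hf hw0]
    apply hsub
    obtain ⟨c, hc, hrep⟩ := exists_rep_mk w hw0
    refine ⟨⟨?_, ?_⟩, fun h0 => right_ne_zero_of_mul hw ?_⟩
    · rw [hXmem, hrep, S.forall_eval_smul_iff hc, hXF]; exact hwF
    · rw [mem_planeOf_iff, hrep, dotProduct_smul, hwh, smul_zero]
    · have h1 := congrFun h0 0
      rw [hrep] at h1
      exact (eval_smul_eq_zero_iff (fracSubst_isHomogeneous _ _ ha hb) hc w).1 h1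
  · have := congrArg (fun p => Polynomial.coeff p P.natDegree) h0
    simpa using this

end
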